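/- Let $\rho\ge 2$, and let $l:\mathbb R\to\mathbb R$ be a measurable even function such that, for some constants $c_1,c_2>0$, $$c_1^2(1+\xi^2)^{\rho/2}\le l(\xi)\le c_2^2(1+\xi^2)^{\rho/2}\qquad\text{for all }\xi\in\mathbb R .$$ Let $L$ be the operator with symbol $l$, that is, $\mathcal F(Lv)(\xi)=l(\xi)\,\mathcal F(v)(\xi)$ with $\mathcal F(v)(\xi)=\int v(x)e^{-ix\xi}\,dx$, and put $\Lambda^{-1}w=\mathcal F^{-1}(|\xi|^{-1}\mathcal F w)$. Let $H^s=H^s(\mathbb R)$ denote the $L^2$ Sobolev space of real-valued functions (for $s<0$, of real tempered distributions) with norm $\|u\|_s^2=\int(1+\xi^2)^s|\mathcal F u(\xi)|^2\,d\xi$. Let $g:\mathbb R\to\mathbb R$ be of class $C^{[\rho/2]+1}$, where $[\cdot]$ is the integer part, and let $G(y)=\int_0^y g(p)\,dp$. Assume that $G(y)\ge 0$ for all $y\in\mathbb R$, that $\varphi\in H^{\rho/2}$ with $G(\varphi)\in L^1(\mathbb R)$, and that $\psi\in H^{-1}$ with $\Lambda^{-1}\psi\in L^2(\mathbb R)$.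 Then the Cauchy problem $$u_{tt}-Lu_{xx}=(g(u))_{xx},\quad x\in\mathbb R,\ t>0,\qquad u(x,0)=\varphi(x),\quad u_t(x,0)=\psi(x),$$ where the equation is understood in the sense of tempered distributions in $x$, has a unique global solution $$u\in C([0,\infty),H^{\rho/2})\cap C^1([0,\infty),H^{-1}).$$ -/

import Mathlib

open MeasureTheory TemperedDistribution Set
open scoped SchwartzMap FourierTransform LineDeriv

noncomputable section

namespace NonlocalWave

/-- The tempered distribution `f` is the (a.e. unique) function `F`, that is,
`⟨f, χ⟩ = ∫ χ(x) F(x) dx` for every Schwartz function `χ`. -/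
def IsFunction (f : 𝓢'(ℝ, ℂ)) (F : ℝ → ℂ) : Prop :=
  AEStronglyMeasurable F volume ∧
    ∀ χ : 𝓢(ℝ, ℂ), Integrable (fun x => χ x * F x) ∧ f χ = ∫ x, χ x * F x

/-- The tempered distribution `f` is real: it takes real values on real Schwartz functions. -/
def IsReal (f : 𝓢'(ℝ, ℂ)) : Prop :=
  ∀ χ : 𝓢(ℝ, ℂ), (∀ x, (χ x).im = 0) → (f χ).im = 0

/-- The real tempered distributions in the `L²` Sobolev space `H^s(ℝ)`, as a real subspace of the
space of tempered distributions. -/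
def sobolevSubmodule (s : ℝ) : Submodule ℝ 𝓢'(ℝ, ℂ) where
  carrier := {f | MemSobolev s 2 f ∧ IsReal f}
  add_mem' := by
    rintro f g ⟨hf, hf'⟩ ⟨hg, hg'⟩
    refine ⟨hf.add hg, fun χ hχ => ?_⟩
    have h : (f + g) χ = f χ + g χ := rfl
    rw [h, Complex.add_im, hf' χ hχ, hg' χ hχ, add_zero]
  zero_mem' := ⟨memSobolev_fun_zero ℝ ℂ s 2, fun _ _ => rfl⟩
  smul_mem' := by
    rintro c f ⟨hf, hf'⟩
    refine ⟨?_, fun χ hχ => ?_⟩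
    · have h : c • f = (c : ℂ) • f := by
        ext χ
        exact (Complex.coe_smul c (f χ)).symm
      rw [h]
      exact hf.smul _
    · have h : (c • f) χ = c • f χ := rfl
      rw [h, Complex.smul_im, hf' χ hχ, smul_zero]

/-- The Sobolev space `H^s = H^s(ℝ)` of real tempered distributions. -/
def H (s : ℝ) : Type := ↥(sobolevSubmodule s)

namespace H

variable {s : ℝ}

instance : AddCommGroup (H s) := inferInstanceAs (AddCommGroup ↥(sobolevSubmodule s))

instance : Module ℝ (H s) := inferInstanceAs (Module ℝ ↥(sobolevSubmodule s))

/-- The tempered distribution underlying an element of `H^s`. -/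
def dist : H s →ₗ[ℝ] 𝓢'(ℝ, ℂ) := (sobolevSubmodule s).subtype

theorem dist_injective : Function.Injective (dist : H s → 𝓢'(ℝ, ℂ)) := Subtype.val_injective

theorem memSobolev (f : H s) : MemSobolev s 2 (dist f) := f.2.1

theorem isReal (f : H s) : IsReal (dist f) := f.2.2

/-- The `L²` function given by the Bessel potential `(1 + D²)^{s/2} f` of an `f ∈ H^s`. -/
def besselFun (f : H s) : Lp ℂ 2 (volume : Measure ℝ) := (memSobolev f).choose

theorem besselFun_spec (f : H s) :
    besselPotential ℝ ℂ s (dist f) = (besselFun f : 𝓢'(ℝ, ℂ)) := (memSobolev f).choose_spec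

theorem lp_dist_injective :
    Function.Injective (fun f : Lp ℂ 2 (volume : Measure ℝ) => (f : 𝓢'(ℝ, ℂ))) :=
  LinearMap.ker_eq_bot.mp (Lp.ker_toTemperedDistributionCLM_eq_bot (F := ℂ) (p := 2)
    (μ := (volume : Measure ℝ)))

/-- The Bessel potential as a linear map `H^s → L²`. -/
def bessel (s : ℝ) : H s →ₗ[ℝ] Lp ℂ 2 (volume : Measure ℝ) where
  toFun := besselFun
  map_add' f g := by
    apply lp_dist_injective
    change ((besselFun (f + g) : Lp ℂ 2 (volume : Measure ℝ)) : 𝓢'(ℝ, ℂ)) =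
      Lp.toTemperedDistributionCLM ℂ volume 2 (besselFun f + besselFun g)
    rw [map_add, Lp.toTemperedDistributionCLM_apply, Lp.toTemperedDistributionCLM_apply,
      ← besselFun_spec, ← besselFun_spec, ← besselFun_spec, map_add, map_add]
  map_smul' c f := by
    apply lp_dist_injective
    have h1 : ∀ d : 𝓢'(ℝ, ℂ), c • d = (c : ℂ) • d := fun d => by
      ext χ
      exact (Complex.coe_smul c (d χ)).symm
    have h2 : ∀ v : Lp ℂ 2 (volume : Measure ℝ), c • v = (c : ℂ) • v := fun v =>
      (Complex.coe_smul c v).symm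
    change ((besselFun (c • f) : Lp ℂ 2 (volume : Measure ℝ)) : 𝓢'(ℝ, ℂ)) =
      Lp.toTemperedDistributionCLM ℂ volume 2 (c • besselFun f)
    rw [h2, map_smul, Lp.toTemperedDistributionCLM_apply, ← besselFun_spec, ← besselFun_spec,
      map_smul, h1, map_smul]

theorem bessel_injective : Function.Injective (bessel s) := by
  intro f g h
  apply dist_injective
  have h' : besselPotential ℝ ℂ s (dist f) = besselPotential ℝ ℂ s (dist g) := by
    rw [besselFun_spec, besselFun_spec]
    exact congrArg _ h
  have h2 := congrArg (besselPotential ℝ ℂ (-s)) h'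
  simpa using h2

/-- The Sobolev norm `‖(1 + D²)^{s/2} f‖_{L²}`, that is, the square root of
`∫ (1 + ξ²)^s |𝓕 f(ξ)|² dξ`. Here `𝓕` has the kernel `exp(-2πixξ)`; with `exp(-ixξ)` instead, the
same formula gives an equivalent norm. -/
instance : NormedAddCommGroup (H s) :=
  NormedAddCommGroup.induced (H s) (Lp ℂ 2 (volume : Measure ℝ)) (bessel s) bessel_injective

instance : NormedSpace ℝ (H s) := NormedSpace.induced ℝ (H s) (Lp ℂ 2 (volume : Measure ℝ)) (bessel s)

/-- The inclusion `H^s ⊆ H^r` for `r ≤ s`. -/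
def incl {s r : ℝ} (h : r ≤ s) (f : H s) : H r := ⟨dist f, (memSobolev f).mono h, isReal f⟩

end H

/-- `h = m(D) f`: the Fourier transform of `f` is a function, and the Fourier transform of `h` is
the product of that function with the symbol `m`. Symbols are functions of the angular frequency;
Mathlib's `𝓕 f` at `ξ` is the Fourier transform at the angular frequency `2πξ`. -/
def IsMultiplierImage (m : ℝ → ℝ) (f h : 𝓢'(ℝ, ℂ)) : Prop :=
  ∃ F : ℝ → ℂ, IsFunction (𝓕 f) F ∧
    IsFunction (𝓕 h) (fun ξ => (m (2 * Real.pi * ξ) : ℂ) * F ξ)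

/-- `h = g(f)`: the distribution `f` is a real function `v`, and `h` is the function `g ∘ v`. -/
def IsComposition (g : ℝ → ℝ) (f h : 𝓢'(ℝ, ℂ)) : Prop :=
  ∃ v : ℝ → ℝ, IsFunction f (fun x => (v x : ℂ)) ∧ IsFunction h (fun x => (g (v x) : ℂ))

/-- The second distributional derivative `∂²f/∂x²`. -/
def dxx (f : 𝓢'(ℝ, ℂ)) : 𝓢'(ℝ, ℂ) := ∂_{(1 : ℝ)} (∂_{(1 : ℝ)} f)

/-- The function `u`, with time derivative `u'`, belongs to
`C([0,∞), H^s) ∩ C¹([0,∞), H^r)`, where `r ≤ s`, and solves the Cauchy problem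
`u_tt - L u_xx = (g(u))_xx` for `t > 0`, `u(0) = φ`, `u_t(0) = ψ`, where `L` has the symbol `l`.
The equation is understood in the space of tempered distributions. -/
structure SolvesWith (l g : ℝ → ℝ) {s r : ℝ} (hrs : r ≤ s) (φ : H s) (ψ : H r)
    (u : ℝ → H s) (u' : ℝ → H r) : Prop where
  continuousOn : ContinuousOn u (Ici 0)
  continuousOn_deriv : ContinuousOn u' (Ici 0)
  hasDeriv : ∀ t ∈ Ici (0 : ℝ), HasDerivWithinAt (fun τ => H.incl hrs (u τ)) (u' t) (Ici 0) t
  initial : u 0 = φ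
  initial_deriv : u' 0 = ψ
  equation : ∀ t : ℝ, 0 < t → ∃ w h : 𝓢'(ℝ, ℂ),
    IsMultiplierImage l (dxx (H.dist (u t))) w ∧ IsComposition g (H.dist (u t)) h ∧
      ∀ χ : 𝓢(ℝ, ℂ), HasDerivAt (fun τ => H.dist (u' τ) χ) ((w + dxx h) χ) t

/-- `u ∈ C([0,∞), H^s) ∩ C¹([0,∞), H^r)` is a global solution of the Cauchy problem; only the
values of `u` on `[0,∞)` matter. -/
def IsGlobalSolution (l g : ℝ → ℝ) {s r : ℝ} (hrs : r ≤ s) (φ : H s) (ψ : H r)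
    (u : ℝ → H s) : Prop :=
  ∃ u' : ℝ → H r, SolvesWith l g hrs φ ψ u u'

end NonlocalWave

end

/-!
The problem is solved on the Fourier side, as a first order equation in `L²`. Put
`λ(ξ) = l(2πξ)` and `ω = 2π|ξ| √λ`, and let `|D|` have the symbol `2π|ξ|`. For a solution `u`, the
functions `√λ 𝓕u` and `𝓕(|D|⁻¹ u_t)` are square integrable and hermitian (that is, fixed by the
antilinear involution `J f(ξ) = conj (f (-ξ))`), and together they are the hermitian parts of
the single unknown `z = √λ 𝓕u - i 𝓕(|D|⁻¹ u_t)`. The Cauchy problem becomes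
`z' = i ω z + i 𝓕(|D| g(u))`, or, with `y = exp(-itω) z`, an ordinary differential equation in `L²`
that involves no unbounded operator (`IsInteractionSolution`).

* The nonlinear term is Lipschitz on balls (`nl_lipschitz`). Since `ρ ≥ 2`, the function `u` is in
  `H¹`, which embeds in the bounded functions, so the mean value theorem bounds the difference
  quotients of `g(u) - g(v)`, and these control `|D| (g(u) - g(v))` in `L²`. Only `g ∈ C²` and
  `g(0) = 0` matter; the latter holds because the primitive `G` is smallest at `0`.
* The energy `‖z‖² / 2 + ∫ G(u)` is constant (`energy_conserved`). As `u_t` is only in `H⁻¹`, the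
  derivative of `∫ G(u)` is found from a Taylor expansion of `G` with the quadratic error
  `‖u(τ) - u(t)‖² ≤ ‖u(τ) - u(t)‖_{H¹} ‖u(τ) - u(t)‖_{H⁻¹} = o(|τ - t|)`. With `G ≥ 0` this bounds
  `‖z‖`, and the equation is solvable for all times (`exists_global_interaction`). The hermitian
  parts of `z` then give a solution of the Cauchy problem (`exists_solvesWith`).
* Conversely every solution arises in this way (`SolvesWith.exists_interaction`). Tested against
  Schwartz functions, the equation gives `𝓕(|D|⁻¹ u_t)` as a time integral in a weighted space. There
  the variation of constants formula holds (`eq_duhamel`), and the weight can be removed, because the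
  right-hand side of that formula is square integrable without it. Uniqueness is therefore
  that of the ordinary differential equation (`interaction_unique`).
-/

noncomputable section

namespace NonlocalWave

open Filter Topology Metric
open scoped NNReal ENNReal ComplexConjugate

/-- Complex-valued square integrable functions on the line. -/
abbrev L2 : Type := Lp ℂ 2 (volume : Measure ℝ)

theorem L2.norm_sq_eq (f : L2) : ‖f‖ ^ 2 = ∫ x, ‖f x‖ ^ 2 := by
  have h := inner_self_eq_norm_sq_to_K (𝕜 := ℂ) f
  rw [L2.inner_def] at h
  have h2 : ∀ x, inner ℂ (f x) (f x) = ((‖f x‖ ^ 2 : ℝ) : ℂ) := fun x => by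
    rw [inner_self_eq_norm_sq_to_K]; norm_cast
  simp_rw [h2] at h
  rw [integral_complex_ofReal] at h
  apply Complex.ofReal_injective
  rw [Complex.ofReal_pow]
  exact h.symm

theorem L2.integrable_norm_sq (f : L2) : Integrable (fun x => ‖f x‖ ^ 2) :=
  (Lp.memLp f).integrable_norm_pow (by norm_num)

/-! ### Bounded multipliers on `L²` -/

/-- A bounded measurable symbol. -/
def IsBddSymbol (m : ℝ → ℂ) : Prop := Measurable m ∧ ∃ C : ℝ, ∀ ξ, ‖m ξ‖ ≤ C

theorem IsBddSymbol.memLp_mul {m : ℝ → ℂ} (hm : IsBddSymbol m) (f : L2) :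
    MemLp (fun ξ => m ξ * f ξ) 2 volume := by
  obtain ⟨C, hC⟩ := hm.2
  refine (Lp.memLp f).of_le_mul (c := C)
    (hm.1.aestronglyMeasurable.mul (Lp.aestronglyMeasurable f)) (ae_of_all _ fun ξ => ?_)
  rw [norm_mul]
  gcongr
  exact hC ξ

theorem L2.norm_toLp_le {f : L2} {F : ℝ → ℂ} (hF : MemLp F 2 volume) {C : ℝ}
    (h : ∀ᵐ ξ, ‖F ξ‖ ≤ C * ‖f ξ‖) : ‖hF.toLp F‖ ≤ C * ‖f‖ := by
  refine Lp.norm_le_mul_norm_of_ae_le_mul ?_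
  filter_upwards [h, hF.coeFn_toLp] with ξ h1 h2
  rwa [h2]

theorem L2.norm_le_of_ae {f g : L2} {C : ℝ} (h : ∀ᵐ ξ, ‖f ξ‖ ≤ C * ‖g ξ‖) : ‖f‖ ≤ C * ‖g‖ :=
  Lp.norm_le_mul_norm_of_ae_le_mul h

open Classical in
/-- Multiplication by a bounded measurable symbol, as a bounded operator on `L²`. The value is `0`
when the symbol is not measurable or not bounded. -/
def mul (m : ℝ → ℂ) : L2 →L[ℂ] L2 :=
  if hm : IsBddSymbol m then
    LinearMap.mkContinuous
      { toFun := fun f => (hm.memLp_mul f).toLp _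
        map_add' := fun f g => by
          rw [← MemLp.toLp_add]
          refine MemLp.toLp_congr _ _ ?_
          filter_upwards [Lp.coeFn_add f g] with ξ h
          change m ξ * (f + g : L2) ξ = m ξ * f ξ + m ξ * g ξ
          rw [h, Pi.add_apply, mul_add]
        map_smul' := fun c f => by
          rw [RingHom.id_apply, ← MemLp.toLp_const_smul]
          refine MemLp.toLp_congr _ _ ?_
          filter_upwards [Lp.coeFn_smul c f] with ξ h
          change m ξ * (c • f : L2) ξ = c * (m ξ * f ξ)
          rw [h, Pi.smul_apply, smul_eq_mul, mul_left_comm] }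
      hm.2.choose
      (fun f => L2.norm_toLp_le (hm.memLp_mul f) 
        (ae_of_all _ fun ξ => by
          rw [norm_mul]; exact mul_le_mul_of_nonneg_right (hm.2.choose_spec ξ) (norm_nonneg _)))
  else 0

theorem mul_coe {m : ℝ → ℂ} (hm : IsBddSymbol m) (f : L2) :
    mul m f =ᵐ[volume] fun ξ => m ξ * f ξ := by
  rw [mul, dif_pos hm]
  exact (hm.memLp_mul f).coeFn_toLp

theorem norm_mul_le {m : ℝ → ℂ} (hm : Measurable m) {C : ℝ} (h : ∀ ξ, ‖m ξ‖ ≤ C) (f : L2) :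
    ‖mul m f‖ ≤ C * ‖f‖ := by
  apply L2.norm_le_of_ae
  filter_upwards [mul_coe ⟨hm, C, h⟩ f] with ξ h1
  rw [h1, norm_mul]
  exact mul_le_mul_of_nonneg_right (h ξ) (norm_nonneg _)

theorem IsBddSymbol.mul {m n : ℝ → ℂ} (hm : IsBddSymbol m) (hn : IsBddSymbol n) :
    IsBddSymbol (fun ξ => m ξ * n ξ) := by
  obtain ⟨C, hC⟩ := hm.2
  obtain ⟨D, hD⟩ := hn.2
  refine ⟨hm.1.mul hn.1, C * D, fun ξ => ?_⟩
  rw [norm_mul]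
  exact mul_le_mul (hC ξ) (hD ξ) (norm_nonneg _) ((norm_nonneg _).trans (hC ξ))

theorem mul_mul {m n : ℝ → ℂ} (hm : IsBddSymbol m) (hn : IsBddSymbol n) (f : L2) :
    mul m (mul n f) = mul (fun ξ => m ξ * n ξ) f := by
  apply Lp.ext
  filter_upwards [mul_coe hm (mul n f), mul_coe hn f, mul_coe (hm.mul hn) f] with ξ h1 h2 h3
  rw [h1, h2, h3, mul_assoc]

theorem mul_comm_apply {m n : ℝ → ℂ} (hm : IsBddSymbol m) (hn : IsBddSymbol n) (f : L2) :
    mul m (mul n f) = mul n (mul m f) := by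
  rw [mul_mul hm hn, mul_mul hn hm,
    show (fun ξ => m ξ * n ξ) = fun ξ => n ξ * m ξ from funext fun ξ => mul_comm _ _]

theorem mul_one_symbol (f : L2) : mul (fun _ => 1) f = f := by
  apply Lp.ext
  filter_upwards [mul_coe (m := fun _ => 1) ⟨measurable_const, 1, by simp⟩ f] with ξ h
  simp [h]

/-- Dominated convergence: uniformly bounded symbols that converge pointwise give strongly convergent
multipliers. -/
theorem tendsto_mul {ι : Type*} {l : Filter ι} [l.IsCountablyGenerated] {M : ι → ℝ → ℂ}
    {m : ℝ → ℂ} {C : ℝ} (hM : ∀ i, Measurable (M i)) (hC : ∀ i ξ, ‖M i ξ‖ ≤ C)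
    (hm : Measurable m) (hm' : ∀ ξ, ‖m ξ‖ ≤ C)
    (h : ∀ ξ, Tendsto (fun i => M i ξ) l (𝓝 (m ξ))) {g : ι → L2} {f : L2}
    (hg : Tendsto g l (𝓝 f)) :
    Tendsto (fun i => mul (M i) (g i)) l (𝓝 (mul m f)) := by
  have key : Tendsto (fun i => mul (M i) f) l (𝓝 (mul m f)) := by
    rw [tendsto_iff_norm_sub_tendsto_zero]
    have h0 : Tendsto (fun i => ‖mul (M i) f - mul m f‖ ^ 2) l (𝓝 0) := by
      have e : ∀ i, ‖mul (M i) f - mul m f‖ ^ 2 = ∫ ξ, ‖(M i ξ - m ξ) * f ξ‖ ^ 2 := fun i => by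
        rw [L2.norm_sq_eq]
        apply integral_congr_ae
        filter_upwards [Lp.coeFn_sub (mul (M i) f) (mul m f), mul_coe ⟨hM i, C, hC i⟩ f,
          mul_coe ⟨hm, C, hm'⟩ f] with ξ h1 h2 h3
        rw [h1, Pi.sub_apply, h2, h3, sub_mul]
      simp_rw [e]
      have z : (0 : ℝ) = ∫ _ : ℝ, (0 : ℝ) := by simp
      rw [z]
      refine tendsto_integral_filter_of_dominated_convergence (fun ξ => (2 * C) ^ 2 * ‖f ξ‖ ^ 2)
        (Eventually.of_forall fun i => ?_) (Eventually.of_forall fun i => ae_of_all _ fun ξ => ?_)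
        ((L2.integrable_norm_sq f).const_mul _) (ae_of_all _ fun ξ => ?_)
      · exact ((((hM i).sub hm).aestronglyMeasurable.mul (Lp.aestronglyMeasurable f)).norm.pow 2)
      · rw [Real.norm_of_nonneg (by positivity), norm_mul, mul_pow]
        gcongr
        calc ‖M i ξ - m ξ‖ ≤ ‖M i ξ‖ + ‖m ξ‖ := norm_sub_le _ _
          _ ≤ 2 * C := by linarith [hC i ξ, hm' ξ]
      · have := (((h ξ).sub_const (m ξ)).mul_const (f ξ)).norm.pow 2
        simpa using this
    have h1 := h0.sqrt
    simpa [Real.sqrt_sq] using h1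
  have h2 : Tendsto (fun i => mul (M i) (g i - f)) l (𝓝 0) := by
    have h3 : Tendsto (fun i => C * ‖g i - f‖) l (𝓝 0) := by
      simpa using (tendsto_iff_norm_sub_tendsto_zero.1 hg).const_mul C
    exact squeeze_zero_norm (fun i => norm_mul_le (hM i) (hC i) _) h3
  have h3 := h2.add key
  simp only [map_sub, sub_add_cancel, zero_add] at h3
  exact h3

/-! ### The unitary group of a real phase -/

/-- The symbol `exp(i ω t)`. -/
def expSymbol (ω : ℝ → ℝ) (t : ℝ) (ξ : ℝ) : ℂ := Complex.exp (Complex.I * ((ω ξ * t : ℝ) : ℂ))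

theorem norm_expSymbol (ω : ℝ → ℝ) (t ξ : ℝ) : ‖expSymbol ω t ξ‖ = 1 := by
  rw [expSymbol, mul_comm]; exact Complex.norm_exp_ofReal_mul_I _

theorem measurable_expSymbol {ω : ℝ → ℝ} (hω : Measurable ω) (t : ℝ) :
    Measurable (expSymbol ω t) := by
  unfold expSymbol; fun_prop

theorem isBddSymbol_exp {ω : ℝ → ℝ} (hω : Measurable ω) (t : ℝ) : IsBddSymbol (expSymbol ω t) :=
  ⟨measurable_expSymbol hω t, 1, fun ξ => (norm_expSymbol ω t ξ).le⟩

/-- The unitary group `exp(i t ω)` acting by multiplication on `L²`. -/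
def group (ω : ℝ → ℝ) (t : ℝ) : L2 →L[ℂ] L2 := mul (expSymbol ω t)

theorem group_neg_group {ω : ℝ → ℝ} (hω : Measurable ω) (t : ℝ) (f : L2) :
    group ω (-t) (group ω t f) = f := by
  rw [group, group, mul_mul (isBddSymbol_exp hω _) (isBddSymbol_exp hω _)]
  convert mul_one_symbol f using 2
  congr 1
  ext ξ
  rw [expSymbol, expSymbol, ← Complex.exp_add, ← mul_add]
  simp

theorem group_group_neg {ω : ℝ → ℝ} (hω : Measurable ω) (t : ℝ) (f : L2) :
    group ω t (group ω (-t) f) = f := by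
  simpa using group_neg_group hω (-t) f

theorem group_zero (ω : ℝ → ℝ) (f : L2) : group ω 0 f = f := by
  rw [group]
  convert mul_one_symbol f using 2
  congr 1
  ext ξ
  simp [expSymbol]

theorem norm_group {ω : ℝ → ℝ} (hω : Measurable ω) (t : ℝ) (f : L2) : ‖group ω t f‖ = ‖f‖ := by
  have h : ∀ s (g : L2), ‖group ω s g‖ ≤ ‖g‖ := fun s g => by
    simpa [group] using norm_mul_le (measurable_expSymbol hω s) (fun ξ => (norm_expSymbol ω s ξ).le) g
  refine le_antisymm (h t f) ?_
  simpa [group_neg_group hω] using h (-t) (group ω t f)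

theorem continuous_expSymbol (ω : ℝ → ℝ) (ξ : ℝ) : Continuous (fun t => expSymbol ω t ξ) := by
  unfold expSymbol; fun_prop

theorem tendsto_group {ω : ℝ → ℝ} (hω : Measurable ω) {ι : Type*} {l : Filter ι}
    [l.IsCountablyGenerated] {τ : ι → ℝ} {t : ℝ} (hτ : Tendsto τ l (𝓝 t)) {g : ι → L2} {f : L2}
    (hg : Tendsto g l (𝓝 f)) : Tendsto (fun i => group ω (τ i) (g i)) l (𝓝 (group ω t f)) :=
  tendsto_mul (C := 1) (fun _ => measurable_expSymbol hω _) (fun _ _ => (norm_expSymbol _ _ _).le)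
    (measurable_expSymbol hω _) (fun _ => (norm_expSymbol _ _ _).le)
    (fun ξ => ((continuous_expSymbol ω ξ).tendsto t).comp hτ) hg

theorem norm_expSymbol_sub_le (ω : ℝ → ℝ) (s t ξ : ℝ) :
    ‖expSymbol ω s ξ - expSymbol ω t ξ‖ ≤ |ω ξ| * |s - t| := by
  have e : expSymbol ω s ξ - expSymbol ω t ξ =
      expSymbol ω t ξ * (Complex.exp (Complex.I * ((ω ξ * (s - t) : ℝ) : ℂ)) - 1) := by
    rw [expSymbol, expSymbol, mul_sub, ← Complex.exp_add, mul_one]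
    congr 2
    push_cast
    ring
  rw [e, norm_mul, norm_expSymbol, one_mul, ← abs_mul]
  exact Real.norm_exp_I_mul_ofReal_sub_one_le

theorem hasDerivAt_expSymbol (ω : ℝ → ℝ) (t ξ : ℝ) :
    HasDerivAt (fun s => expSymbol ω s ξ) (Complex.I * ω ξ * expSymbol ω t ξ) t := by
  have h1 : HasDerivAt (fun s : ℝ => Complex.I * ((ω ξ * s : ℝ) : ℂ)) (Complex.I * ω ξ) t := by
    have := ((hasDerivAt_id t).const_mul (ω ξ)).ofReal_comp.const_mul Complex.I
    simpa using this
  have := h1.cexp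
  rw [mul_comm] at this
  exact this

/-- If the symbols `m` and `m ω` are bounded then, although `ω` may be unbounded, `m exp(i t ω) y(t)`
is differentiable in `L²` whenever `y` is. -/
theorem hasDerivWithinAt_mul_group {ω : ℝ → ℝ} (hω : Measurable ω) {m : ℝ → ℂ}
    (hm : IsBddSymbol m) (hmω : IsBddSymbol (fun ξ => m ξ * ω ξ)) {y : ℝ → L2} {y' : L2} {s : Set ℝ} {t : ℝ}
    (hy : HasDerivWithinAt y y' s t) :
    HasDerivWithinAt (fun τ => mul m (group ω τ (y τ)))
      (mul (fun ξ => Complex.I * (m ξ * ω ξ)) (group ω t (y t)) + mul m (group ω t y')) s t := by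
  obtain ⟨C, hC⟩ := hmω.2
  have bI : IsBddSymbol (fun ξ => Complex.I * (m ξ * ω ξ)) :=
    ⟨hmω.1.const_mul _, C, fun ξ => by simpa using hC ξ⟩
  rw [hasDerivWithinAt_iff_tendsto_slope] at hy ⊢
  have hid : Tendsto (fun τ : ℝ => τ) (𝓝[s \ {t}] t) (𝓝 t) := tendsto_id.mono_left nhdsWithin_le_nhds
  set q : ℝ → ℝ → ℂ := fun τ ξ => ((τ - t : ℝ) : ℂ)⁻¹ * (m ξ * (expSymbol ω τ ξ - expSymbol ω t ξ))
    with hq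
  have hqm : ∀ τ, Measurable (q τ) := fun τ => by
    have h1 := measurable_expSymbol hω τ
    have h2 := measurable_expSymbol hω t
    exact (hm.1.mul (h1.sub h2)).const_mul _
  have hqC : ∀ τ ξ, ‖q τ ξ‖ ≤ C := fun τ ξ => by
    have hC' := hC ξ
    have h0 : 0 ≤ C := (norm_nonneg _).trans hC'
    rw [norm_mul, Complex.norm_real, Real.norm_eq_abs] at hC'
    rw [hq]
    simp only [norm_mul, norm_inv, Complex.norm_real, Real.norm_eq_abs]
    rcases eq_or_ne τ t with rfl | hne
    · simpa using h0
    have hpos : 0 < |τ - t| := abs_pos.2 (sub_ne_zero.2 hne)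
    rw [inv_mul_le_iff₀ hpos]
    calc ‖m ξ‖ * ‖expSymbol ω τ ξ - expSymbol ω t ξ‖ ≤ ‖m ξ‖ * (|ω ξ| * |τ - t|) := by
          gcongr; exact norm_expSymbol_sub_le _ _ _ _
      _ = (‖m ξ‖ * |ω ξ|) * |τ - t| := by ring
      _ ≤ C * |τ - t| := by gcongr
      _ = |τ - t| * C := mul_comm _ _
  have A : Tendsto (fun τ => mul (q τ) (y t)) (𝓝[s \ {t}] t)
      (𝓝 (mul (fun ξ => Complex.I * (m ξ * ω ξ) * expSymbol ω t ξ) (y t))) := by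
    refine tendsto_mul hqm hqC (bI.1.mul (measurable_expSymbol hω t)) (fun ξ => ?_) (fun ξ => ?_)
      tendsto_const_nhds
    · simpa [norm_expSymbol] using hC ξ
    · have h1 := (hasDerivAt_expSymbol ω t ξ).hasDerivWithinAt (s := s)
      rw [hasDerivWithinAt_iff_tendsto_slope] at h1
      have h2 := h1.const_mul (m ξ)
      convert h2 using 2
      · rename_i τ
        rw [hq, slope_def_module, Complex.real_smul]
        push_cast
        ring
      · simp only [Pi.mul_apply]
        ring
  have B : Tendsto (fun τ => mul m (group ω τ (slope y t τ))) (𝓝[s \ {t}] t)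
      (𝓝 (mul m (group ω t y'))) :=
    ((mul m).continuous.tendsto _).comp (tendsto_group hω hid hy)
  have e1 : mul (fun ξ => Complex.I * (m ξ * ω ξ)) (group ω t (y t)) =
      mul (fun ξ => Complex.I * (m ξ * ω ξ) * expSymbol ω t ξ) (y t) :=
    mul_mul bI (isBddSymbol_exp hω t) _
  rw [e1]
  refine (A.add B).congr' ?_
  filter_upwards [self_mem_nhdsWithin] with τ hτ
  have e2 : mul (q τ) (y t) = (τ - t)⁻¹ • (mul m (group ω τ (y t)) - mul m (group ω t (y t))) := by
    apply Lp.ext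
    have b1 := isBddSymbol_exp hω τ
    have b2 := isBddSymbol_exp hω t
    rw [group, group, mul_mul hm b1, mul_mul hm b2]
    filter_upwards [mul_coe ⟨hqm τ, C, hqC τ⟩ (y t), mul_coe (hm.mul b1) (y t),
      mul_coe (hm.mul b2) (y t), Lp.coeFn_smul (τ - t)⁻¹ (mul (fun ξ => m ξ * expSymbol ω τ ξ) (y t) -
        mul (fun ξ => m ξ * expSymbol ω t ξ) (y t)),
      Lp.coeFn_sub (mul (fun ξ => m ξ * expSymbol ω τ ξ) (y t))
        (mul (fun ξ => m ξ * expSymbol ω t ξ) (y t))] with ξ h1 h2 h3 h4 h5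
    rw [h4, Pi.smul_apply, h5, Pi.sub_apply, h1, h2, h3, hq, Complex.real_smul]
    push_cast
    ring
  rw [e2, slope_def_module, slope_def_module, ContinuousLinearMap.map_smul_of_tower,
    ContinuousLinearMap.map_smul_of_tower, ← smul_add, map_sub, map_sub]
  congr 1
  abel

/-! ### Semilinear evolution in the interaction picture -/

/-- The function `y`, on the time set `s`, satisfies `y' = exp(-itω) N(exp(itω) y)`: this is the
equation `z' = iωz + N(z)` in terms of `y = exp(-itω) z`. -/
def IsInteractionSolution (ω : ℝ → ℝ) (N : L2 → L2) (s : Set ℝ) (y : ℝ → L2) : Prop :=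
  ∀ t ∈ s, HasDerivWithinAt y (group ω (-t) (N (group ω t (y t)))) s t

theorem interaction_unique {ω : ℝ → ℝ} (hω : Measurable ω) {N : L2 → L2}
    (hN : ∀ M : ℝ, ∃ K : ℝ≥0, LipschitzOnWith K N (closedBall 0 M)) {T : ℝ} {y z : ℝ → L2}
    (hy : IsInteractionSolution ω N (Icc 0 T) y) (hz : IsInteractionSolution ω N (Icc 0 T) z)
    (h0 : y 0 = z 0) : EqOn y z (Icc 0 T) := by
  have cy : ContinuousOn y (Icc 0 T) := fun t ht => (hy t ht).continuousWithinAt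
  have cz : ContinuousOn z (Icc 0 T) := fun t ht => (hz t ht).continuousWithinAt
  obtain ⟨A, hA⟩ := isCompact_Icc.exists_bound_of_continuousOn cy
  obtain ⟨B, hB⟩ := isCompact_Icc.exists_bound_of_continuousOn cz
  obtain ⟨K, hK⟩ := hN (max A B)
  have hd : ∀ {x : ℝ → L2}, IsInteractionSolution ω N (Icc 0 T) x → ∀ t ∈ Ico 0 T,
      HasDerivWithinAt x (group ω (-t) (N (group ω t (x t)))) (Ici t) t := fun hx t ht =>
    (hx t (Ico_subset_Icc_self ht)).mono_of_mem_nhdsWithin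
      (mem_of_superset (Icc_mem_nhdsGE ht.2) (Icc_subset_Icc_left ht.1))
  refine ODE_solution_unique_of_mem_Icc_right
    (v := fun t x => group ω (-t) (N (group ω t x))) (s := fun _ => closedBall 0 (max A B)) (K := K)
    (fun t _ => ?_) cy (hd hy) (fun t ht => ?_) cz (hd hz) (fun t ht => ?_) h0
  · refine LipschitzOnWith.of_dist_le_mul fun a ha b hb => ?_
    rw [dist_eq_norm, ← map_sub, norm_group hω]
    have := hK.dist_le_mul (group ω t a) (by simpa [norm_group hω] using ha) (group ω t b)
      (by simpa [norm_group hω] using hb)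
    rwa [dist_eq_norm, dist_eq_norm, ← map_sub, norm_group hω, ← dist_eq_norm a b] at this
  · simpa using Or.inl (hA t (Ico_subset_Icc_self ht))
  · simpa using Or.inr (hB t (Ico_subset_Icc_self ht))

theorem exists_interaction_of_lipschitzWith {ω : ℝ → ℝ} (hω : Measurable ω) {N : L2 → L2} {K : ℝ≥0}
    (hN : LipschitzWith K N) {B : ℝ} (hB : ∀ x, ‖N x‖ ≤ B) {T : ℝ} (hT : 0 ≤ T) (a : L2) :
    ∃ y : ℝ → L2, y 0 = a ∧ IsInteractionSolution ω N (Icc 0 T) y := by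
  have hB0 : 0 ≤ B := (norm_nonneg _).trans (hB 0)
  have hp : IsPicardLindelof (fun t x => group ω (-t) (N (group ω t x)))
      (⟨0, left_mem_Icc.2 hT⟩ : Icc (0 : ℝ) T) a (B.toNNReal * T.toNNReal) 0 B.toNNReal K := by
    constructor
    · refine fun t _ => LipschitzOnWith.of_dist_le_mul fun x _ z _ => ?_
      rw [dist_eq_norm, ← map_sub, norm_group hω]
      have := hN.dist_le_mul (group ω t x) (group ω t z)
      rwa [dist_eq_norm, dist_eq_norm, ← map_sub, norm_group hω, ← dist_eq_norm x z] at this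
    · refine fun x _ => Continuous.continuousOn (continuous_iff_continuousAt.2 fun t => ?_)
      refine tendsto_group hω (continuous_neg.tendsto t) ?_
      exact (hN.continuous.tendsto _).comp (tendsto_group hω tendsto_id tendsto_const_nhds)
    · intro t _ x _
      rw [norm_group hω, Real.coe_toNNReal _ hB0]
      exact hB _
    · simp [hT, Real.coe_toNNReal _ hT]
  exact hp.exists_eq_forall_mem_Icc_hasDerivWithinAt₀

/-- The retraction `x ↦ (M / max(M, ‖x‖)) x` of a normed space onto the ball of radius `M`. -/
def radial (M : ℝ) (x : L2) : L2 := (M / max M ‖x‖) • x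

theorem norm_radial_le {M : ℝ} (hM : 0 < M) (x : L2) : ‖radial M x‖ ≤ M := by
  have h : 0 < max M ‖x‖ := lt_max_of_lt_left hM
  rw [radial, norm_smul, Real.norm_of_nonneg (by positivity), div_mul_eq_mul_div, div_le_iff₀ h]
  gcongr
  exact le_max_right _ _

theorem radial_of_le {M : ℝ} (hM : 0 < M) {x : L2} (hx : ‖x‖ ≤ M) : radial M x = x := by
  rw [radial, max_eq_left hx, div_self hM.ne', one_smul]

theorem lipschitzWith_radial {M : ℝ} (hM : 0 < M) : LipschitzWith 2 (radial M) := by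
  refine LipschitzWith.of_dist_le_mul fun a b => ?_
  rw [dist_eq_norm, dist_eq_norm]
  have ha : 0 < max M ‖a‖ := lt_max_of_lt_left hM
  have hb : 0 < max M ‖b‖ := lt_max_of_lt_left hM
  have e : radial M a - radial M b =
      (M / max M ‖a‖) • (a - b) + (M / max M ‖a‖ - M / max M ‖b‖) • b := by
    rw [radial, radial, smul_sub, sub_smul]; abel
  have h1 : ‖(M / max M ‖a‖) • (a - b)‖ ≤ ‖a - b‖ := by
    rw [norm_smul, Real.norm_of_nonneg (by positivity)]
    exact mul_le_of_le_one_left (norm_nonneg _) ((div_le_one ha).2 (le_max_left _ _))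
  have h2 : ‖(M / max M ‖a‖ - M / max M ‖b‖) • b‖ ≤ ‖a - b‖ := by
    have e2 : M / max M ‖a‖ - M / max M ‖b‖ =
        (M / max M ‖a‖) * ((max M ‖b‖ - max M ‖a‖) / max M ‖b‖) := by
      field_simp
    have h3 : |max M ‖b‖ - max M ‖a‖| ≤ ‖a - b‖ := by
      rw [norm_sub_rev]
      refine le_trans ?_ (abs_norm_sub_norm_le b a)
      rw [max_comm M, max_comm M]
      exact abs_max_sub_max_le_abs _ _ _
    rw [norm_smul, e2, Real.norm_eq_abs, abs_mul, abs_div, abs_div, abs_of_pos hM, abs_of_pos ha,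
      abs_of_pos hb]
    calc M / max M ‖a‖ * (|max M ‖b‖ - max M ‖a‖| / max M ‖b‖) * ‖b‖
        = (M / max M ‖a‖) * (‖b‖ / max M ‖b‖) * |max M ‖b‖ - max M ‖a‖| := by ring
      _ ≤ 1 * 1 * ‖a - b‖ := by
          gcongr
          · exact (div_le_one ha).2 (le_max_left _ _)
          · exact (div_le_one hb).2 (le_max_right _ _)
      _ = ‖a - b‖ := by ring
  rw [e]
  refine (norm_add_le _ _).trans ?_
  rw [NNReal.coe_ofNat]
  linarith

/-- A nonlinearity that is Lipschitz on balls admits a solution up to time `T` if solutions obey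
an a priori bound. The nonlinearity is cut off outside the ball of radius `M`, and the a priori
bound keeps the solution of the modified equation inside this ball. -/
theorem exists_interaction_Icc {ω : ℝ → ℝ} (hω : Measurable ω) {N : L2 → L2}
    (hN : ∀ M : ℝ, ∃ K : ℝ≥0, LipschitzOnWith K N (closedBall 0 M)) {a : L2} {M : ℝ}
    (ha : ‖a‖ < M)
    (hbound : ∀ T : ℝ, 0 ≤ T → ∀ y : ℝ → L2, y 0 = a → IsInteractionSolution ω N (Icc 0 T) y →
      (∀ t ∈ Icc 0 T, ‖y t‖ ≤ M) → ∀ t ∈ Icc 0 T, ‖y t‖ < M) {T : ℝ} (hT : 0 ≤ T) :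
    ∃ y : ℝ → L2, y 0 = a ∧ IsInteractionSolution ω N (Icc 0 T) y := by
  have hM : 0 < M := (norm_nonneg _).trans_lt ha
  obtain ⟨K, hK⟩ := hN M
  have hL : LipschitzWith (K * 2) (fun x => N (radial M x)) :=
    (hK.comp (lipschitzWith_radial hM).lipschitzOnWith
      (fun x _ => by simpa using norm_radial_le hM x) : LipschitzOnWith _ _ univ)
      |> lipschitzOnWith_univ.1
  have hbd : ∀ x, ‖N (radial M x)‖ ≤ ‖N 0‖ + K * M := fun x => by
    have h := hK.dist_le_mul (radial M x) (by simpa using norm_radial_le hM x) 0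
      (by simpa using hM.le)
    rw [dist_eq_norm, dist_zero_right] at h
    calc ‖N (radial M x)‖ = ‖N 0 + (N (radial M x) - N 0)‖ := by congr 1; abel
      _ ≤ ‖N 0‖ + ‖N (radial M x) - N 0‖ := norm_add_le _ _
      _ ≤ ‖N 0‖ + K * M := by
        have := mul_le_mul_of_nonneg_left (norm_radial_le hM x) K.coe_nonneg
        linarith
  obtain ⟨y, hy0, hy⟩ := exists_interaction_of_lipschitzWith hω hL hbd hT a
  have cy : ContinuousOn y (Icc 0 T) := fun t ht => (hy t ht).continuousWithinAt
  have restrict : ∀ T' ≤ T, (∀ t ∈ Icc 0 T', ‖y t‖ ≤ M) →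
      IsInteractionSolution ω N (Icc 0 T') y := by
    intro T' hT' hle t ht
    have h := (hy t ⟨ht.1, ht.2.trans hT'⟩).mono (Icc_subset_Icc_right hT')
    have e : radial M (group ω t (y t)) = group ω t (y t) :=
      radial_of_le hM (by rw [norm_group hω]; exact hle t ht)
    simpa only [e] using h
  have hall : ∀ t ∈ Icc 0 T, ‖y t‖ ≤ M := by
    by_contra! hcon
    obtain ⟨t₁, ht₁, hlt⟩ := hcon
    -- the first time at which the norm reaches the level `M`
    set A := {t ∈ Icc 0 T | M ≤ ‖y t‖} with hA
    have hAc : IsClosed A := by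
      have := cy.norm.preimage_isClosed_of_isClosed isClosed_Icc (isClosed_Ici (a := M))
      exact this
    have hAne : A.Nonempty := ⟨t₁, ht₁, hlt.le⟩
    have hAb : BddBelow A := ⟨0, fun t ht => ht.1.1⟩
    have hmem := hAc.csInf_mem hAne hAb
    set σ := sInf A with hσ
    have hbelow : ∀ t ∈ Ico 0 σ, ‖y t‖ < M := by
      intro t ht
      by_contra! hge
      exact absurd (csInf_le hAb ⟨⟨ht.1, (ht.2.le.trans hmem.1.2)⟩, hge⟩) (not_le.2 ht.2)
    have hσM : ‖y σ‖ ≤ M := by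
      rcases hmem.1.1.eq_or_lt with h0 | h0
      · rw [← h0, hy0]; exact ha.le
      · have hc : ContinuousWithinAt (fun t => ‖y t‖) (Ico 0 σ) σ :=
          (cy σ hmem.1).norm.mono fun t ht => ⟨ht.1, ht.2.le.trans hmem.1.2⟩
        have : (𝓝[Ico 0 σ] σ).NeBot := by
          rw [← mem_closure_iff_nhdsWithin_neBot, closure_Ico h0.ne]
          exact right_mem_Icc.2 h0.le
        exact le_of_tendsto hc (by
          filter_upwards [self_mem_nhdsWithin] with t ht using (hbelow t ht).le)
    have hle : ∀ t ∈ Icc 0 σ, ‖y t‖ ≤ M := by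
      intro t ht
      rcases ht.2.eq_or_lt with h | h
      · rw [h]; exact hσM
      · exact (hbelow t ⟨ht.1, h⟩).le
    exact absurd (hbound σ hmem.1.1 y hy0 (restrict σ hmem.1.2 hle) hle σ
      ⟨hmem.1.1, le_rfl⟩) (not_lt.2 hmem.2)
  exact ⟨y, hy0, restrict T le_rfl hall⟩

/-- Global solvability under an a priori bound, by gluing the solutions on bounded intervals. -/
theorem exists_interaction_Ici {ω : ℝ → ℝ} (hω : Measurable ω) {N : L2 → L2}
    (hN : ∀ M : ℝ, ∃ K : ℝ≥0, LipschitzOnWith K N (closedBall 0 M)) {a : L2} {M : ℝ}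
    (ha : ‖a‖ < M)
    (hbound : ∀ T : ℝ, 0 ≤ T → ∀ y : ℝ → L2, y 0 = a → IsInteractionSolution ω N (Icc 0 T) y →
      (∀ t ∈ Icc 0 T, ‖y t‖ ≤ M) → ∀ t ∈ Icc 0 T, ‖y t‖ < M) :
    ∃ y : ℝ → L2, y 0 = a ∧ IsInteractionSolution ω N (Ici 0) y := by
  choose Y hY0 hY using fun n : ℕ =>
    exists_interaction_Icc hω hN ha hbound (T := n) n.cast_nonneg
  have hres : ∀ {n k : ℕ}, n ≤ k → IsInteractionSolution ω N (Icc 0 n) (Y k) :=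
    fun {n k} hnk t ht => (hY k t ⟨ht.1, ht.2.trans (by exact_mod_cast hnk)⟩).mono
      (Icc_subset_Icc_right (by exact_mod_cast hnk))
  have hagree : ∀ {n k : ℕ}, n ≤ k → EqOn (Y n) (Y k) (Icc 0 n) := fun hnk =>
    interaction_unique hω hN (hY _) (hres hnk) (by rw [hY0, hY0])
  have heq : ∀ (n : ℕ) (t : ℝ), t ∈ Icc (0 : ℝ) n → Y (⌈t⌉₊) t = Y n t := fun n t ht =>
    hagree (Nat.ceil_le.2 ht.2) ⟨ht.1, Nat.le_ceil t⟩
  refine ⟨fun t => Y ⌈t⌉₊ t, by simp [hY0], fun t ht => ?_⟩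
  set n := ⌈t⌉₊ + 1 with hn
  have htn : t < n := by rw [hn]; push_cast; exact (Nat.le_ceil t).trans_lt (lt_add_one _)
  have h1 := hY n t ⟨ht, htn.le⟩
  have hnh : Icc (0 : ℝ) n ∈ 𝓝[Ici 0] t := by
    have : Iio (n : ℝ) ∈ 𝓝 t := Iio_mem_nhds htn
    filter_upwards [self_mem_nhdsWithin, mem_nhdsWithin_of_mem_nhds this] with s hs hs'
    exact ⟨hs, (mem_Iio.1 hs').le⟩
  have h2 := h1.mono_of_mem_nhdsWithin hnh
  have e : Y ⌈t⌉₊ t = Y n t := heq n t ⟨ht, htn.le⟩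
  simp only [e]
  refine h2.congr_of_eventuallyEq ?_ e
  filter_upwards [hnh] with s hs using heq n s hs

/-! ### The reflection-conjugation of `L²` -/

theorem measurePreserving_neg : MeasurePreserving (fun x : ℝ => -x) volume volume :=
  Measure.measurePreserving_neg _

/-- The antilinear involution `(J f)(ξ) = conj (f (-ξ))`; the Fourier transforms of real functions
are its fixed points. -/
def J : L2 →L[ℝ] L2 :=
  (Complex.conjCLE : ℂ →L[ℝ] ℂ).compLpL 2 volume ∘L
    (Lp.compMeasurePreservingₗᵢ ℝ (fun x : ℝ => -x) measurePreserving_neg).toContinuousLinearMap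

theorem J_coe (f : L2) : J f =ᵐ[volume] fun ξ => conj (f (-ξ)) := by
  have h1 := ContinuousLinearMap.coeFn_compLpL (p := 2) (μ := volume)
    (Complex.conjCLE : ℂ →L[ℝ] ℂ)
    (Lp.compMeasurePreserving (fun x : ℝ => -x) measurePreserving_neg f)
  have h2 := Lp.coeFn_compMeasurePreserving f measurePreserving_neg
  filter_upwards [h1, h2] with ξ h1 h2
  change (Complex.conjCLE : ℂ →L[ℝ] ℂ).compLpL 2 volume
    (Lp.compMeasurePreserving (fun x : ℝ => -x) measurePreserving_neg f) ξ = _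
  rw [h1, h2]
  rfl

theorem ae_neg {p : ℝ → Prop} (h : ∀ᵐ x, p x) : ∀ᵐ x, p (-x) :=
  measurePreserving_neg.quasiMeasurePreserving.ae h

theorem J_J (f : L2) : J (J f) = f := by
  apply Lp.ext
  filter_upwards [J_coe (J f), ae_neg (J_coe f)] with ξ h1 h2
  rw [h1, h2]
  simp

theorem norm_J (f : L2) : ‖J f‖ = ‖f‖ := by
  have h : ∀ g : L2, ‖J g‖ ≤ ‖g‖ := fun g => by
    have e : ‖Lp.compMeasurePreserving (fun x : ℝ => -x) measurePreserving_neg g‖ = ‖g‖ :=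
      Lp.norm_compMeasurePreserving g measurePreserving_neg
    have := L2.norm_le_of_ae (f := J g) (C := 1)
      (g := Lp.compMeasurePreserving (fun x : ℝ => -x) measurePreserving_neg g) (by
        filter_upwards [J_coe g, Lp.coeFn_compMeasurePreserving g measurePreserving_neg] with ξ h1 h2
        rw [h1, h2]
        simp)
    rwa [e, one_mul] at this
  exact le_antisymm (h f) (by simpa [J_J] using h (J f))

theorem J_eq_iff {f : L2} : J f = f ↔ ∀ᵐ ξ, conj (f (-ξ)) = f ξ := by
  constructor
  · intro h
    filter_upwards [J_coe f] with ξ h1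
    rw [← h1, h]
  · intro h
    apply Lp.ext
    filter_upwards [J_coe f, h] with ξ h1 h2
    rw [h1, h2]

theorem J_mul {m n : ℝ → ℂ} (hm : IsBddSymbol m) (hn : IsBddSymbol n)
    (h : ∀ ξ, conj (m (-ξ)) = n ξ) (f : L2) : J (mul m f) = mul n (J f) := by
  apply Lp.ext
  filter_upwards [J_coe (mul m f), J_coe f, ae_neg (mul_coe hm f), mul_coe hn (J f)]
    with ξ h1 h2 h3 h4
  rw [h1, h3, h4, h2, map_mul, h]

theorem J_smul_I (f : L2) : J (Complex.I • f) = -(Complex.I • J f) := by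
  apply Lp.ext
  filter_upwards [J_coe (Complex.I • f), J_coe f, ae_neg (Lp.coeFn_smul Complex.I f),
    Lp.coeFn_neg (Complex.I • J f), Lp.coeFn_smul Complex.I (J f)] with ξ h1 h2 h3 h4 h5
  rw [h1, h3, h4, Pi.neg_apply, h5, Pi.smul_apply, Pi.smul_apply, h2]
  simp

/-! ### Distributions given by functions -/

theorem IsFunction.locallyIntegrable {f : 𝓢'(ℝ, ℂ)} {F : ℝ → ℂ} (hF : IsFunction f F) :
    LocallyIntegrable F volume := by
  intro x
  let b : ContDiffBump x := default
  have h1 : HasCompactSupport (Complex.ofRealCLM ∘ b) := b.hasCompactSupport.comp_left rfl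
  have h2 : ContDiff ℝ (⊤ : ℕ∞) (Complex.ofRealCLM ∘ b) :=
    Complex.ofRealCLM.contDiff.comp b.contDiff
  have h3 := (hF.2 (h1.toSchwartzMap h2)).1
  refine ⟨closedBall x b.rIn, closedBall_mem_nhds x b.rIn_pos, ?_⟩
  refine (h3.integrableOn (s := closedBall x b.rIn)).congr ?_
  refine (ae_restrict_iff' isClosed_closedBall.measurableSet).2 (ae_of_all _ fun y hy => ?_)
  have : b y = 1 := b.one_of_mem_closedBall hy
  simp [this]

theorem ae_eq_zero_of_forall_real_schwartz {F : ℝ → ℂ} (hF : LocallyIntegrable F volume)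
    (h : ∀ χ : 𝓢(ℝ, ℂ), (∀ x, (χ x).im = 0) → ∫ x, χ x * F x = 0) : F =ᵐ[volume] 0 := by
  refine ae_eq_zero_of_integral_contDiff_smul_eq_zero hF fun g hg hgc => ?_
  have h1 : HasCompactSupport (Complex.ofRealCLM ∘ g) := hgc.comp_left rfl
  have h2 : ContDiff ℝ (⊤ : ℕ∞) (Complex.ofRealCLM ∘ g) := Complex.ofRealCLM.contDiff.comp hg
  simpa using h (h1.toSchwartzMap h2) (fun x => by simp)

theorem IsFunction.ae_eq {f : 𝓢'(ℝ, ℂ)} {F G : ℝ → ℂ} (hF : IsFunction f F)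
    (hG : IsFunction f G) : F =ᵐ[volume] G := by
  have h := ae_eq_zero_of_forall_real_schwartz (hF.locallyIntegrable.sub hG.locallyIntegrable)
    (fun χ _ => by
      simp only [Pi.sub_apply, mul_sub]
      rw [integral_sub (hF.2 χ).1 (hG.2 χ).1, ← (hF.2 χ).2, ← (hG.2 χ).2, sub_self])
  filter_upwards [h] with x hx
  exact sub_eq_zero.1 hx

theorem IsFunction.congr {f : 𝓢'(ℝ, ℂ)} {F G : ℝ → ℂ} (hF : IsFunction f F)
    (h : F =ᵐ[volume] G) : IsFunction f G := by
  refine ⟨hF.1.congr h, fun χ => ?_⟩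
  have e : (fun x => χ x * F x) =ᵐ[volume] fun x => χ x * G x := by
    filter_upwards [h] with x hx
    rw [hx]
  exact ⟨(hF.2 χ).1.congr e, (hF.2 χ).2.trans (integral_congr_ae e)⟩

theorem IsFunction.dist_eq {f g : 𝓢'(ℝ, ℂ)} {F : ℝ → ℂ} (hf : IsFunction f F)
    (hg : IsFunction g F) : f = g := by
  ext χ
  rw [(hf.2 χ).2, (hg.2 χ).2]

theorem IsFunction.add {f g : 𝓢'(ℝ, ℂ)} {F G : ℝ → ℂ} (hF : IsFunction f F)
    (hG : IsFunction g G) : IsFunction (f + g) (fun x => F x + G x) := by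
  refine ⟨hF.1.add hG.1, fun χ => ?_⟩
  simp only [mul_add]
  refine ⟨(hF.2 χ).1.add (hG.2 χ).1, ?_⟩
  rw [integral_add (hF.2 χ).1 (hG.2 χ).1, ← (hF.2 χ).2, ← (hG.2 χ).2]
  rfl

theorem IsFunction.smul {f : 𝓢'(ℝ, ℂ)} {F : ℝ → ℂ} (c : ℂ) (hF : IsFunction f F) :
    IsFunction (c • f) (fun x => c * F x) := by
  refine ⟨hF.1.const_mul c, fun χ => ?_⟩
  have e : ∀ x, χ x * (c * F x) = c * (χ x * F x) := fun x => by ring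
  simp only [e]
  refine ⟨(hF.2 χ).1.const_mul c, ?_⟩
  rw [integral_const_mul, ← (hF.2 χ).2]
  rfl

theorem IsFunction.smulLeft {f : 𝓢'(ℝ, ℂ)} {F : ℝ → ℂ} (hF : IsFunction f F) {m : ℝ → ℂ}
    (hm : m.HasTemperateGrowth) : IsFunction (smulLeftCLM ℂ m f) (fun x => m x * F x) := by
  have e : ∀ (χ : 𝓢(ℝ, ℂ)) x, χ x * (m x * F x) = SchwartzMap.smulLeftCLM ℂ m χ x * F x := by
    intro χ x
    rw [SchwartzMap.smulLeftCLM_apply_apply hm]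
    simp only [smul_eq_mul]
    ring
  refine ⟨hm.1.continuous.aestronglyMeasurable.mul hF.1, fun χ => ?_⟩
  simp only [e]
  exact hF.2 _

theorem isFunction_lp (f : L2) : IsFunction (f : 𝓢'(ℝ, ℂ)) f := by
  refine ⟨Lp.aestronglyMeasurable f, fun χ => ⟨?_, ?_⟩⟩
  · exact (χ.memLp 2 volume).integrable_mul (Lp.memLp f)
  · rw [Lp.toTemperedDistribution_apply]
    rfl

theorem isFunction_fourier_lp (f : L2) : IsFunction (𝓕 (f : 𝓢'(ℝ, ℂ))) (𝓕 f : L2) := by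
  rw [Lp.fourier_toTemperedDistribution_eq]
  exact isFunction_lp _

/-! ### Powers of the Japanese bracket -/

/-- The weight `(1 + ξ²)^{s/2}`. -/
def jap (s ξ : ℝ) : ℝ := (1 + ξ ^ 2) ^ (s / 2)

theorem jap_pos (s ξ : ℝ) : 0 < jap s ξ := Real.rpow_pos_of_pos (by positivity) _

theorem jap_neg_arg (s ξ : ℝ) : jap s (-ξ) = jap s ξ := by simp [jap]

theorem jap_mul_jap (s r ξ : ℝ) : jap s ξ * jap r ξ = jap (s + r) ξ := by
  rw [jap, jap, jap, ← Real.rpow_add (by positivity), add_div]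

theorem jap_zero (ξ : ℝ) : jap 0 ξ = 1 := by simp [jap]

theorem jap_two (ξ : ℝ) : jap 2 ξ = 1 + ξ ^ 2 := by simp [jap]

theorem jap_le_jap {s r : ℝ} (h : s ≤ r) (ξ : ℝ) : jap s ξ ≤ jap r ξ :=
  Real.rpow_le_rpow_of_exponent_le (by nlinarith [sq_nonneg ξ]) (by linarith)

theorem jap_neg (s ξ : ℝ) : jap (-s) ξ = (jap s ξ)⁻¹ := by
  rw [jap, jap, neg_div, Real.rpow_neg (by positivity)]

theorem abs_le_jap_one (ξ : ℝ) : |ξ| ≤ jap 1 ξ := by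
  rw [jap, ← Real.sqrt_eq_rpow]
  exact Real.abs_le_sqrt (by linarith)

theorem continuous_jap (s : ℝ) : Continuous (jap s) := by
  unfold jap
  refine Continuous.rpow_const (by fun_prop) fun ξ => Or.inl ?_
  positivity

theorem hasTemperateGrowth_jap (s : ℝ) : (fun ξ => (jap s ξ : ℂ)).HasTemperateGrowth := by
  have h : (fun ξ : ℝ => (((1 + ‖ξ‖ ^ 2) ^ (s / 2) : ℝ) : ℂ)).HasTemperateGrowth := by fun_prop
  simpa [jap] using h

/-- A measurable function of polynomial growth times a square integrable function defines a
tempered distribution. -/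
theorem exists_isFunction_mul {m : ℝ → ℂ} (hm : Measurable m) {C k : ℝ}
    (h : ∀ ξ, ‖m ξ‖ ≤ C * jap k ξ) (f : L2) :
    ∃ d : 𝓢'(ℝ, ℂ), IsFunction d (fun ξ => m ξ * f ξ) := by
  set n : ℝ → ℂ := fun ξ => m ξ * jap (-k) ξ with hn
  have hn' : IsBddSymbol n := by
    refine ⟨hm.mul (Complex.measurable_ofReal.comp (continuous_jap _).measurable), C, fun ξ => ?_⟩
    rw [hn]
    simp only [norm_mul, Complex.norm_real]
    rw [Real.norm_of_nonneg (jap_pos _ _).le, jap_neg, mul_inv_le_iff₀ (jap_pos k ξ)]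
    exact h ξ
  refine ⟨_, ((isFunction_lp (mul n f)).smulLeft (hasTemperateGrowth_jap k)).congr ?_⟩
  filter_upwards [mul_coe hn' f] with ξ h1
  rw [h1, hn]
  have : (jap k ξ : ℂ) * jap (-k) ξ = 1 := by
    rw [← Complex.ofReal_mul, jap_mul_jap]
    simp [jap_zero]
  calc (jap k ξ : ℂ) * (m ξ * jap (-k) ξ * f ξ) = ((jap k ξ : ℂ) * jap (-k) ξ) * (m ξ * f ξ) := by ring
    _ = m ξ * f ξ := by rw [this, one_mul]

/-! ### Real distributions -/

/-- The complex conjugate of a Schwartz function. -/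
def conjSchwartz (χ : 𝓢(ℝ, ℂ)) : 𝓢(ℝ, ℂ) :=
  SchwartzMap.postcompCLM (𝕜 := ℝ) (Complex.conjCLE : ℂ →L[ℝ] ℂ) χ

theorem conjSchwartz_apply (χ : 𝓢(ℝ, ℂ)) (x : ℝ) : conjSchwartz χ x = conj (χ x) := rfl

theorem fourierInv_conjSchwartz (χ : 𝓢(ℝ, ℂ)) (ξ : ℝ) :
    𝓕⁻ (conjSchwartz χ) ξ = conj (𝓕⁻ χ (-ξ)) := by
  rw [SchwartzMap.fourierInv_coe, SchwartzMap.fourierInv_coe, Real.fourierInv_eq',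
    Real.fourierInv_eq', ← integral_conj]
  apply integral_congr_ae
  refine ae_of_all _ fun v => ?_
  simp only [conjSchwartz_apply, smul_eq_mul, map_mul, ← Complex.exp_conj]
  congr 2
  simp [Complex.conj_ofNat]

theorem IsReal.apply_conj {d : 𝓢'(ℝ, ℂ)} (hd : IsReal d) (χ : 𝓢(ℝ, ℂ)) :
    d (conjSchwartz χ) = conj (d χ) := by
  have h1 := hd (χ + conjSchwartz χ) (fun x => by simp [conjSchwartz_apply])
  have h2 := hd (Complex.I • (χ - conjSchwartz χ)) (fun x => by simp [conjSchwartz_apply])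
  rw [map_add, Complex.add_im] at h1
  rw [map_smul, map_sub, smul_eq_mul, Complex.I_mul_im, Complex.sub_re] at h2
  apply Complex.ext
  · rw [Complex.conj_re]; linarith
  · rw [Complex.conj_im]; linarith

/-- A distribution is real if and only if its Fourier transform, when a function, is hermitian. -/
theorem isReal_iff_fourier {d : 𝓢'(ℝ, ℂ)} {B : ℝ → ℂ} (hB : IsFunction (𝓕 d) B) :
    IsReal d ↔ ∀ᵐ ξ, conj (B (-ξ)) = B ξ := by
  have hd : ∀ χ : 𝓢(ℝ, ℂ), d χ = ∫ ξ, 𝓕⁻ χ ξ * B ξ := fun χ => by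
    rw [← (hB.2 (𝓕⁻ χ)).2, TemperedDistribution.fourier_apply, FourierTransform.fourier_fourierInv_eq]
  have hconj : ∀ χ : 𝓢(ℝ, ℂ), conj (d (conjSchwartz χ)) = ∫ ξ, 𝓕⁻ χ ξ * conj (B (-ξ)) := by
    intro χ
    rw [hd, ← integral_conj, ← integral_neg_eq_self]
    simp only [map_mul, fourierInv_conjSchwartz, neg_neg, Complex.conj_conj]
  constructor
  · intro hr
    have hB' : IsFunction (𝓕 d) (fun ξ => conj (B (-ξ))) := by
      have hm : AEStronglyMeasurable (fun ξ => conj (B (-ξ))) volume :=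
        Complex.continuous_conj.comp_aestronglyMeasurable
          (hB.1.comp_quasiMeasurePreserving measurePreserving_neg.quasiMeasurePreserving)
      refine ⟨hm, fun χ => ⟨?_, ?_⟩⟩
      · have h1 := (hB.2 (conjSchwartz (SchwartzMap.compCLMOfContinuousLinearEquiv ℂ
          (ContinuousLinearEquiv.neg ℝ) χ))).1
        have h2 := h1.comp_neg
        refine (Complex.conjCLE.integrable_comp_iff.2 h2).congr (ae_of_all _ fun ξ => ?_)
        simp [conjSchwartz_apply]
      · have h3 := hconj (𝓕 χ)
        rw [hr.apply_conj, Complex.conj_conj, FourierTransform.fourierInv_fourier_eq] at h3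
        exact h3
    exact hB'.ae_eq hB
  · intro h χ hχ
    have e : conjSchwartz χ = χ := by
      ext x
      rw [conjSchwartz_apply, Complex.conj_eq_iff_im, hχ x]
    have h1 := hconj χ
    rw [e] at h1
    rw [← Complex.conj_eq_iff_im, h1, hd]
    apply integral_congr_ae
    filter_upwards [h] with ξ hξ
    rw [hξ]

theorem IsReal.im_eq_zero {d : 𝓢'(ℝ, ℂ)} (hd : IsReal d) {u : ℝ → ℂ} (hu : IsFunction d u) :
    ∀ᵐ x, (u x).im = 0 := by
  have hl : LocallyIntegrable (fun x => ((u x).im : ℂ)) volume := by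
    intro x
    obtain ⟨s, hs, hi⟩ := hu.locallyIntegrable x
    exact ⟨s, hs, (hi.im).ofReal⟩
  have h := ae_eq_zero_of_forall_real_schwartz hl (fun χ hχ => by
    have h1 := hd χ hχ
    have e : ∀ x, χ x * ((u x).im : ℂ) = ((χ x * u x).im : ℂ) := fun x => by
      apply Complex.ext <;> simp [hχ x]
    simp only [e]
    rw [integral_complex_ofReal]
    have h2 := integral_im (hu.2 χ).1
    simp only [RCLike.im_eq_complex_im] at h2
    rw [h2, ← (hu.2 χ).2, h1, Complex.ofReal_zero])
  filter_upwards [h] with x hx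
  exact Complex.ofReal_eq_zero.1 hx

theorem isReal_of_im_eq_zero {d : 𝓢'(ℝ, ℂ)} {u : ℝ → ℂ} (hu : IsFunction d u)
    (h : ∀ᵐ x, (u x).im = 0) : IsReal d := by
  intro χ hχ
  have h2 := integral_im (hu.2 χ).1
  simp only [RCLike.im_eq_complex_im] at h2
  rw [(hu.2 χ).2, ← h2]
  apply integral_eq_zero_of_ae
  filter_upwards [h] with x hx
  simp [hx, hχ x]

theorem isReal_lp_iff (f : L2) : IsReal (f : 𝓢'(ℝ, ℂ)) ↔ J (𝓕 f) = 𝓕 f := by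
  rw [isReal_iff_fourier (isFunction_fourier_lp f), J_eq_iff]

/-! ### Sobolev spaces on the Fourier side -/

/-- The isometry `f ↦ (1 + ξ²)^{s/2} 𝓕 f` of `H^s` into `L²`. -/
def ft (s : ℝ) : H s →ₗᵢ[ℝ] L2 where
  toFun f := 𝓕 (H.bessel s f)
  map_add' f g := by rw [map_add, FourierTransform.fourier_add]
  map_smul' c f := by
    rw [map_smul, RingHom.id_apply]
    exact ((Lp.fourierTransformₗᵢ ℝ ℂ).toLinearEquiv.toLinearMap.restrictScalars ℝ).map_smul c _
  norm_map' f := Lp.norm_fourier_eq (H.bessel s f)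

theorem isFunction_fourier_dist {s : ℝ} (f : H s) :
    IsFunction (𝓕 (H.dist f)) (fun ξ => (jap (-s) ξ : ℂ) * ft s f ξ) := by
  have h1 : H.dist f = besselPotential ℝ ℂ (-s) (H.besselFun f : 𝓢'(ℝ, ℂ)) := by
    rw [← H.besselFun_spec]
    simp
  have h2 := (isFunction_fourier_lp (H.besselFun f)).smulLeft (hasTemperateGrowth_jap (-s))
  rw [h1, fourier_besselPotential_eq_smulLeftCLM_fourier_apply]
  have e : (fun x : ℝ => (((1 + ‖x‖ ^ 2) ^ (-s / 2) : ℝ) : ℂ)) = fun ξ => (jap (-s) ξ : ℂ) := by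
    simp [jap]
  rw [e]
  exact h2

theorem J_ft {s : ℝ} (f : H s) : J (ft s f) = ft s f := by
  rw [J_eq_iff]
  filter_upwards [(isReal_iff_fourier (isFunction_fourier_dist f)).1 (H.isReal f)] with ξ h
  rw [map_mul, Complex.conj_ofReal, jap_neg_arg] at h
  exact mul_left_cancel₀ (by exact_mod_cast (jap_pos _ _).ne') h

/-- The element of `H^s` with `(1 + ξ²)^{s/2} 𝓕 f = b`, for a hermitian `b ∈ L²`. -/
def ofFt (s : ℝ) (b : L2) (hb : J b = b) : H s :=
  ⟨besselPotential ℝ ℂ (-s) ((𝓕⁻ b : L2) : 𝓢'(ℝ, ℂ)), ⟨𝓕⁻ b, by simp⟩, by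
    have h2 := (isFunction_fourier_lp (𝓕⁻ b : L2)).smulLeft (hasTemperateGrowth_jap (-s))
    have e : (fun x : ℝ => (((1 + ‖x‖ ^ 2) ^ (-s / 2) : ℝ) : ℂ)) = fun ξ => (jap (-s) ξ : ℂ) := by
      simp [jap]
    rw [← e, ← fourier_besselPotential_eq_smulLeftCLM_fourier_apply,
      FourierTransform.fourier_fourierInv_eq] at h2
    rw [isReal_iff_fourier h2]
    filter_upwards [J_eq_iff.1 hb] with ξ h
    rw [map_mul, h, Complex.conj_ofReal, jap_neg_arg]⟩

theorem ft_ofFt (s : ℝ) (b : L2) (hb : J b = b) : ft s (ofFt s b hb) = b := by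
  have h : H.bessel s (ofFt s b hb) = 𝓕⁻ b := by
    apply H.lp_dist_injective
    change ((H.besselFun (ofFt s b hb) : L2) : 𝓢'(ℝ, ℂ)) = _
    rw [← H.besselFun_spec]
    change besselPotential ℝ ℂ s (besselPotential ℝ ℂ (-s) ((𝓕⁻ b : L2) : 𝓢'(ℝ, ℂ))) = _
    simp
  change 𝓕 (H.bessel s (ofFt s b hb)) = b
  rw [h, FourierTransform.fourier_fourierInv_eq]

/-! ### Mean value estimates for functions of one real variable -/

theorem exists_lipschitz_bound {g : ℝ → ℝ} (hg : ContDiff ℝ 1 g) (R : ℝ) :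
    ∃ K : ℝ, 0 ≤ K ∧ (∀ a ∈ Icc (-R) R, |deriv g a| ≤ K) ∧
      ∀ a ∈ Icc (-R) R, ∀ b ∈ Icc (-R) R, |g a - g b| ≤ K * |a - b| := by
  obtain ⟨K, hK⟩ := (isCompact_Icc (a := -R) (b := R)).exists_bound_of_continuousOn
    (hg.continuous_deriv le_rfl).continuousOn
  have hK' : ∀ a ∈ Icc (-R) R, ‖deriv g a‖ ≤ max K 0 := fun a ha => (hK a ha).trans (le_max_left _ _)
  refine ⟨max K 0, le_max_right _ _, hK', fun a ha b hb => ?_⟩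
  exact Convex.norm_image_sub_le_of_norm_deriv_le
    (fun x _ => (hg.differentiable one_ne_zero) x) hK' (convex_Icc _ _) hb ha

theorem segment_mem_Icc {R a b s : ℝ} (ha : a ∈ Icc (-R) R) (hb : b ∈ Icc (-R) R)
    (hs : s ∈ Icc (0 : ℝ) 1) : b + s * (a - b) ∈ Icc (-R) R := by
  have := (convex_Icc (-R) R).add_smul_sub_mem hb ha hs
  simpa using this

theorem abs_second_difference_le {g : ℝ → ℝ} (hg : Differentiable ℝ g) {R K₁ K₂ : ℝ}
    (h1 : ∀ a ∈ Icc (-R) R, |deriv g a| ≤ K₁) (hK₂ : 0 ≤ K₂)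
    (h2 : ∀ a ∈ Icc (-R) R, ∀ b ∈ Icc (-R) R, |deriv g a - deriv g b| ≤ K₂ * |a - b|)
    {a b c d D : ℝ} (ha : a ∈ Icc (-R) R) (hb : b ∈ Icc (-R) R) (hc : c ∈ Icc (-R) R)
    (hd : d ∈ Icc (-R) R) (hac : |a - c| ≤ D) (hbd : |b - d| ≤ D) :
    |(g a - g c) - (g b - g d)| ≤ K₁ * |(a - c) - (b - d)| + K₂ * D * |c - d| := by
  have key := norm_image_sub_le_of_norm_deriv_le_segment_01'
    (f := fun s : ℝ => g (b + s * (a - b)) - g (d + s * (c - d)))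
    (f' := fun s => deriv g (b + s * (a - b)) * (a - b) - deriv g (d + s * (c - d)) * (c - d))
    (C := K₁ * |(a - c) - (b - d)| + K₂ * D * |c - d|)
    (fun s _ => by
      have l : ∀ p q : ℝ, HasDerivAt (fun s : ℝ => p + s * q) q s := fun p q => by
        simpa using ((hasDerivAt_id s).mul_const q).const_add p
      exact (((hg _).hasDerivAt.comp s (l b (a - b))).sub
        ((hg _).hasDerivAt.comp s (l d (c - d)))).hasDerivWithinAt)
    (fun s hs => by
      have hs' : s ∈ Icc (0 : ℝ) 1 := Ico_subset_Icc_self hs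
      have m1 := segment_mem_Icc ha hb hs'
      have m2 := segment_mem_Icc hc hd hs'
      set x := b + s * (a - b) with hx
      set y := d + s * (c - d) with hy
      have e : deriv g x * (a - b) - deriv g y * (c - d) =
          deriv g x * ((a - c) - (b - d)) + (deriv g x - deriv g y) * (c - d) := by ring
      have hxy : |x - y| ≤ D := by
        have e2 : x - y = (1 - s) * (b - d) + s * (a - c) := by rw [hx, hy]; ring
        rw [e2]
        calc |(1 - s) * (b - d) + s * (a - c)| ≤ |(1 - s) * (b - d)| + |s * (a - c)| := abs_add_le _ _
          _ = (1 - s) * |b - d| + s * |a - c| := by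
            rw [abs_mul, abs_mul, abs_of_nonneg hs'.1, abs_of_nonneg (sub_nonneg.2 hs'.2)]
          _ ≤ (1 - s) * D + s * D := by
            gcongr
            · exact sub_nonneg.2 hs'.2
            · exact hs'.1
          _ = D := by ring
      rw [e, Real.norm_eq_abs]
      refine (abs_add_le _ _).trans ?_
      rw [abs_mul, abs_mul]
      gcongr
      · exact h1 _ m1
      · exact (h2 _ m1 _ m2).trans (mul_le_mul_of_nonneg_left hxy hK₂))
  simp only [one_mul, zero_mul, add_zero, add_sub_cancel, Real.norm_eq_abs] at key
  convert key using 2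

theorem hasDerivAt_primitive {g : ℝ → ℝ} (hg : Continuous g) (y : ℝ) :
    HasDerivAt (fun z => ∫ p in (0 : ℝ)..z, g p) (g y) y :=
  intervalIntegral.integral_hasDerivAt_right (hg.intervalIntegrable _ _)
    (hg.stronglyMeasurableAtFilter _ _) hg.continuousAt

theorem abs_primitive_taylor_le {g : ℝ → ℝ} (hg : Continuous g) {R K : ℝ} (hK : 0 ≤ K)
    (h : ∀ a ∈ Icc (-R) R, ∀ b ∈ Icc (-R) R, |g a - g b| ≤ K * |a - b|)
    {a b : ℝ} (ha : a ∈ Icc (-R) R) (hb : b ∈ Icc (-R) R) :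
    |(∫ p in (0 : ℝ)..b, g p) - (∫ p in (0 : ℝ)..a, g p) - g a * (b - a)| ≤ K * (b - a) ^ 2 := by
  have key := norm_image_sub_le_of_norm_deriv_le_segment_01'
    (f := fun s : ℝ => (∫ p in (0 : ℝ)..(a + s * (b - a)), g p) - s * (g a * (b - a)))
    (f' := fun s => g (a + s * (b - a)) * (b - a) - g a * (b - a))
    (C := K * (b - a) ^ 2)
    (fun s _ => by
      have l : ∀ p q : ℝ, HasDerivAt (fun s : ℝ => p + s * q) q s := fun p q => by
        simpa using ((hasDerivAt_id s).mul_const q).const_add p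
      have l2 := (hasDerivAt_id s).mul_const (g a * (b - a))
      rw [one_mul] at l2
      exact (((hasDerivAt_primitive hg _).comp s (l a (b - a))).sub l2).hasDerivWithinAt)
    (fun s hs => by
      have hs' : s ∈ Icc (0 : ℝ) 1 := Ico_subset_Icc_self hs
      rw [← sub_mul, Real.norm_eq_abs, abs_mul, ← sq_abs (b - a), pow_two, ← mul_assoc]
      gcongr
      refine (h _ (segment_mem_Icc hb ha hs') _ ha).trans ?_
      rw [add_sub_cancel_left, abs_mul, abs_of_nonneg hs'.1]
      gcongr
      exact mul_le_of_le_one_left (abs_nonneg _) hs'.2)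
  simp only [one_mul, zero_mul, add_zero, sub_zero, add_sub_cancel, Real.norm_eq_abs] at key
  convert key using 2
  ring

/-! ### Translations and difference quotients -/

/-- The translation `f ↦ f(· + s)` of `L²`. -/
def trans (s : ℝ) : L2 →ₗᵢ[ℂ] L2 :=
  Lp.compMeasurePreservingₗᵢ ℂ (fun x : ℝ => x + s) (measurePreserving_add_right volume s)

theorem trans_coe (s : ℝ) (f : L2) : trans s f =ᵐ[volume] fun x => f (x + s) :=
  Lp.coeFn_compMeasurePreserving f (measurePreserving_add_right volume s)

theorem ae_translate {p : ℝ → Prop} (h : ∀ᵐ x, p x) (s : ℝ) : ∀ᵐ x, p (x + s) :=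
  (measurePreserving_add_right volume s).quasiMeasurePreserving.ae h

/-- The Fourier transform turns the translation by `s` into the multiplication by `exp(2πisξ)`. -/
theorem fourier_trans (s : ℝ) (f : L2) :
    𝓕 (trans s f) = group (fun ξ => 2 * Real.pi * ξ) s (𝓕 f) := by
  have hω : Measurable (fun ξ : ℝ => 2 * Real.pi * ξ) := by fun_prop
  refine DenseRange.induction_on (p := fun f : L2 =>
      𝓕 (trans s f) = group (fun ξ => 2 * Real.pi * ξ) s (𝓕 f))
    (SchwartzMap.denseRange_toLpCLM (E := ℝ) (F := ℂ) (p := 2) (μ := volume)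
      ENNReal.ofNat_ne_top) f ?_ fun χ => ?_
  · have c1 : Continuous (fun f : L2 => 𝓕 f) := (Lp.fourierTransformₗᵢ ℝ ℂ).continuous
    exact isClosed_eq (c1.comp (trans s).continuous) ((group _ s).continuous.comp c1)
  · have e1 : trans s (χ.toLp 2) = (χ.compSubConstCLM ℂ (-s)).toLp 2 volume := by
      apply Lp.ext
      filter_upwards [trans_coe s (χ.toLp 2), ae_translate (χ.coeFn_toLp 2 volume) s,
        (χ.compSubConstCLM ℂ (-s)).coeFn_toLp 2 volume] with x h1 h2 h3
      rw [h1, h2, h3, SchwartzMap.compSubConstCLM_apply, sub_neg_eq_add]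
    change 𝓕 (trans s (χ.toLp 2)) = group _ s (𝓕 (χ.toLp 2))
    rw [e1, SchwartzMap.toLp_fourier_eq, SchwartzMap.toLp_fourier_eq]
    apply Lp.ext
    filter_upwards [(𝓕 (χ.compSubConstCLM ℂ (-s))).coeFn_toLp 2 volume,
      mul_coe (isBddSymbol_exp hω s) ((𝓕 χ).toLp 2), (𝓕 χ).coeFn_toLp 2 volume] with ξ h1 h2 h3
    rw [group, h1, h2, h3, SchwartzMap.fourier_coe, SchwartzMap.fourier_coe]
    have e2 : (χ.compSubConstCLM ℂ (-s) : ℝ → ℂ) = χ ∘ fun v => v + s := by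
      ext v
      simp
    rw [e2]
    have e3 := congrFun (VectorFourier.fourierIntegral_comp_add_right Real.fourierChar volume
      (innerₗ ℝ) (χ : ℝ → ℂ) s) ξ
    refine e3.trans ?_
    rw [Circle.smul_def, smul_eq_mul, Real.fourierChar_apply, expSymbol]
    congr 2
    simp
    ring

/-- The frequency weight `2π|ξ|`, the symbol of `Λ = (-∂²)^{1/2}`. -/
def wt (ξ : ℝ) : ℝ := 2 * Real.pi * |ξ|

theorem measurable_wt : Measurable wt := by unfold wt; fun_prop

theorem wt_nonneg (ξ : ℝ) : 0 ≤ wt ξ := by unfold wt; positivity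

theorem wt_neg (ξ : ℝ) : wt (-ξ) = wt ξ := by simp [wt]

/-- If the difference quotients of `h` are bounded in `L²` then `|D| h` is in `L²` with the same bound,
by Fatou's lemma on the Fourier side. -/
theorem memLp_wt_of_translation {h : L2} {C : ℝ} (hC : 0 ≤ C)
    (hh : ∀ s, ‖trans s h - h‖ ≤ C * |s|) :
    ∃ hm : MemLp (fun ξ => (wt ξ : ℂ) * (𝓕 h : L2) ξ) 2 volume, ‖hm.toLp _‖ ≤ C := by
  set F : ℕ → L2 := fun n => ((n : ℂ) + 1) • (𝓕 (trans ((n : ℝ) + 1)⁻¹ h) - 𝓕 h) with hF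
  have hFn : ∀ n, ‖F n‖ ≤ C := fun n => by
    have hn : (0 : ℝ) < (n : ℝ) + 1 := by positivity
    have e1 : ‖((n : ℂ) + 1)‖ = (n : ℝ) + 1 := by
      have : ((n : ℂ) + 1) = (((n : ℝ) + 1 : ℝ) : ℂ) := by push_cast; rfl
      rw [this, Complex.norm_real, Real.norm_of_nonneg hn.le]
    have e2 : ‖𝓕 (trans ((n : ℝ) + 1)⁻¹ h) - 𝓕 h‖ = ‖trans ((n : ℝ) + 1)⁻¹ h - h‖ := by
      rw [← Lp.norm_fourier_eq (trans ((n : ℝ) + 1)⁻¹ h - h)]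
      congr 1
      exact (map_sub (Lp.fourierTransformₗᵢ ℝ ℂ) _ _).symm
    rw [hF, norm_smul, e1, e2]
    calc ((n : ℝ) + 1) * ‖trans ((n : ℝ) + 1)⁻¹ h - h‖ ≤ ((n : ℝ) + 1) * (C * |((n : ℝ) + 1)⁻¹|) := by
          gcongr; exact hh _
      _ = C := by rw [abs_of_pos (inv_pos.2 hn)]; field_simp
  have hlim : ∀ᵐ ξ, Tendsto (fun n => F n ξ) atTop
      (𝓝 (Complex.I * ((2 * Real.pi * ξ : ℝ) : ℂ) * (𝓕 h : L2) ξ)) := by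
    have hω : Measurable (fun ξ : ℝ => 2 * Real.pi * ξ) := by fun_prop
    have h1 : ∀ n : ℕ, ∀ᵐ ξ, F n ξ = ((n : ℂ) + 1) *
        (expSymbol (fun ξ => 2 * Real.pi * ξ) ((n : ℝ) + 1)⁻¹ ξ - 1) * (𝓕 h : L2) ξ := by
      intro n
      rw [hF]
      simp only
      rw [fourier_trans, group]
      filter_upwards [Lp.coeFn_smul ((n : ℂ) + 1)
        (mul (expSymbol (fun ξ => 2 * Real.pi * ξ) ((n : ℝ) + 1)⁻¹) (𝓕 h) - 𝓕 h),
        Lp.coeFn_sub (mul (expSymbol (fun ξ => 2 * Real.pi * ξ) ((n : ℝ) + 1)⁻¹) (𝓕 h)) (𝓕 h),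
        mul_coe (isBddSymbol_exp hω ((n : ℝ) + 1)⁻¹) (𝓕 h)] with ξ h1 h2 h3
      rw [h1, Pi.smul_apply, h2, Pi.sub_apply, h3, smul_eq_mul]
      ring
    rw [← ae_all_iff] at h1
    filter_upwards [h1] with ξ h1
    simp only [h1]
    refine Tendsto.mul_const _ ?_
    have hd := (hasDerivAt_expSymbol (fun ξ => 2 * Real.pi * ξ) 0 ξ)
    rw [hasDerivAt_iff_tendsto_slope_zero] at hd
    have ht : Tendsto (fun n : ℕ => ((n : ℝ) + 1)⁻¹) atTop (𝓝[≠] 0) := by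
      refine tendsto_nhdsWithin_iff.2 ⟨?_, Eventually.of_forall fun n => ?_⟩
      · exact tendsto_inv_atTop_zero.comp
          (tendsto_atTop_add_const_right _ _ tendsto_natCast_atTop_atTop)
      · exact (inv_pos.2 (by positivity : (0 : ℝ) < (n : ℝ) + 1)).ne'
    have := hd.comp ht
    convert this using 2
    · simp [expSymbol]
    · simp [expSymbol]
  have hle : eLpNorm (fun ξ => Complex.I * ((2 * Real.pi * ξ : ℝ) : ℂ) * (𝓕 h : L2) ξ) 2 volume ≤
      ENNReal.ofReal C := by
    refine (Lp.eLpNorm_lim_le_liminf_eLpNorm (fun n => Lp.aestronglyMeasurable (F n)) _ hlim).trans ?_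
    refine liminf_le_of_le (by isBoundedDefault) fun b hb => ?_
    obtain ⟨n, hn⟩ := hb.exists
    refine hn.trans ?_
    rw [← Lp.enorm_def, ← ofReal_norm]
    exact ENNReal.ofReal_le_ofReal (hFn n)
  have heq : eLpNorm (fun ξ => (wt ξ : ℂ) * (𝓕 h : L2) ξ) 2 volume =
      eLpNorm (fun ξ => Complex.I * ((2 * Real.pi * ξ : ℝ) : ℂ) * (𝓕 h : L2) ξ) 2 volume := by
    refine eLpNorm_congr_norm_ae (ae_of_all _ fun ξ => ?_)
    simp [wt, abs_of_pos Real.pi_pos]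
  have hmeas : AEStronglyMeasurable (fun ξ => (wt ξ : ℂ) * (𝓕 h : L2) ξ) volume :=
    (Complex.measurable_ofReal.comp measurable_wt).aestronglyMeasurable.mul
      (Lp.aestronglyMeasurable _)
  have hm : MemLp (fun ξ => (wt ξ : ℂ) * (𝓕 h : L2) ξ) 2 volume :=
    ⟨hmeas, (heq.trans_le hle).trans_lt ENNReal.ofReal_lt_top⟩
  refine ⟨hm, ?_⟩
  rw [Lp.norm_toLp, heq]
  exact ENNReal.toReal_le_of_le_ofReal hC hle

/-! ### The Sobolev space `H¹` -/

theorem isBddSymbol_jap {s : ℝ} (hs : s ≤ 0) : IsBddSymbol (fun ξ => (jap s ξ : ℂ)) := by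
  refine ⟨Complex.measurable_ofReal.comp (continuous_jap s).measurable, 1, fun ξ => ?_⟩
  rw [Complex.norm_real, Real.norm_of_nonneg (jap_pos _ _).le, ← jap_zero ξ]
  exact jap_le_jap hs ξ

/-- The operator `b ↦ 𝓕⁻¹ ((1 + ξ²)^{-1/2} b)`, an isomorphism of `L²` onto `H¹`. -/
def bess (b : L2) : L2 := 𝓕⁻ (mul (fun ξ => (jap (-1) ξ : ℂ)) b)

theorem fourier_bess (b : L2) : 𝓕 (bess b) = mul (fun ξ => (jap (-1) ξ : ℂ)) b :=
  FourierTransform.fourier_fourierInv_eq _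

theorem bess_sub (b c : L2) : bess (b - c) = bess b - bess c := by
  rw [bess, map_sub]
  exact map_sub (Lp.fourierTransformₗᵢ ℝ ℂ).symm _ _

theorem memLp_jap : MemLp (fun ξ => (jap (-1) ξ : ℂ)) 2 volume := by
  refine MemLp.ofReal ?_
  refine (memLp_two_iff_integrable_sq (continuous_jap _).aestronglyMeasurable).2 ?_
  refine integrable_inv_one_add_sq.congr (ae_of_all _ fun ξ => ?_)
  change (1 + ξ ^ 2)⁻¹ = jap (-1) ξ ^ 2
  rw [pow_two (jap (-1) ξ), jap_mul_jap, ← jap_two, ← jap_neg]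
  norm_num

/-- The Sobolev embedding of `H¹` into the space of bounded functions. -/
theorem exists_bess_bound : ∃ C : ℝ, 0 ≤ C ∧ ∀ b : L2, ∀ᵐ x, ‖bess b x‖ ≤ C * ‖b‖ := by
  set k : L2 := memLp_jap.toLp _ with hk
  refine ⟨‖k‖, norm_nonneg _, fun b => ?_⟩
  set F : L2 := mul (fun ξ => (jap (-1) ξ : ℂ)) b with hF
  have hb := isBddSymbol_jap (s := -1) (by norm_num)
  have hae : (fun ξ => conj (k ξ) * b ξ) =ᵐ[volume] F := by
    filter_upwards [mul_coe hb b, memLp_jap.coeFn_toLp] with ξ h1 h2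
    rw [hF, h1, hk, h2, Complex.conj_ofReal]
  have hint : Integrable F volume := by
    refine Integrable.congr ?_ hae
    exact (Lp.memLp k).star.integrable_mul (Lp.memLp b)
  have hnorm : ∫ ξ, ‖F ξ‖ ≤ ‖k‖ * ‖b‖ := by
    have h1 : ∫ ξ, ‖F ξ‖ = ∫ ξ, ‖k ξ‖ * ‖b ξ‖ := by
      refine integral_congr_ae ?_
      filter_upwards [hae] with ξ h
      rw [← h, norm_mul, RCLike.norm_conj]
    have h2 := integral_mul_le_Lp_mul_Lq_of_nonneg (μ := (volume : Measure ℝ))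
      Real.HolderConjugate.two_two (f := fun ξ => ‖k ξ‖) (g := fun ξ => ‖b ξ‖)
      (ae_of_all _ fun _ => norm_nonneg _) (ae_of_all _ fun _ => norm_nonneg _)
      (by simpa using (Lp.memLp k).norm) (by simpa using (Lp.memLp b).norm)
    rw [h1]
    refine h2.trans_eq ?_
    have e : ∀ f : L2, (∫ ξ, ‖f ξ‖ ^ (2 : ℝ)) ^ (1 / (2 : ℝ)) = ‖f‖ := fun f => by
      simp only [Real.rpow_ofNat]
      rw [← L2.norm_sq_eq, ← Real.sqrt_eq_rpow, Real.sqrt_sq (norm_nonneg _)]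
    rw [e, e]
  have hfun : IsFunction (bess b : 𝓢'(ℝ, ℂ)) (𝓕⁻ (F : ℝ → ℂ)) := by
    have hcont : Continuous (𝓕⁻ (F : ℝ → ℂ)) :=
      VectorFourier.fourierIntegral_continuous Real.continuous_fourierChar
        (by simp only [LinearMap.neg_apply, innerₗ_apply_apply]; exact continuous_inner.neg) hint
    have hbd : ∀ x, ‖𝓕⁻ (F : ℝ → ℂ) x‖ ≤ ∫ ξ, ‖F ξ‖ :=
      VectorFourier.norm_fourierIntegral_le_integral_norm _ _ _ _
    refine ⟨hcont.aestronglyMeasurable, fun χ => ⟨?_, ?_⟩⟩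
    · exact χ.integrable.mul_bdd hcont.aestronglyMeasurable (ae_of_all _ hbd)
    · have h1 : (bess b : 𝓢'(ℝ, ℂ)) χ = ∫ ξ, 𝓕⁻ χ ξ * F ξ := by
        rw [← ((isFunction_lp F).2 (𝓕⁻ χ)).2, hF, bess, ← Lp.fourierInv_toTemperedDistribution_eq]
        rfl
      rw [h1, SchwartzMap.fourierInv_coe]
      have h2 := VectorFourier.integral_fourierIntegral_smul_eq_flip (μ := volume) (ν := volume)
        (L := -innerₗ ℝ) Real.continuous_fourierChar (by
          simp only [LinearMap.neg_apply, innerₗ_apply_apply]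
          exact continuous_inner.neg)
        χ.integrable hint
      have h3 : (-innerₗ ℝ : ℝ →ₗ[ℝ] ℝ →ₗ[ℝ] ℝ).flip = -innerₗ ℝ := by
        ext; simp
      rw [h3] at h2
      exact h2
  filter_upwards [(isFunction_lp (bess b)).ae_eq hfun] with x hx
  rw [hx]
  exact (VectorFourier.norm_fourierIntegral_le_integral_norm _ _ _ _ _).trans hnorm

theorem norm_trans_bess_sub_le (s : ℝ) (b : L2) :
    ‖trans s (bess b) - bess b‖ ≤ 2 * Real.pi * |s| * ‖b‖ := by
  have hω : Measurable (fun ξ : ℝ => 2 * Real.pi * ξ) := by fun_prop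
  have hb := isBddSymbol_jap (s := -1) (by norm_num)
  have e : 𝓕 (trans s (bess b) - bess b) =
      group (fun ξ => 2 * Real.pi * ξ) s (mul (fun ξ => (jap (-1) ξ : ℂ)) b) -
        mul (fun ξ => (jap (-1) ξ : ℂ)) b := by
    rw [← fourier_bess, ← fourier_trans]
    exact map_sub (Lp.fourierTransformₗᵢ ℝ ℂ) _ _
  rw [← Lp.norm_fourier_eq, e, group]
  refine L2.norm_le_of_ae ?_
  filter_upwards [Lp.coeFn_sub (mul (expSymbol (fun ξ => 2 * Real.pi * ξ) s)
      (mul (fun ξ => (jap (-1) ξ : ℂ)) b)) (mul (fun ξ => (jap (-1) ξ : ℂ)) b), mul_coe hb b,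
    mul_coe (isBddSymbol_exp hω s) (mul (fun ξ => (jap (-1) ξ : ℂ)) b)] with ξ h1 h2 h3
  rw [h1, Pi.sub_apply, h3, h2, ← sub_one_mul, norm_mul, norm_mul, ← mul_assoc, Complex.norm_real,
    Real.norm_of_nonneg (jap_pos _ _).le]
  refine mul_le_mul_of_nonneg_right ?_ (norm_nonneg _)
  have h4 := norm_expSymbol_sub_le (fun ξ => 2 * Real.pi * ξ) s 0 ξ
  have h5 : expSymbol (fun ξ => 2 * Real.pi * ξ) 0 ξ = 1 := by simp [expSymbol]
  rw [h5, sub_zero, abs_mul, abs_of_pos Real.two_pi_pos] at h4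
  calc ‖expSymbol (fun ξ => 2 * Real.pi * ξ) s ξ - 1‖ * jap (-1) ξ
      ≤ (2 * Real.pi * |ξ| * |s|) * jap (-1) ξ := by
        gcongr
        exact (jap_pos _ _).le
    _ = 2 * Real.pi * |s| * (|ξ| * jap (-1) ξ) := by ring
    _ ≤ 2 * Real.pi * |s| * 1 := by
        gcongr
        rw [jap_neg, mul_inv_le_iff₀ (jap_pos _ _), one_mul]
        exact abs_le_jap_one ξ
    _ = 2 * Real.pi * |s| := mul_one _

/-! ### The nonlinearity on `H¹` -/

theorem re_mem_Icc {R : ℝ} {z : ℂ} (h : ‖z‖ ≤ R) : z.re ∈ Icc (-R) R :=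
  abs_le.1 ((Complex.abs_re_le_norm z).trans h)

theorem memLp_comp_re {g : ℝ → ℝ} (hg : ContDiff ℝ 1 g) (g0 : g 0 = 0) {u : L2} {R : ℝ}
    (hu : ∀ᵐ x, ‖u x‖ ≤ R) : MemLp (fun x => (g (u x).re : ℂ)) 2 volume := by
  obtain ⟨K, hK, -, h⟩ := exists_lipschitz_bound hg R
  have hm : AEStronglyMeasurable (fun x => (g (u x).re : ℂ)) volume :=
    (Complex.continuous_ofReal.comp (hg.continuous.comp Complex.continuous_re)
      ).comp_aestronglyMeasurable (Lp.aestronglyMeasurable u)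
  refine (Lp.memLp u).of_le_mul (c := K) hm ?_
  filter_upwards [hu] with x hx
  have hR : 0 ≤ R := (norm_nonneg _).trans hx
  have := h _ (re_mem_Icc hx) 0 ⟨by linarith, hR⟩
  rw [g0, sub_zero, sub_zero] at this
  rw [Complex.norm_real, Real.norm_eq_abs]
  exact this.trans (mul_le_mul_of_nonneg_left (Complex.abs_re_le_norm _) hK)

open Classical in
/-- The composition `g(Re u)` as a square integrable function (and `0` if it is not one). -/
def compL2 (g : ℝ → ℝ) (u : L2) : L2 :=
  if h : MemLp (fun x => (g (u x).re : ℂ)) 2 volume then h.toLp _ else 0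

theorem compL2_coe {g : ℝ → ℝ} (hg : ContDiff ℝ 1 g) (g0 : g 0 = 0) {u : L2} {R : ℝ}
    (hu : ∀ᵐ x, ‖u x‖ ≤ R) : compL2 g u =ᵐ[volume] fun x => (g (u x).re : ℂ) := by
  rw [compL2, dif_pos (memLp_comp_re hg g0 hu)]
  exact MemLp.coeFn_toLp _

theorem compL2_bess_coe {g : ℝ → ℝ} (hg : ContDiff ℝ 1 g) (g0 : g 0 = 0) (b : L2) :
    compL2 g (bess b) =ᵐ[volume] fun x => (g (bess b x).re : ℂ) := by
  obtain ⟨C, -, hC⟩ := exists_bess_bound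
  exact compL2_coe hg g0 (hC b)

theorem L2.norm_le_add_of_ae {f p q : L2} {A B : ℝ} (hA : 0 ≤ A) (hB : 0 ≤ B)
    (h : ∀ᵐ x, ‖f x‖ ≤ A * ‖p x‖ + B * ‖q x‖) : ‖f‖ ≤ A * ‖p‖ + B * ‖q‖ := by
  set P : Lp ℝ 2 (volume : Measure ℝ) := (Lp.memLp p).norm.toLp _ with hP
  set Q : Lp ℝ 2 (volume : Measure ℝ) := (Lp.memLp q).norm.toLp _ with hQ
  have nP : ‖P‖ = ‖p‖ := by
    rw [hP, Lp.norm_toLp, eLpNorm_norm, Lp.norm_def]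
  have nQ : ‖Q‖ = ‖q‖ := by
    rw [hQ, Lp.norm_toLp, eLpNorm_norm, Lp.norm_def]
  have h1 : ‖f‖ ≤ ‖A • P + B • Q‖ := by
    refine Lp.norm_le_norm_of_ae_le ?_
    filter_upwards [h, Lp.coeFn_add (A • P) (B • Q), Lp.coeFn_smul A P, Lp.coeFn_smul B Q,
      (Lp.memLp p).norm.coeFn_toLp, (Lp.memLp q).norm.coeFn_toLp] with x h h1 h2 h3 h4 h5
    rw [h1, Pi.add_apply, h2, h3, Pi.smul_apply, Pi.smul_apply, hP, hQ, h4, h5, smul_eq_mul,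
      smul_eq_mul]
    exact h.trans (le_abs_self _)
  refine h1.trans ((norm_add_le _ _).trans ?_)
  rw [norm_smul, norm_smul, nP, nQ, Real.norm_of_nonneg hA, Real.norm_of_nonneg hB]

theorem contDiff_one_deriv {g : ℝ → ℝ} (hg : ContDiff ℝ 2 g) : ContDiff ℝ 1 (deriv g) := by
  have : ContDiff ℝ (1 + 1) g := by
    have e : (1 + 1 : WithTop ℕ∞) = 2 := by norm_num
    rwa [e]
  exact (contDiff_succ_iff_deriv.1 this).2.2

/-- The difference quotients of `g(u) - g(v)` are controlled by the `H¹` norm of `u - v`. -/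
theorem exists_translation_bound {g : ℝ → ℝ} (hg : ContDiff ℝ 2 g) (g0 : g 0 = 0) (M : ℝ) :
    ∃ K : ℝ, 0 ≤ K ∧ ∀ b c : L2, ‖b‖ ≤ M → ‖c‖ ≤ M → ∀ s,
      ‖trans s (compL2 g (bess b) - compL2 g (bess c)) -
        (compL2 g (bess b) - compL2 g (bess c))‖ ≤ K * ‖b - c‖ * |s| := by
  have hg1 : ContDiff ℝ 1 g := hg.of_le (by norm_num)
  obtain ⟨C, hC0, hC⟩ := exists_bess_bound
  obtain ⟨K₁, hK₁, h1, -⟩ := exists_lipschitz_bound hg1 (C * M)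
  obtain ⟨K₂, hK₂, -, h2⟩ := exists_lipschitz_bound (contDiff_one_deriv hg) (C * M)
  have hpi := Real.two_pi_pos.le
  refine ⟨2 * Real.pi * (K₁ + K₂ * C * |M|), by positivity, fun b c hb hc s => ?_⟩
  set u := bess b
  set v := bess c
  have hub : ∀ᵐ x, ‖u x‖ ≤ C * M := by
    filter_upwards [hC b] with x hx using hx.trans (by gcongr)
  have hvb : ∀ᵐ x, ‖v x‖ ≤ C * M := by
    filter_upwards [hC c] with x hx using hx.trans (by gcongr)
  have huv : ∀ᵐ x, ‖u x - v x‖ ≤ C * ‖b - c‖ := by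
    have e : bess (b - c) = u - v := bess_sub b c
    filter_upwards [hC (b - c), Lp.coeFn_sub u v] with x hx h
    rwa [e, h] at hx
  have key := L2.norm_le_add_of_ae
    (f := trans s (compL2 g u - compL2 g v) - (compL2 g u - compL2 g v))
    (p := trans s (u - v) - (u - v)) (q := trans s v - v)
    (A := K₁) (B := K₂ * (C * ‖b - c‖)) hK₁ (by positivity) (by
      have gu := compL2_bess_coe hg1 g0 b
      have gv := compL2_bess_coe hg1 g0 c
      have gs := Lp.coeFn_sub (compL2 g u) (compL2 g v)
      have us := Lp.coeFn_sub u v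
      filter_upwards [hub, hvb, huv, ae_translate hub s, ae_translate hvb s, ae_translate huv s,
        gu, gv, ae_translate gu s, ae_translate gv s, gs, ae_translate gs s, us, ae_translate us s,
        Lp.coeFn_sub (trans s (compL2 g u - compL2 g v)) (compL2 g u - compL2 g v),
        trans_coe s (compL2 g u - compL2 g v), Lp.coeFn_sub (trans s (u - v)) (u - v),
        trans_coe s (u - v), Lp.coeFn_sub (trans s v) v, trans_coe s v]
        with x a1 a2 a3 a4 a5 a6 e1 e2 e3 e4 e5 e6 e7 e8 e9 e10 e11 e12 e13 e14
      rw [e9, Pi.sub_apply, e10, e6, Pi.sub_apply, e5, Pi.sub_apply, e1, e2, e3, e4,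
        e11, Pi.sub_apply, e12, e8, Pi.sub_apply, e7, Pi.sub_apply, e13, Pi.sub_apply, e14]
      have hs := abs_second_difference_le (hg1.differentiable one_ne_zero) h1 hK₂ h2
        (re_mem_Icc a4) (re_mem_Icc a1) (re_mem_Icc a5) (re_mem_Icc a2)
        (D := C * ‖b - c‖) ((Complex.abs_re_le_norm (u (x + s) - v (x + s))).trans a6)
        ((Complex.abs_re_le_norm (u x - v x)).trans a3)
      rw [← Complex.ofReal_sub, ← Complex.ofReal_sub, ← Complex.ofReal_sub, Complex.norm_real,
        Real.norm_eq_abs]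
      refine hs.trans ?_
      gcongr
      · exact Complex.abs_re_le_norm (u (x + s) - v (x + s) - (u x - v x))
      · exact Complex.abs_re_le_norm (v (x + s) - v x))
  have k1 := norm_trans_bess_sub_le s (b - c)
  rw [bess_sub] at k1
  have k2 := norm_trans_bess_sub_le s c
  calc _ ≤ K₁ * ‖trans s (u - v) - (u - v)‖ + K₂ * (C * ‖b - c‖) * ‖trans s v - v‖ := key
    _ ≤ K₁ * (2 * Real.pi * |s| * ‖b - c‖) + K₂ * (C * ‖b - c‖) * (2 * Real.pi * |s| * |M|) := by
      gcongr
      exact k2.trans (by gcongr; exact hc.trans (le_abs_self M))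
    _ = _ := by ring

theorem bess_zero : bess 0 = 0 := by
  have := bess_sub 0 0
  simpa using this

theorem compL2_bess_zero {g : ℝ → ℝ} (hg : ContDiff ℝ 1 g) (g0 : g 0 = 0) :
    compL2 g (bess 0) = 0 := by
  apply Lp.ext
  filter_upwards [compL2_bess_coe hg g0 0, Lp.coeFn_zero ℂ 2 (volume : Measure ℝ)] with x h1 h2
  rw [h1, h2, bess_zero, h2]
  simp [g0]

theorem memLp_wt_comp {g : ℝ → ℝ} (hg : ContDiff ℝ 2 g) (g0 : g 0 = 0) (b : L2) :
    MemLp (fun ξ => (wt ξ : ℂ) * (𝓕 (compL2 g (bess b)) : L2) ξ) 2 volume := by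
  obtain ⟨K, hK, h⟩ := exists_translation_bound hg g0 ‖b‖
  refine (memLp_wt_of_translation (h := compL2 g (bess b)) (C := K * ‖b‖) (by positivity)
    fun s => ?_).1
  have := h b 0 le_rfl (by simp) s
  rwa [compL2_bess_zero (hg.of_le (by norm_num)) g0, sub_zero, sub_zero] at this

open Classical in
/-- The function `|D| g(u)` on the Fourier side, where `u ∈ H¹` is given by
`(1 + ξ²)^{1/2} 𝓕 u = b`. -/
def nl (g : ℝ → ℝ) (b : L2) : L2 :=
  if h : MemLp (fun ξ => (wt ξ : ℂ) * (𝓕 (compL2 g (bess b)) : L2) ξ) 2 volume then h.toLp _ else 0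

theorem nl_coe {g : ℝ → ℝ} (hg : ContDiff ℝ 2 g) (g0 : g 0 = 0) (b : L2) :
    nl g b =ᵐ[volume] fun ξ => (wt ξ : ℂ) * (𝓕 (compL2 g (bess b)) : L2) ξ := by
  rw [nl, dif_pos (memLp_wt_comp hg g0 b)]
  exact MemLp.coeFn_toLp _

theorem nl_lipschitz {g : ℝ → ℝ} (hg : ContDiff ℝ 2 g) (g0 : g 0 = 0) (M : ℝ) :
    ∃ K : ℝ≥0, LipschitzOnWith K (nl g) (closedBall 0 M) := by
  obtain ⟨K, hK, h⟩ := exists_translation_bound hg g0 M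
  refine ⟨K.toNNReal, LipschitzOnWith.of_dist_le_mul fun b hb c hc => ?_⟩
  rw [Real.coe_toNNReal _ hK, dist_eq_norm, dist_eq_norm]
  obtain ⟨hm, hle⟩ := memLp_wt_of_translation (C := K * ‖b - c‖) (by positivity)
    (h b c (by simpa using hb) (by simpa using hc))
  refine le_of_eq_of_le ?_ hle
  congr 1
  apply Lp.ext
  have e : (𝓕 (compL2 g (bess b) - compL2 g (bess c)) : L2) =
    𝓕 (compL2 g (bess b)) - 𝓕 (compL2 g (bess c)) := map_sub (Lp.fourierTransformₗᵢ ℝ ℂ) _ _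
  filter_upwards [Lp.coeFn_sub (nl g b) (nl g c), nl_coe hg g0 b, nl_coe hg g0 c, hm.coeFn_toLp,
    Lp.coeFn_sub (𝓕 (compL2 g (bess b)) : L2) (𝓕 (compL2 g (bess c)))] with ξ h1 h2 h3 h4 h5
  rw [h4, h1, Pi.sub_apply, h2, h3, e, h5, Pi.sub_apply, mul_sub]

theorem J_fourier_compL2 {g : ℝ → ℝ} (hg : ContDiff ℝ 1 g) (g0 : g 0 = 0) (b : L2) :
    J (𝓕 (compL2 g (bess b))) = 𝓕 (compL2 g (bess b)) := by
  rw [← isReal_lp_iff]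
  refine isReal_of_im_eq_zero (isFunction_lp _) ?_
  filter_upwards [compL2_bess_coe hg g0 b] with x hx
  rw [hx, Complex.ofReal_im]

theorem J_nl {g : ℝ → ℝ} (hg : ContDiff ℝ 2 g) (g0 : g 0 = 0) (b : L2) : J (nl g b) = nl g b := by
  rw [J_eq_iff]
  have h := J_eq_iff.1 (J_fourier_compL2 (hg.of_le (by norm_num)) g0 b)
  filter_upwards [nl_coe hg g0 b, ae_neg (nl_coe hg g0 b), h] with ξ h1 h2 h3
  rw [h1, h2, map_mul, h3, Complex.conj_ofReal, wt_neg]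

/-! ### The potential energy -/

/-- The potential energy `∫ G(Re u)` with `G(y) = ∫₀^y g`. -/
def potential (g : ℝ → ℝ) (u : L2) : ℝ := ∫ x, ∫ p in (0 : ℝ)..(u x).re, g p

theorem integrable_potential {g : ℝ → ℝ} (hg : ContDiff ℝ 1 g) (g0 : g 0 = 0) {u : L2} {R : ℝ}
    (hu : ∀ᵐ x, ‖u x‖ ≤ R) : Integrable (fun x => ∫ p in (0 : ℝ)..(u x).re, g p) volume := by
  obtain ⟨K, hK, -, h⟩ := exists_lipschitz_bound hg R
  have hc : Continuous (fun y => ∫ p in (0 : ℝ)..y, g p) :=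
    continuous_iff_continuousAt.2 fun y => (hasDerivAt_primitive hg.continuous y).continuousAt
  refine ((L2.integrable_norm_sq u).const_mul K).mono'
    ((hc.comp Complex.continuous_re).comp_aestronglyMeasurable (Lp.aestronglyMeasurable u)) ?_
  filter_upwards [hu] with x hx
  have hR : 0 ≤ R := (norm_nonneg _).trans hx
  have := abs_primitive_taylor_le hg.continuous hK h (a := 0) ⟨by linarith, hR⟩ (re_mem_Icc hx)
  rw [g0, intervalIntegral.integral_same] at this
  simp only [sub_zero, zero_mul] at this
  refine this.trans (mul_le_mul_of_nonneg_left ?_ hK)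
  rw [← sq_abs]
  exact pow_le_pow_left₀ (abs_nonneg _) (Complex.abs_re_le_norm _) 2

theorem L2.re_inner_eq (f h : L2) : (inner ℂ f h).re = ∫ x, (inner ℂ (f x) (h x)).re := by
  rw [L2.inner_def]
  exact (integral_re (L2.integrable_inner (𝕜 := ℂ) f h)).symm

/-- The potential energy has the derivative `g(u)` with respect to `L²`, up to a quadratic error. -/
theorem exists_potential_bound {g : ℝ → ℝ} (hg : ContDiff ℝ 1 g) (g0 : g 0 = 0) (M : ℝ) :
    ∃ K : ℝ, 0 ≤ K ∧ ∀ b c : L2, ‖b‖ ≤ M → ‖c‖ ≤ M →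
      |potential g (bess c) - potential g (bess b) -
        (inner ℂ (compL2 g (bess b)) (bess c - bess b)).re| ≤ K * ‖bess c - bess b‖ ^ 2 := by
  obtain ⟨C, hC0, hC⟩ := exists_bess_bound
  obtain ⟨K, hK, -, hL⟩ := exists_lipschitz_bound hg (C * M)
  refine ⟨K, hK, fun b c hb hc => ?_⟩
  set u := bess b
  set v := bess c
  have hub : ∀ᵐ x, ‖u x‖ ≤ C * M := by
    filter_upwards [hC b] with x hx using hx.trans (by gcongr)
  have hvb : ∀ᵐ x, ‖v x‖ ≤ C * M := by
    filter_upwards [hC c] with x hx using hx.trans (by gcongr)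
  have iu := integrable_potential hg g0 hub
  have iv := integrable_potential hg g0 hvb
  have ii : Integrable (fun x => (inner ℂ (compL2 g u x) ((v - u : L2) x)).re) volume :=
    (L2.integrable_inner (𝕜 := ℂ) (compL2 g u) (v - u)).re
  have ivu : Integrable (fun x => (∫ p in (0 : ℝ)..(v x).re, g p) -
      ∫ p in (0 : ℝ)..(u x).re, g p) volume := iv.sub iu
  rw [L2.re_inner_eq, potential, potential, ← integral_sub iv iu, ← integral_sub ivu ii,
    L2.norm_sq_eq, ← integral_const_mul]
  refine (abs_integral_le_integral_abs).trans ?_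
  refine integral_mono_ae (ivu.sub ii).abs ((L2.integrable_norm_sq _).const_mul K) ?_
  filter_upwards [hub, hvb, compL2_coe hg g0 hub, Lp.coeFn_sub v u] with x h1 h2 h3 h4
  have ht := abs_primitive_taylor_le hg.continuous hK hL (re_mem_Icc h1) (re_mem_Icc h2)
  rw [h3, h4, Pi.sub_apply]
  have e : (inner ℂ ((g (u x).re : ℝ) : ℂ) (v x - u x)).re = g (u x).re * ((v x).re - (u x).re) := by
    simp [RCLike.inner_apply]
    ring
  rw [e]
  refine ht.trans (mul_le_mul_of_nonneg_left ?_ hK)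
  rw [← sq_abs]
  exact pow_le_pow_left₀ (abs_nonneg _) (Complex.abs_re_le_norm (v x - u x)) 2

/-! ### Inner products on `L²` -/

theorem L2.real_smul_eq (r : ℝ) (f : L2) : r • f = (r : ℂ) • f := (Complex.coe_smul r f).symm

theorem inner_mul_left {m : ℝ → ℝ} (hm : IsBddSymbol (fun ξ => (m ξ : ℂ))) (f h : L2) :
    inner ℂ (mul (fun ξ => (m ξ : ℂ)) f) h = inner ℂ f (mul (fun ξ => (m ξ : ℂ)) h) := by
  rw [L2.inner_def, L2.inner_def]
  apply integral_congr_ae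
  filter_upwards [mul_coe hm f, mul_coe hm h] with ξ h1 h2
  rw [h1, h2]
  simp only [RCLike.inner_apply, map_mul, Complex.conj_ofReal]
  ring

theorem re_inner_J_J (f h : L2) : (inner ℂ (J f) (J h)).re = (inner ℂ f h).re := by
  have h1 := norm_add_sq (𝕜 := ℂ) (J f) (J h)
  have h2 := norm_add_sq (𝕜 := ℂ) f h
  rw [← map_add, norm_J, norm_J, norm_J] at h1
  simp only [RCLike.re_eq_complex_re] at h1 h2
  linarith

theorem inner_group_neg {ω : ℝ → ℝ} (hω : Measurable ω) (t : ℝ) (f h : L2) :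
    inner ℂ f (group ω (-t) h) = inner ℂ (group ω t f) h := by
  have e := (LinearIsometry.mk (group ω t).toLinearMap (norm_group hω t)).inner_map_map f
    (group ω (-t) h)
  rw [← e]
  change inner ℂ (group ω t f) (group ω t (group ω (-t) h)) = _
  rw [group_group_neg hω]

/-! ### The hermitian parts of the unknown -/

/-- The hermitian part `(z + J z) / 2`. -/
def hermRe : L2 →L[ℝ] L2 := (1 / 2 : ℝ) • (ContinuousLinearMap.id ℝ L2 + J)

theorem hermRe_apply (z : L2) : hermRe z = (1 / 2 : ℝ) • (z + J z) := rfl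

/-- The hermitian part of `i z`; it is minus the hermitian imaginary part `(z - J z) / (2i)`. -/
def hermIm (z : L2) : L2 := hermRe (Complex.I • z)

theorem J_hermRe (z : L2) : J (hermRe z) = hermRe z := by
  rw [hermRe_apply, map_smul, map_add, J_J, add_comm]

theorem J_hermIm (z : L2) : J (hermIm z) = hermIm z := J_hermRe _

theorem hermRe_of_J {z : L2} (h : J z = z) : hermRe z = z := by
  rw [hermRe_apply, h, ← two_smul ℝ z, smul_smul]
  norm_num

theorem hermIm_of_J {z : L2} (h : J z = z) : hermIm z = 0 := by
  rw [hermIm, hermRe_apply, J_smul_I, h, add_neg_cancel, smul_zero]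

theorem hermIm_smul_I (z : L2) : hermIm (Complex.I • z) = -hermRe z := by
  rw [hermIm, smul_smul, Complex.I_mul_I, neg_one_smul, map_neg]

theorem continuous_smul_I : Continuous (fun z : L2 => Complex.I • z) := continuous_const_smul _

theorem hermRe_mul {m : ℝ → ℝ} (hm : IsBddSymbol (fun ξ => (m ξ : ℂ))) (he : ∀ ξ, m (-ξ) = m ξ)
    (z : L2) : hermRe (mul (fun ξ => (m ξ : ℂ)) z) = mul (fun ξ => (m ξ : ℂ)) (hermRe z) := by
  rw [hermRe_apply, hermRe_apply, J_mul hm hm (fun ξ => by rw [he, Complex.conj_ofReal]),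
    ← map_add, ContinuousLinearMap.map_smul_of_tower]

theorem hermIm_mul {m : ℝ → ℝ} (hm : IsBddSymbol (fun ξ => (m ξ : ℂ))) (he : ∀ ξ, m (-ξ) = m ξ)
    (z : L2) : hermIm (mul (fun ξ => (m ξ : ℂ)) z) = mul (fun ξ => (m ξ : ℂ)) (hermIm z) := by
  rw [hermIm, ← map_smul, hermRe_mul hm he, hermIm]

theorem hermRe_sub_smul_I {p q : L2} (hp : J p = p) (hq : J q = q) :
    hermRe (p - Complex.I • q) = p := by
  rw [map_sub, hermRe_of_J hp]
  change p - hermIm q = p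
  rw [hermIm_of_J hq, sub_zero]

theorem hermIm_sub_smul_I {p q : L2} (hp : J p = p) (hq : J q = q) :
    hermIm (p - Complex.I • q) = q := by
  have h := hermIm_smul_I q
  rw [hermRe_of_J hq] at h
  have h2 := hermIm_of_J hp
  rw [hermIm] at h h2 ⊢
  rw [smul_sub, map_sub, h, h2, zero_sub, neg_neg]

theorem re_inner_hermIm {F : L2} (hF : J F = F) (z : L2) :
    (inner ℂ F (hermIm z)).re = -(inner ℂ z (Complex.I • F)).re := by
  have h1 : (inner ℂ F (J (Complex.I • z))).re = (inner ℂ F (Complex.I • z)).re := by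
    have := re_inner_J_J F (Complex.I • z)
    rwa [hF] at this
  have e : hermIm z = (1 / 2 : ℂ) • (Complex.I • z + J (Complex.I • z)) := by
    rw [hermIm, hermRe_apply, L2.real_smul_eq]
    norm_num
  have h2 : (inner ℂ z F).im = -(inner ℂ F z).im := by
    rw [← inner_conj_symm, Complex.conj_im]
  have h3 : ∀ w : ℂ, ((1 / 2 : ℂ) * w).re = w.re / 2 := fun w => by
    have : ((1 / 2 : ℂ) * w) = ((1 / 2 : ℝ) : ℂ) * w := by norm_num
    rw [this, Complex.re_ofReal_mul]; ring
  rw [e, inner_smul_right, inner_add_right, h3, Complex.add_re, h1, inner_smul_right,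
    inner_smul_right, Complex.I_mul_re, Complex.I_mul_re, h2]
  ring

/-! ### Symbols of the equation -/

/-- The symbol `λ(ξ) = l(2πξ)` is measurable, even and comparable to `(1 + ξ²)^{ρ/2}`, `ρ ≥ 2`. -/
structure IsElliptic (ρ A B : ℝ) (lam : ℝ → ℝ) : Prop where
  two_le : 2 ≤ ρ
  measurable : Measurable lam
  even : ∀ ξ, lam (-ξ) = lam ξ
  pos : 0 < A
  lower : ∀ ξ, A ^ 2 * jap ρ ξ ≤ lam ξ
  nonneg : 0 ≤ B
  upper : ∀ ξ, lam ξ ≤ B ^ 2 * jap ρ ξ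

/-- The phase `ω = 2π|ξ| √λ`. -/
def phase (lam : ℝ → ℝ) (ξ : ℝ) : ℝ := wt ξ * √(lam ξ)

namespace IsElliptic

variable {ρ A B : ℝ} {lam : ℝ → ℝ} (h : IsElliptic ρ A B lam)
include h

theorem lam_pos (ξ : ℝ) : 0 < lam ξ :=
  (mul_pos (pow_pos h.pos 2) (jap_pos _ _)).trans_le (h.lower ξ)

theorem sqrt_pos (ξ : ℝ) : 0 < √(lam ξ) := Real.sqrt_pos.2 (h.lam_pos ξ)

theorem sqrt_lower (ξ : ℝ) : A * jap (ρ / 2) ξ ≤ √(lam ξ) := by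
  apply Real.le_sqrt_of_sq_le
  rw [mul_pow, pow_two (jap _ _), jap_mul_jap, add_halves]
  exact h.lower ξ

theorem sqrt_upper (ξ : ℝ) : √(lam ξ) ≤ B * jap (ρ / 2) ξ := by
  apply Real.sqrt_le_iff.2 ⟨mul_nonneg h.nonneg (jap_pos _ _).le, ?_⟩
  rw [mul_pow, pow_two (jap _ _), jap_mul_jap, add_halves]
  exact h.upper ξ

theorem measurable_sqrt : Measurable (fun ξ => √(lam ξ)) := h.measurable.sqrt

theorem measurable_phase : Measurable (phase lam) := measurable_wt.mul h.measurable_sqrt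

theorem phase_neg (ξ : ℝ) : phase lam (-ξ) = phase lam ξ := by rw [phase, phase, wt_neg, h.even]

theorem isBddSymbol_jap_div_sqrt {s : ℝ} (hs : s ≤ ρ / 2) :
    IsBddSymbol (fun ξ => ((jap s ξ / √(lam ξ) : ℝ) : ℂ)) := by
  refine ⟨Complex.measurable_ofReal.comp ((continuous_jap s).measurable.div h.measurable_sqrt),
    A⁻¹, fun ξ => ?_⟩
  rw [Complex.norm_real, Real.norm_of_nonneg (div_nonneg (jap_pos _ _).le (h.sqrt_pos ξ).le),
    div_le_iff₀ (h.sqrt_pos ξ), inv_mul_eq_div, le_div_iff₀ h.pos, mul_comm]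
  exact (mul_le_mul_of_nonneg_left (jap_le_jap hs ξ) h.pos.le).trans (h.sqrt_lower ξ)

theorem isBddSymbol_sqrt_mul_jap :
    IsBddSymbol (fun ξ => ((√(lam ξ) * jap (-(ρ / 2)) ξ : ℝ) : ℂ)) := by
  refine ⟨Complex.measurable_ofReal.comp (h.measurable_sqrt.mul (continuous_jap _).measurable),
    B, fun ξ => ?_⟩
  rw [Complex.norm_real, Real.norm_of_nonneg (mul_nonneg (h.sqrt_pos ξ).le (jap_pos _ _).le),
    jap_neg, mul_inv_le_iff₀ (jap_pos _ _)]
  exact h.sqrt_upper ξ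

end IsElliptic

theorem isBddSymbol_jap_mul_wt : IsBddSymbol (fun ξ => ((jap (-1) ξ * wt ξ : ℝ) : ℂ)) := by
  refine ⟨Complex.measurable_ofReal.comp ((continuous_jap _).measurable.mul measurable_wt),
    2 * Real.pi, fun ξ => ?_⟩
  rw [Complex.norm_real, Real.norm_of_nonneg (mul_nonneg (jap_pos _ _).le (wt_nonneg ξ)), jap_neg,
    inv_mul_eq_div, div_le_iff₀ (jap_pos _ _), wt]
  gcongr
  exact abs_le_jap_one ξ

theorem isBddSymbol_jap_div_wt : IsBddSymbol (fun ξ => ((jap 1 ξ / (1 + wt ξ) : ℝ) : ℂ)) := by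
  have hpos : ∀ ξ, 0 < 1 + wt ξ := fun ξ => by linarith [wt_nonneg ξ]
  refine ⟨Complex.measurable_ofReal.comp
    ((continuous_jap _).measurable.div (measurable_const.add measurable_wt)), 1, fun ξ => ?_⟩
  rw [Complex.norm_real, Real.norm_of_nonneg (div_nonneg (jap_pos _ _).le (hpos ξ).le),
    div_le_one (hpos ξ), jap, ← Real.sqrt_eq_rpow, Real.sqrt_le_left (hpos ξ).le]
  have h1 : |ξ| ≤ wt ξ := by
    rw [wt]
    nlinarith [Real.pi_gt_three, abs_nonneg ξ]
  rw [← sq_abs]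
  nlinarith [abs_nonneg ξ]

/-- The operator `z ↦ (1 + ξ²)^{1/2} λ^{-1/2} (z + J z) / 2`. It takes the unknown `z` to the
function `b` with `𝓕 u = (1 + ξ²)^{-1/2} b`, that is, `u = bess b`. -/
def profile (lam : ℝ → ℝ) (z : L2) : L2 :=
  mul (fun ξ => ((jap 1 ξ / √(lam ξ) : ℝ) : ℂ)) (hermRe z)

/-- The nonlinear part `i |D| g(u)` of the first order equation. -/
def force (lam g : ℝ → ℝ) (z : L2) : L2 := Complex.I • nl g (profile lam z)

theorem continuous_profile (lam : ℝ → ℝ) : Continuous (profile lam) :=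
  (mul _).continuous.comp hermRe.continuous

theorem norm_hermRe_le (z : L2) : ‖hermRe z‖ ≤ ‖z‖ := by
  rw [hermRe_apply, norm_smul]
  have := norm_add_le z (J z)
  rw [norm_J] at this
  norm_num
  linarith

theorem exists_profile_bound {ρ A B : ℝ} {lam : ℝ → ℝ} (h : IsElliptic ρ A B lam) :
    ∃ C : ℝ, 0 ≤ C ∧ ∀ z, ‖profile lam z‖ ≤ C * ‖z‖ := by
  have hb := h.isBddSymbol_jap_div_sqrt (s := 1) (by linarith [h.two_le])
  obtain ⟨C, hC⟩ := hb.2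
  have hC0 : 0 ≤ C := (norm_nonneg _).trans (hC 0)
  exact ⟨C, hC0, fun z => (norm_mul_le hb.1 hC _).trans
    (mul_le_mul_of_nonneg_left (norm_hermRe_le z) hC0)⟩

theorem profile_sub (lam : ℝ → ℝ) (z w : L2) :
    profile lam (z - w) = profile lam z - profile lam w := by
  rw [profile, map_sub, map_sub, profile, profile]

theorem force_lipschitz {ρ A B : ℝ} {lam g : ℝ → ℝ} (h : IsElliptic ρ A B lam)
    (hg : ContDiff ℝ 2 g) (g0 : g 0 = 0) (M : ℝ) :
    ∃ K : ℝ≥0, LipschitzOnWith K (force lam g) (closedBall 0 M) := by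
  obtain ⟨C, hC0, hC⟩ := exists_profile_bound h
  obtain ⟨K, hK⟩ := nl_lipschitz hg g0 (C * M)
  refine ⟨K * C.toNNReal, LipschitzOnWith.of_dist_le_mul fun a ha b hb => ?_⟩
  have hm : ∀ x ∈ closedBall (0 : L2) M, profile lam x ∈ closedBall (0 : L2) (C * M) := fun x hx => by
    rw [mem_closedBall_zero_iff] at hx ⊢
    exact (hC x).trans (mul_le_mul_of_nonneg_left hx hC0)
  have h1 := hK.dist_le_mul _ (hm a ha) _ (hm b hb)
  rw [dist_eq_norm, force, force, ← smul_sub, norm_smul, Complex.norm_I, one_mul, ← dist_eq_norm]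
  refine h1.trans ?_
  rw [NNReal.coe_mul, Real.coe_toNNReal _ hC0, mul_assoc, dist_eq_norm, ← profile_sub, dist_eq_norm]
  exact mul_le_mul_of_nonneg_left (hC _) K.coe_nonneg

/-! ### Time derivatives of the hermitian parts -/

section Derivatives

variable {ρ A B : ℝ} {lam g : ℝ → ℝ} {s : Set ℝ} {y : ℝ → L2} {t : ℝ}

theorem hasDerivWithinAt_mul_state (h : IsElliptic ρ A B lam)
    (hy : IsInteractionSolution (phase lam) (force lam g) s y) (ht : t ∈ s) {m : ℝ → ℝ}
    (hm : IsBddSymbol (fun ξ => (m ξ : ℂ)))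
    (hmω : IsBddSymbol (fun ξ => ((m ξ * phase lam ξ : ℝ) : ℂ))) :
    HasDerivWithinAt (fun τ => mul (fun ξ => (m ξ : ℂ)) (group (phase lam) τ (y τ)))
      (Complex.I • (mul (fun ξ => ((m ξ * phase lam ξ : ℝ) : ℂ)) (group (phase lam) t (y t)) +
        mul (fun ξ => (m ξ : ℂ)) (nl g (profile lam (group (phase lam) t (y t)))))) s t := by
  have hmω' : IsBddSymbol (fun ξ => (m ξ : ℂ) * (phase lam ξ : ℂ)) := by
    simpa only [Complex.ofReal_mul] using hmω
  have h1 := hasDerivWithinAt_mul_group h.measurable_phase hm hmω' (hy t ht)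
  rw [group_group_neg h.measurable_phase, force, map_smul] at h1
  convert h1 using 1
  rw [smul_add]
  congr 1
  apply Lp.ext
  have hI : IsBddSymbol (fun ξ => Complex.I * ((m ξ : ℂ) * (phase lam ξ : ℂ))) := by
    obtain ⟨C, hC⟩ := hmω'.2
    exact ⟨hmω'.1.const_mul _, C, fun ξ => by simpa using hC ξ⟩
  filter_upwards [Lp.coeFn_smul Complex.I
    (mul (fun ξ => ((m ξ * phase lam ξ : ℝ) : ℂ)) (group (phase lam) t (y t))),
    mul_coe hmω (group (phase lam) t (y t)), mul_coe hI (group (phase lam) t (y t))] with ξ h1 h2 h3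
  rw [h1, Pi.smul_apply, h2, h3, Complex.ofReal_mul, smul_eq_mul]
  ring

/-- The force is `i` times a hermitian function and does not contribute to the hermitian part `hermRe`
of the derivative. -/
theorem hasDerivWithinAt_hermRe (h : IsElliptic ρ A B lam) (hg : ContDiff ℝ 2 g) (g0 : g 0 = 0)
    (hy : IsInteractionSolution (phase lam) (force lam g) s y) (ht : t ∈ s) {m : ℝ → ℝ}
    (hm : IsBddSymbol (fun ξ => (m ξ : ℂ))) (he : ∀ ξ, m (-ξ) = m ξ)
    (hmω : IsBddSymbol (fun ξ => ((m ξ * phase lam ξ : ℝ) : ℂ))) :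
    HasDerivWithinAt (fun τ => mul (fun ξ => (m ξ : ℂ)) (hermRe (group (phase lam) τ (y τ))))
      (mul (fun ξ => ((m ξ * phase lam ξ : ℝ) : ℂ)) (hermIm (group (phase lam) t (y t)))) s t := by
  have h1 := hermRe.hasFDerivAt.comp_hasDerivWithinAt t (hasDerivWithinAt_mul_state h hy ht hm hmω)
  have e1 : ∀ τ, hermRe (mul (fun ξ => (m ξ : ℂ)) (group (phase lam) τ (y τ))) =
      mul (fun ξ => (m ξ : ℂ)) (hermRe (group (phase lam) τ (y τ))) := fun τ => hermRe_mul hm he _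
  have e2 : ∀ z : L2, hermRe (Complex.I • z) = hermIm z := fun _ => rfl
  rw [e2, hermIm, smul_add, map_add, e2, e2, hermIm_mul hmω (fun ξ => by rw [he, h.phase_neg]),
    hermIm_mul hm he, hermIm_of_J (J_nl hg g0 _), map_zero, add_zero] at h1
  exact h1.congr (fun τ _ => (e1 τ).symm) (e1 t).symm

theorem hasDerivWithinAt_hermIm (h : IsElliptic ρ A B lam) (hg : ContDiff ℝ 2 g) (g0 : g 0 = 0)
    (hy : IsInteractionSolution (phase lam) (force lam g) s y) (ht : t ∈ s) {m : ℝ → ℝ}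
    (hm : IsBddSymbol (fun ξ => (m ξ : ℂ))) (he : ∀ ξ, m (-ξ) = m ξ)
    (hmω : IsBddSymbol (fun ξ => ((m ξ * phase lam ξ : ℝ) : ℂ))) :
    HasDerivWithinAt (fun τ => mul (fun ξ => (m ξ : ℂ)) (hermIm (group (phase lam) τ (y τ))))
      (-(mul (fun ξ => ((m ξ * phase lam ξ : ℝ) : ℂ)) (hermRe (group (phase lam) t (y t))) +
        mul (fun ξ => (m ξ : ℂ)) (nl g (profile lam (group (phase lam) t (y t)))))) s t := by
  have h1 := hermRe.hasFDerivAt.comp_hasDerivWithinAt t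
    ((hasDerivWithinAt_mul_state h hy ht hm hmω).const_smul Complex.I)
  have e1 : ∀ τ, hermRe (Complex.I • mul (fun ξ => (m ξ : ℂ)) (group (phase lam) τ (y τ))) =
      mul (fun ξ => (m ξ : ℂ)) (hermIm (group (phase lam) τ (y τ))) := fun τ => hermIm_mul hm he _
  rw [smul_smul, Complex.I_mul_I, neg_one_smul, map_neg, map_add,
    hermRe_mul hmω (fun ξ => by rw [he, h.phase_neg]), hermRe_mul hm he,
    hermRe_of_J (J_nl hg g0 _)] at h1
  exact h1.congr (fun τ _ => (e1 τ).symm) (e1 t).symm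

theorem continuousOn_state (h : IsElliptic ρ A B lam) (hy : ContinuousOn y s) :
    ContinuousOn (fun τ => group (phase lam) τ (y τ)) s := fun t ht =>
  tendsto_group h.measurable_phase (tendsto_id.mono_left nhdsWithin_le_nhds) (hy t ht)

/-! ### Conservation of energy -/

theorem mul_bess_profile (h : IsElliptic ρ A B lam) (z : L2) :
    mul (fun ξ => (jap (-1) ξ : ℂ)) (mul (fun ξ => (jap (-1) ξ : ℂ)) (profile lam z)) =
      mul (fun ξ => ((jap (-1) ξ / √(lam ξ) : ℝ) : ℂ)) (hermRe z) := by
  have hb := isBddSymbol_jap (s := -1) (by norm_num)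
  have h1 := h.isBddSymbol_jap_div_sqrt (s := 1) (by linarith [h.two_le])
  rw [profile, mul_mul hb h1, mul_mul hb (hb.mul h1)]
  congr 2
  ext ξ
  rw [← Complex.ofReal_mul, ← Complex.ofReal_mul]
  congr 1
  have := jap_mul_jap (-1) 1 ξ
  rw [neg_add_cancel, jap_zero] at this
  rw [← mul_div_assoc (jap (-1) ξ) (jap 1 ξ), this, ← mul_div_assoc, mul_one]

theorem norm_sq_bess_sub (b c : L2) : ‖bess c - bess b‖ ^ 2 ≤ ‖c - b‖ *
    ‖mul (fun ξ => (jap (-1) ξ : ℂ)) (mul (fun ξ => (jap (-1) ξ : ℂ)) (c - b))‖ := by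
  have hb := isBddSymbol_jap (s := -1) (by norm_num)
  have e := inner_self_eq_norm_sq_to_K (𝕜 := ℂ) (mul (fun ξ => (jap (-1) ξ : ℂ)) (c - b))
  rw [inner_mul_left hb] at e
  have e2 : ‖mul (fun ξ => (jap (-1) ξ : ℂ)) (c - b)‖ ^ 2 =
      ‖inner ℂ (c - b) (mul (fun ξ => (jap (-1) ξ : ℂ)) (mul (fun ξ => (jap (-1) ξ : ℂ)) (c - b)))‖ := by
    rw [e]
    simp
  rw [← bess_sub, ← Lp.norm_fourier_eq, fourier_bess, e2]
  exact norm_inner_le_norm _ _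

/-- The function `(1 + ξ²)^{1/2} 𝓕 g(u)`, which is square integrable since `g(u) ∈ H¹`. -/
def compWeighted (g : ℝ → ℝ) (b : L2) : L2 :=
  mul (fun ξ => ((jap 1 ξ / (1 + wt ξ) : ℝ) : ℂ)) (𝓕 (compL2 g (bess b)) + nl g b)

theorem compWeighted_coe (hg : ContDiff ℝ 2 g) (g0 : g 0 = 0) (b : L2) :
    compWeighted g b =ᵐ[volume] fun ξ => (jap 1 ξ : ℂ) * (𝓕 (compL2 g (bess b)) : L2) ξ := by
  filter_upwards [mul_coe isBddSymbol_jap_div_wt (𝓕 (compL2 g (bess b)) + nl g b), nl_coe hg g0 b,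
    Lp.coeFn_add (𝓕 (compL2 g (bess b)) : L2) (nl g b)] with ξ h1 h2 h3
  rw [compWeighted, h1, h3, Pi.add_apply, h2]
  have : (1 : ℂ) + wt ξ ≠ 0 := by
    have h : 0 < 1 + wt ξ := by linarith [wt_nonneg ξ]
    exact_mod_cast h.ne'
  push_cast
  field_simp

theorem inner_compL2_bess (hg : ContDiff ℝ 2 g) (g0 : g 0 = 0) (b c : L2) :
    inner ℂ (compL2 g (bess b)) (bess c) = inner ℂ (compWeighted g b)
      (mul (fun ξ => (jap (-1) ξ : ℂ)) (mul (fun ξ => (jap (-1) ξ : ℂ)) c)) := by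
  have hb := isBddSymbol_jap (s := -1) (by norm_num)
  rw [← inner_mul_left hb, ← Lp.inner_fourier_eq, fourier_bess]
  congr 1
  apply Lp.ext
  filter_upwards [mul_coe hb (compWeighted g b), compWeighted_coe hg g0 b] with ξ h1 h2
  rw [h1, h2, ← mul_assoc, ← Complex.ofReal_mul, jap_mul_jap, neg_add_cancel, jap_zero,
    Complex.ofReal_one, one_mul]

theorem inner_compWeighted (hg : ContDiff ℝ 2 g) (g0 : g 0 = 0) (b q : L2) :
    inner ℂ (compWeighted g b) (mul (fun ξ => ((jap (-1) ξ * wt ξ : ℝ) : ℂ)) q) =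
      inner ℂ (nl g b) q := by
  rw [← inner_mul_left isBddSymbol_jap_mul_wt]
  congr 1
  apply Lp.ext
  filter_upwards [mul_coe isBddSymbol_jap_mul_wt (compWeighted g b), compWeighted_coe hg g0 b,
    nl_coe hg g0 b] with ξ h1 h2 h3
  have := jap_mul_jap (-1) 1 ξ
  rw [neg_add_cancel, jap_zero] at this
  rw [h1, h2, h3, ← mul_assoc, ← Complex.ofReal_mul]
  congr 2
  calc jap (-1) ξ * wt ξ * jap 1 ξ = (jap (-1) ξ * jap 1 ξ) * wt ξ := by ring
    _ = wt ξ := by rw [this, one_mul]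

theorem jap_div_sqrt_mul_phase (h : IsElliptic ρ A B lam) :
    (fun ξ => ((jap (-1) ξ / √(lam ξ) * phase lam ξ : ℝ) : ℂ)) =
      fun ξ => ((jap (-1) ξ * wt ξ : ℝ) : ℂ) := by
  ext ξ
  congr 1
  have := (h.sqrt_pos ξ).ne'
  rw [phase]
  field_simp

/-- The potential energy is differentiable in time although `u_t` is only in `H^{-1}`: `g(u)` is in
`H¹`, and the quadratic error is `o(h)` by interpolation between `H¹` and `H^{-1}`. -/
theorem hasDerivWithinAt_potential (h : IsElliptic ρ A B lam) (hg : ContDiff ℝ 2 g) (g0 : g 0 = 0)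
    {M : ℝ} (hM : ∀ τ ∈ s, ‖y τ‖ ≤ M)
    (hy : IsInteractionSolution (phase lam) (force lam g) s y) (ht : t ∈ s) :
    HasDerivWithinAt (fun τ => potential g (bess (profile lam (group (phase lam) τ (y τ)))))
      (inner ℂ (nl g (profile lam (group (phase lam) t (y t))))
        (hermIm (group (phase lam) t (y t)))).re s t := by
  set z := fun τ => group (phase lam) τ (y τ) with hz
  set b := fun τ => profile lam (z τ) with hb
  have hbs := h.isBddSymbol_jap_div_sqrt (s := -1) (by linarith [h.two_le])
  have hd := hasDerivWithinAt_hermRe h hg g0 hy ht (m := fun ξ => jap (-1) ξ / √(lam ξ)) hbs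
    (fun ξ => by rw [jap_neg_arg, h.even])
    (by rw [jap_div_sqrt_mul_phase h]; exact isBddSymbol_jap_mul_wt)
  rw [jap_div_sqrt_mul_phase h] at hd
  set d := fun τ => mul (fun ξ => ((jap (-1) ξ / √(lam ξ) : ℝ) : ℂ)) (hermRe (z τ)) with hdd
  obtain ⟨C, hC0, hC⟩ := exists_profile_bound h
  obtain ⟨K, hK, hpot⟩ := exists_potential_bound (hg.of_le (by norm_num)) g0 (C * M)
  have hbM : ∀ τ ∈ s, ‖b τ‖ ≤ C * M := fun τ hτ => (hC _).trans (by
    rw [hz, norm_group h.measurable_phase]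
    exact mul_le_mul_of_nonneg_left (hM τ hτ) hC0)
  have hcont : Tendsto b (𝓝[s \ {t}] t) (𝓝 (b t)) := by
    have h1 := continuousOn_state h (fun τ hτ => (hy τ hτ).continuousWithinAt) t ht
    exact ((continuous_profile lam).tendsto _).comp (h1.mono_left (nhdsWithin_mono _ sdiff_subset))
  have hdiff : ∀ τ, mul (fun ξ => (jap (-1) ξ : ℂ)) (mul (fun ξ => (jap (-1) ξ : ℂ)) (b τ - b t)) =
      d τ - d t := fun τ => by
    rw [map_sub, map_sub, hb, mul_bess_profile h, mul_bess_profile h]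
  rw [hasDerivWithinAt_iff_tendsto_slope] at hd ⊢
  have hmain : Tendsto (fun τ => (inner ℂ (compWeighted g (b t)) (slope d t τ)).re)
      (𝓝[s \ {t}] t) (𝓝 (inner ℂ (nl g (b t)) (hermIm (z t))).re) := by
    rw [← inner_compWeighted hg g0]
    exact (Complex.continuous_re.tendsto _).comp (tendsto_const_nhds.inner hd)
  have herr : Tendsto (fun τ => K * ‖b τ - b t‖ * ‖slope d t τ‖) (𝓝[s \ {t}] t) (𝓝 0) := by
    have h1 := ((tendsto_iff_norm_sub_tendsto_zero.1 hcont).const_mul K).mul hd.norm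
    simpa using h1
  have hsq : Tendsto (fun τ => slope (fun τ => potential g (bess (b τ))) t τ -
      (inner ℂ (compWeighted g (b t)) (slope d t τ)).re) (𝓝[s \ {t}] t) (𝓝 0) := by
    refine squeeze_zero_norm' ?_ herr
    filter_upwards [self_mem_nhdsWithin] with τ hτ
    have h1 := hpot (b t) (b τ) (hbM t ht) (hbM τ hτ.1)
    have h2 := norm_sq_bess_sub (b t) (b τ)
    rw [← bess_sub, inner_compL2_bess hg g0, hdiff] at h1
    rw [hdiff] at h2
    rw [slope_def_module, slope_def_module, norm_smul, L2.real_smul_eq, inner_smul_right,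
      Complex.re_ofReal_mul, smul_eq_mul, ← mul_sub, norm_mul]
    have h3 := h1.trans (mul_le_mul_of_nonneg_left ((bess_sub (b τ) (b t)) ▸ h2) hK)
    calc ‖(τ - t)⁻¹‖ * ‖_‖ ≤ ‖(τ - t)⁻¹‖ * (K * (‖b τ - b t‖ * ‖d τ - d t‖)) := by
          gcongr
          exact h3
      _ = _ := by ring
  have := hsq.add hmain
  simpa using this

/-- The energy `‖z‖² / 2 + ∫ G(u)` of a solution. -/
def energy (lam g : ℝ → ℝ) (z : L2) : ℝ := ‖z‖ ^ 2 / 2 + potential g (bess (profile lam z))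

theorem hasDerivWithinAt_energy (h : IsElliptic ρ A B lam) (hg : ContDiff ℝ 2 g) (g0 : g 0 = 0)
    {M : ℝ} (hM : ∀ τ ∈ s, ‖y τ‖ ≤ M)
    (hy : IsInteractionSolution (phase lam) (force lam g) s y) (ht : t ∈ s) :
    HasDerivWithinAt (fun τ => energy lam g (group (phase lam) τ (y τ))) 0 s t := by
  have h1 := hasDerivWithinAt_potential h hg g0 hM hy ht
  have h2 := (hy t ht).inner ℂ (hy t ht)
  have h3 := (Complex.reCLM.hasFDerivAt.comp_hasDerivWithinAt t h2).div_const 2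
  have h4 := h3.add h1
  set z := group (phase lam) t (y t) with hz
  have e : (Complex.reCLM (inner ℂ (y t) (group (phase lam) (-t) (force lam g z)) +
      inner ℂ (group (phase lam) (-t) (force lam g z)) (y t))) / 2 +
      (inner ℂ (nl g (profile lam z)) (hermIm z)).re = 0 := by
    rw [re_inner_hermIm (J_nl hg g0 _), ← inner_conj_symm (group (phase lam) (-t) (force lam g z)),
      Complex.reCLM_apply, Complex.add_re, Complex.conj_re, inner_group_neg h.measurable_phase,
      force, ← hz]
    ring
  rw [e] at h4
  refine h4.congr_of_eventuallyEq (Eventually.of_forall fun τ => ?_) ?_ <;>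
  · simp only [energy, Pi.add_apply, Function.comp_apply, norm_group h.measurable_phase,
      inner_self_eq_norm_sq_to_K, Complex.reCLM_apply]
    norm_cast

theorem energy_conserved (h : IsElliptic ρ A B lam) (hg : ContDiff ℝ 2 g) (g0 : g 0 = 0)
    {M T : ℝ} (hM : ∀ τ ∈ Icc 0 T, ‖y τ‖ ≤ M)
    (hy : IsInteractionSolution (phase lam) (force lam g) (Icc 0 T) y) (ht : t ∈ Icc 0 T) :
    energy lam g (group (phase lam) t (y t)) = energy lam g (y 0) := by
  have hd := fun τ (hτ : τ ∈ Icc 0 T) => hasDerivWithinAt_energy h hg g0 hM hy hτ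
  have := constant_of_derivWithin_zero (fun τ hτ => (hd τ hτ).differentiableWithinAt)
    (fun τ hτ => (hd τ (Ico_subset_Icc_self hτ)).derivWithin
      (uniqueDiffOn_Icc (hτ.1.trans_lt hτ.2) τ (Ico_subset_Icc_self hτ))) t ht
  rwa [group_zero] at this

end Derivatives

/-- Global existence for the first order equation, by conservation of energy. -/
theorem exists_global_interaction {ρ A B : ℝ} {lam g : ℝ → ℝ} (h : IsElliptic ρ A B lam)
    (hg : ContDiff ℝ 2 g) (g0 : g 0 = 0) (hG : ∀ y : ℝ, 0 ≤ ∫ p in (0 : ℝ)..y, g p) (a : L2) :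
    ∃ y : ℝ → L2, y 0 = a ∧ IsInteractionSolution (phase lam) (force lam g) (Ici 0) y := by
  have hpos : ∀ z, ‖z‖ ^ 2 / 2 ≤ energy lam g z := fun z => by
    have : 0 ≤ potential g (bess (profile lam z)) := integral_nonneg fun x => hG _
    rw [energy]
    linarith
  have hlt : ∀ z, energy lam g z = energy lam g a → ‖z‖ < √(2 * energy lam g a) + 1 := by
    intro z hz
    have h1 := hpos z
    rw [hz] at h1
    have : ‖z‖ ≤ √(2 * energy lam g a) := Real.le_sqrt_of_sq_le (by linarith)
    linarith
  refine exists_interaction_Ici h.measurable_phase (force_lipschitz h hg g0) (hlt a rfl) ?_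
  intro T _ y hy0 hy hM t ht
  have := hlt _ ((energy_conserved h hg g0 hM hy ht).trans (by rw [hy0]))
  rwa [norm_group h.measurable_phase] at this

/-! ### Sobolev functions in terms of the first order unknown -/

theorem mul_mul_real {m n k : ℝ → ℝ} (hm : IsBddSymbol (fun ξ => (m ξ : ℂ)))
    (hn : IsBddSymbol (fun ξ => (n ξ : ℂ))) (h : ∀ ξ, m ξ * n ξ = k ξ) (f : L2) :
    mul (fun ξ => (m ξ : ℂ)) (mul (fun ξ => (n ξ : ℂ)) f) = mul (fun ξ => (k ξ : ℂ)) f := by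
  rw [mul_mul hm hn]
  congr 2
  ext ξ
  rw [← h, Complex.ofReal_mul]

theorem mul_one_real {m : ℝ → ℝ} (h : ∀ ξ, m ξ = 1) (f : L2) : mul (fun ξ => (m ξ : ℂ)) f = f := by
  rw [← mul_one_symbol f]
  congr 2
  · ext ξ
    rw [h, Complex.ofReal_one]
  · exact mul_one_symbol f

theorem jap_neg_mul (s ξ : ℝ) : jap (-s) ξ * jap s ξ = 1 := by
  rw [jap_mul_jap, neg_add_cancel, jap_zero]

theorem J_mul_real {m : ℝ → ℝ} (hm : IsBddSymbol (fun ξ => (m ξ : ℂ))) (he : ∀ ξ, m (-ξ) = m ξ)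
    {f : L2} (hf : J f = f) : J (mul (fun ξ => (m ξ : ℂ)) f) = mul (fun ξ => (m ξ : ℂ)) f := by
  rw [J_mul hm hm (fun ξ => by rw [he, Complex.conj_ofReal]), hf]

section Amplitude

variable {ρ A B : ℝ} {lam g : ℝ → ℝ}

/-- The function `λ^{1/2} 𝓕 u`, for `u ∈ H^{ρ/2}`. -/
def amp (lam : ℝ → ℝ) (u : H (ρ / 2)) : L2 :=
  mul (fun ξ => ((√(lam ξ) * jap (-(ρ / 2)) ξ : ℝ) : ℂ)) (ft (ρ / 2) u)

/-- The function `(1 + ξ²)^{1/2} 𝓕 u`, for `u ∈ H^{ρ/2} ⊆ H¹`. -/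
def oneFt (u : H (ρ / 2)) : L2 := mul (fun ξ => (jap (1 - ρ / 2) ξ : ℂ)) (ft (ρ / 2) u)

theorem ft_eq_amp (h : IsElliptic ρ A B lam) (u : H (ρ / 2)) :
    ft (ρ / 2) u = mul (fun ξ => ((jap (ρ / 2) ξ / √(lam ξ) : ℝ) : ℂ)) (amp lam u) := by
  rw [amp, mul_mul_real (h.isBddSymbol_jap_div_sqrt le_rfl) h.isBddSymbol_sqrt_mul_jap
    (k := fun _ => 1) (fun ξ => ?_), mul_one_real (fun _ => rfl)]
  have := (h.sqrt_pos ξ).ne'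
  rw [div_mul_eq_mul_div, mul_left_comm, mul_comm (jap _ _), jap_neg_mul, mul_one, div_self this]

theorem amp_eq_of_ft (h : IsElliptic ρ A B lam) {u : H (ρ / 2)} {f : L2}
    (hf : ft (ρ / 2) u = mul (fun ξ => ((jap (ρ / 2) ξ / √(lam ξ) : ℝ) : ℂ)) f) :
    amp lam u = f := by
  rw [amp, hf, mul_mul_real h.isBddSymbol_sqrt_mul_jap (h.isBddSymbol_jap_div_sqrt le_rfl)
    (k := fun _ => 1) (fun ξ => ?_), mul_one_real (fun _ => rfl)]
  have := (h.sqrt_pos ξ).ne'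
  rw [mul_div_assoc', mul_assoc, jap_neg_mul, mul_one, div_self this]

theorem oneFt_eq_amp (h : IsElliptic ρ A B lam) (u : H (ρ / 2)) :
    oneFt u = mul (fun ξ => ((jap 1 ξ / √(lam ξ) : ℝ) : ℂ)) (amp lam u) := by
  rw [oneFt, ft_eq_amp h]
  refine mul_mul_real (isBddSymbol_jap (by linarith [h.two_le])) (h.isBddSymbol_jap_div_sqrt le_rfl)
    (fun ξ => ?_) _
  rw [mul_div_assoc', jap_mul_jap]
  ring_nf

theorem J_amp (h : IsElliptic ρ A B lam) (u : H (ρ / 2)) : J (amp lam u) = amp lam u :=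
  J_mul_real h.isBddSymbol_sqrt_mul_jap (fun ξ => by rw [h.even, jap_neg_arg]) (J_ft u)

theorem isFunction_fourier_amp (h : IsElliptic ρ A B lam) (u : H (ρ / 2)) :
    IsFunction (𝓕 (H.dist u)) (fun ξ => ((√(lam ξ))⁻¹ : ℝ) * amp lam u ξ) := by
  refine (isFunction_fourier_dist u).congr ?_
  filter_upwards [mul_coe h.isBddSymbol_sqrt_mul_jap (ft (ρ / 2) u)] with ξ h1
  rw [amp, h1, ← mul_assoc, ← Complex.ofReal_mul]
  congr 2
  have := (h.sqrt_pos ξ).ne'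
  field_simp

theorem dist_eq_bess (h2 : 2 ≤ ρ) (u : H (ρ / 2)) :
    H.dist u = (bess (oneFt u) : 𝓢'(ℝ, ℂ)) := by
  have hb := isBddSymbol_jap (s := -1) (by norm_num)
  have hb2 := isBddSymbol_jap (s := 1 - ρ / 2) (by linarith)
  have h1 := isFunction_fourier_dist u
  have h3 : IsFunction (𝓕 (bess (oneFt u) : 𝓢'(ℝ, ℂ))) (fun ξ => (jap (-(ρ / 2)) ξ : ℂ) *
      ft (ρ / 2) u ξ) := by
    refine (isFunction_fourier_lp (bess (oneFt u))).congr ?_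
    rw [fourier_bess]
    filter_upwards [mul_coe hb (oneFt u), mul_coe hb2 (ft (ρ / 2) u)] with ξ e1 e2
    rw [e1, oneFt, e2, ← mul_assoc, ← Complex.ofReal_mul, jap_mul_jap]
    ring_nf
  have e := congrArg (fun d : 𝓢'(ℝ, ℂ) => 𝓕⁻ d) (h1.dist_eq h3)
  simpa only [FourierTransform.fourierInv_fourier_eq] using e

theorem isFunction_bess_oneFt (h2 : 2 ≤ ρ) (u : H (ρ / 2)) :
    IsFunction (H.dist u) (fun x => ((bess (oneFt u) x).re : ℂ)) := by
  have h1 : IsFunction (H.dist u) (bess (oneFt u)) := by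
    rw [dist_eq_bess h2]
    exact isFunction_lp _
  refine h1.congr ?_
  filter_upwards [(H.isReal u).im_eq_zero h1] with x hx
  apply Complex.ext <;> simp [hx]

theorem isComposition_compL2 (h2 : 2 ≤ ρ) (hg : ContDiff ℝ 1 g) (g0 : g 0 = 0) (u : H (ρ / 2)) :
    IsComposition g (H.dist u) (compL2 g (bess (oneFt u)) : 𝓢'(ℝ, ℂ)) :=
  ⟨fun x => (bess (oneFt u) x).re, isFunction_bess_oneFt h2 u,
    (isFunction_lp _).congr (compL2_bess_coe hg g0 _)⟩

theorem IsComposition.eq_compL2 (h2 : 2 ≤ ρ) (hg : ContDiff ℝ 1 g) (g0 : g 0 = 0)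
    {u : H (ρ / 2)} {d : 𝓢'(ℝ, ℂ)} (hd : IsComposition g (H.dist u) d) :
    d = (compL2 g (bess (oneFt u)) : 𝓢'(ℝ, ℂ)) := by
  obtain ⟨v, hv, hgv⟩ := hd
  refine (hgv.congr ?_).dist_eq ((isFunction_lp _).congr (compL2_bess_coe hg g0 _))
  filter_upwards [hv.ae_eq (isFunction_bess_oneFt h2 u)] with x hx
  rw [Complex.ofReal_inj.1 hx]

/-! ### The right-hand side of the equation -/

theorem isFunction_fourier_dxx {f : 𝓢'(ℝ, ℂ)} {F : ℝ → ℂ} (hF : IsFunction (𝓕 f) F) :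
    IsFunction (𝓕 (dxx f)) (fun ξ => -((wt ξ ^ 2 : ℝ) : ℂ) * F ξ) := by
  have hT : (fun x : ℝ => ((inner ℝ x (1 : ℝ) : ℝ) : ℂ)).HasTemperateGrowth := by fun_prop
  have step : ∀ {d : 𝓢'(ℝ, ℂ)} {D : ℝ → ℂ}, IsFunction (𝓕 d) D →
      IsFunction (𝓕 (∂_{(1 : ℝ)} d)) (fun ξ => (2 * Real.pi * Complex.I) * (((ξ : ℝ) : ℂ) * D ξ)) := by
    intro d D hD
    rw [TemperedDistribution.fourier_lineDerivOp_eq]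
    have := (hD.smulLeft hT).smul (2 * Real.pi * Complex.I)
    simpa using this
  refine (step (step hF)).congr (ae_of_all _ fun ξ => ?_)
  simp only [wt, mul_pow, sq_abs]
  push_cast
  have := Complex.I_sq
  linear_combination (4 * (Real.pi : ℂ) ^ 2 * ξ ^ 2 * F ξ) * this

theorem isBddSymbol_jap_mul_phase (h : IsElliptic ρ A B lam) :
    IsBddSymbol (fun ξ => ((jap (-(1 + ρ / 2)) ξ * phase lam ξ : ℝ) : ℂ)) := by
  have := isBddSymbol_jap_mul_wt.mul h.isBddSymbol_sqrt_mul_jap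
  convert this using 2 with ξ
  rw [← Complex.ofReal_mul]
  congr 1
  rw [phase, show -(1 + ρ / 2) = -1 + -(ρ / 2) by ring, ← jap_mul_jap]
  ring

theorem isBddSymbol_jap_order (h : IsElliptic ρ A B lam) :
    IsBddSymbol (fun ξ => (jap (-(1 + ρ / 2)) ξ : ℂ)) :=
  isBddSymbol_jap (by linarith [h.two_le])

/-- The right-hand side `-(ω λ^{1/2} 𝓕 u + |D| g(u))` of the equation for `|D|⁻¹ u_t` on the Fourier
side, with the weight `(1 + ξ²)^{-(1 + ρ/2)/2}` that makes it square integrable. -/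
def rate (lam g : ℝ → ℝ) (u : H (ρ / 2)) : L2 :=
  -(mul (fun ξ => ((jap (-(1 + ρ / 2)) ξ * phase lam ξ : ℝ) : ℂ)) (amp lam u) +
    mul (fun ξ => (jap (-(1 + ρ / 2)) ξ : ℂ)) (nl g (oneFt u)))

theorem rate_coe (h : IsElliptic ρ A B lam) (hg : ContDiff ℝ 2 g) (g0 : g 0 = 0) (u : H (ρ / 2)) :
    rate lam g u =ᵐ[volume] fun ξ => -((jap (-(1 + ρ / 2)) ξ * wt ξ : ℝ) : ℂ) *
      (√(lam ξ) * amp lam u ξ + (𝓕 (compL2 g (bess (oneFt u))) : L2) ξ) := by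
  filter_upwards [mul_coe (isBddSymbol_jap_mul_phase h) (amp lam u),
    mul_coe (isBddSymbol_jap_order h) (nl g (oneFt u)), nl_coe hg g0 (oneFt u),
    Lp.coeFn_neg (mul (fun ξ => ((jap (-(1 + ρ / 2)) ξ * phase lam ξ : ℝ) : ℂ)) (amp lam u) +
      mul (fun ξ => (jap (-(1 + ρ / 2)) ξ : ℂ)) (nl g (oneFt u))),
    Lp.coeFn_add (mul (fun ξ => ((jap (-(1 + ρ / 2)) ξ * phase lam ξ : ℝ) : ℂ)) (amp lam u))
      (mul (fun ξ => (jap (-(1 + ρ / 2)) ξ : ℂ)) (nl g (oneFt u)))] with ξ h1 h2 h3 h4 h5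
  rw [rate, h4, Pi.neg_apply, h5, Pi.add_apply, h1, h2, h3, phase]
  push_cast
  ring

/-- On the Fourier side, the right-hand side `L u_xx + g(u)_xx` is `2π|ξ|` times `rate` without its
weight. -/
theorem isFunction_fourier_rhs {l : ℝ → ℝ} (h : IsElliptic ρ A B (fun ξ => l (2 * Real.pi * ξ)))
    (hg : ContDiff ℝ 2 g) (g0 : g 0 = 0) {u : H (ρ / 2)} {w d : 𝓢'(ℝ, ℂ)}
    (hw : IsMultiplierImage l (dxx (H.dist u)) w) (hd : IsComposition g (H.dist u) d) :
    IsFunction (𝓕 (w + dxx d)) (fun ξ => (jap (2 + ρ / 2) ξ : ℂ) *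
      mul (fun ξ => ((jap (-1) ξ * wt ξ : ℝ) : ℂ)) (rate (fun ξ => l (2 * Real.pi * ξ)) g u) ξ) := by
  obtain ⟨F, hF, hlF⟩ := hw
  have hF' := hF.ae_eq (isFunction_fourier_dxx (isFunction_fourier_amp h u))
  have hd' : IsFunction (𝓕 (dxx d)) (fun ξ => -((wt ξ ^ 2 : ℝ) : ℂ) *
      (𝓕 (compL2 g (bess (oneFt u))) : L2) ξ) := by
    rw [hd.eq_compL2 h.two_le (hg.of_le (by norm_num)) g0]
    exact isFunction_fourier_dxx (isFunction_fourier_lp _)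
  rw [FourierTransform.fourier_add]
  refine (hlF.add hd').congr ?_
  filter_upwards [hF', rate_coe h hg g0 u,
    mul_coe isBddSymbol_jap_mul_wt (rate (fun ξ => l (2 * Real.pi * ξ)) g u)] with ξ h1 h2 h3
  rw [h1, h3, h2]
  have e1 : l (2 * Real.pi * ξ) = √(l (2 * Real.pi * ξ)) * √(l (2 * Real.pi * ξ)) :=
    (Real.mul_self_sqrt (h.lam_pos ξ).le).symm
  have e2 := (h.sqrt_pos ξ).ne'
  have e3 : jap (2 + ρ / 2) ξ * jap (-1) ξ * jap (-(1 + ρ / 2)) ξ = 1 := by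
    rw [jap_mul_jap, jap_mul_jap, show 2 + ρ / 2 + -1 + -(1 + ρ / 2) = (0 : ℝ) by ring, jap_zero]
  set r := √(l (2 * Real.pi * ξ)) with hr
  rw [e1]
  have e4 : (r : ℂ) ≠ 0 := by exact_mod_cast e2
  have e5 : (jap (2 + ρ / 2) ξ : ℂ) * jap (-1) ξ * jap (-(1 + ρ / 2)) ξ = 1 := by exact_mod_cast e3
  push_cast
  have e6 : (r : ℂ) * r * (-(wt ξ : ℂ) ^ 2 * ((r : ℂ)⁻¹ * amp (fun ξ => l (2 * Real.pi * ξ)) u ξ)) =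
      -(wt ξ : ℂ) ^ 2 * (r * amp (fun ξ => l (2 * Real.pi * ξ)) u ξ) := by
    field_simp
  rw [e6]
  linear_combination ((wt ξ : ℂ) ^ 2 * (r * amp (fun ξ => l (2 * Real.pi * ξ)) u ξ +
    (𝓕 (compL2 g (bess (oneFt u))) : L2) ξ)) * e5

theorem exists_multiplierImage {l : ℝ → ℝ} (h : IsElliptic ρ A B (fun ξ => l (2 * Real.pi * ξ)))
    (u : H (ρ / 2)) : ∃ w : 𝓢'(ℝ, ℂ), IsMultiplierImage l (dxx (H.dist u)) w := by
  have hF := isFunction_fourier_dxx (isFunction_fourier_amp h u)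
  have hm : Measurable (fun ξ =>
      ((l (2 * Real.pi * ξ) * (-wt ξ ^ 2 * (√(l (2 * Real.pi * ξ)))⁻¹) : ℝ) : ℂ)) :=
    Complex.measurable_ofReal.comp (h.measurable.mul ((measurable_wt.pow_const 2).neg.mul
      h.measurable_sqrt.inv))
  obtain ⟨d, hd⟩ := exists_isFunction_mul hm (C := (2 * Real.pi) ^ 2 * B) (k := 2 + ρ / 2)
    (fun ξ => by
      have e1 : l (2 * Real.pi * ξ) = √(l (2 * Real.pi * ξ)) * √(l (2 * Real.pi * ξ)) :=
        (Real.mul_self_sqrt (h.lam_pos ξ).le).symm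
      have e2 := h.sqrt_pos ξ
      have e3 := h.sqrt_upper ξ
      set r := √(l (2 * Real.pi * ξ)) with hr
      have e4 : l (2 * Real.pi * ξ) * (-wt ξ ^ 2 * r⁻¹) = -(wt ξ ^ 2 * r) := by
        rw [e1]; field_simp
      have e5 : wt ξ ^ 2 ≤ (2 * Real.pi) ^ 2 * jap 2 ξ := by
        rw [wt, mul_pow, sq_abs, jap_two]
        nlinarith [sq_nonneg (2 * Real.pi)]
      rw [e4, Complex.norm_real, norm_neg, Real.norm_of_nonneg (by positivity), ← jap_mul_jap]
      calc wt ξ ^ 2 * r ≤ ((2 * Real.pi) ^ 2 * jap 2 ξ) * (B * jap (ρ / 2) ξ) := by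
            gcongr
            exact mul_nonneg (by positivity) (jap_pos _ _).le
        _ = _ := by ring) (amp (fun ξ => l (2 * Real.pi * ξ)) u)
  refine ⟨𝓕⁻ d, _, hF, ?_⟩
  rw [FourierTransform.fourier_fourierInv_eq]
  refine hd.congr (ae_of_all _ fun ξ => ?_)
  push_cast
  ring

end Amplitude

/-! ### Testing with Schwartz functions -/

/-- The test function `(1 + ξ²)^{k/2} 𝓕⁻¹ χ` against which a distribution with the Fourier transform
`(1 + ξ²)^{k/2} f`, `f ∈ L²`, is evaluated. -/
def dualTest (k : ℝ) (χ : 𝓢(ℝ, ℂ)) : 𝓢(ℝ, ℂ) :=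
  SchwartzMap.smulLeftCLM ℂ (fun ξ => (jap k ξ : ℂ)) (𝓕⁻ χ)

theorem apply_eq_dualTest {d : 𝓢'(ℝ, ℂ)} {k : ℝ} {f : L2}
    (hd : IsFunction (𝓕 d) (fun ξ => (jap k ξ : ℂ) * f ξ)) (χ : 𝓢(ℝ, ℂ)) :
    d χ = (f : 𝓢'(ℝ, ℂ)) (dualTest k χ) := by
  have e : 𝓕 d = smulLeftCLM ℂ (fun ξ => (jap k ξ : ℂ)) (f : 𝓢'(ℝ, ℂ)) :=
    hd.dist_eq ((isFunction_lp f).smulLeft (hasTemperateGrowth_jap k))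
  calc d χ = (𝓕 d) (𝓕⁻ χ) := by
        rw [TemperedDistribution.fourier_apply, FourierTransform.fourier_fourierInv_eq]
    _ = _ := by rw [e]; rfl

theorem dualTest_surjective (k : ℝ) (η : 𝓢(ℝ, ℂ)) : ∃ χ, dualTest k χ = η := by
  refine ⟨𝓕 (SchwartzMap.smulLeftCLM ℂ (fun ξ => (jap (-k) ξ : ℂ)) η), ?_⟩
  rw [dualTest, FourierTransform.fourierInv_fourier_eq]
  ext ξ
  rw [SchwartzMap.smulLeftCLM_apply_apply (hasTemperateGrowth_jap k),
    SchwartzMap.smulLeftCLM_apply_apply (hasTemperateGrowth_jap (-k)), smul_smul,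
    ← Complex.ofReal_mul, mul_comm, jap_neg_mul, Complex.ofReal_one, one_smul]

/-- The evaluation of a square integrable function on a Schwartz function. -/
def testCLM (η : 𝓢(ℝ, ℂ)) : L2 →L[ℝ] ℂ where
  toFun f := (f : 𝓢'(ℝ, ℂ)) η
  map_add' f h := by
    have := map_add (Lp.toTemperedDistributionCLM ℂ (volume : Measure ℝ) 2) f h
    exact congrArg (fun d : 𝓢'(ℝ, ℂ) => d η) this
  map_smul' c f := by
    have := map_smul (Lp.toTemperedDistributionCLM ℂ (volume : Measure ℝ) 2) (c : ℂ) f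
    rw [L2.real_smul_eq]
    exact (congrArg (fun d : 𝓢'(ℝ, ℂ) => d η) this).trans (Complex.coe_smul c _)
  cont := by
    have h1 := (Lp.toTemperedDistributionCLM ℂ (volume : Measure ℝ) 2).continuous
    exact ((PointwiseConvergenceCLM.evalCLM (RingHom.id ℂ) ℂ η).continuous).comp h1

theorem isFunction_fourier_velocity {ρ : ℝ} (h2 : 2 ≤ ρ) (v : H (-1)) :
    IsFunction (𝓕 (H.dist v)) (fun ξ => (jap (2 + ρ / 2) ξ : ℂ) *
      mul (fun ξ => (jap (-(1 + ρ / 2)) ξ : ℂ)) (ft (-1) v) ξ) := by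
  refine (isFunction_fourier_dist v).congr ?_
  filter_upwards [mul_coe (isBddSymbol_jap (s := -(1 + ρ / 2)) (by linarith)) (ft (-1) v)]
    with ξ h1
  rw [h1, ← mul_assoc, ← Complex.ofReal_mul, jap_mul_jap]
  ring_nf

/-! ### From the first order equation to the Cauchy problem -/

theorem hasDerivWithinAt_of_ft {r : ℝ} {f : ℝ → H r} {f' : H r} {s : Set ℝ} {t : ℝ}
    (h : HasDerivWithinAt (fun τ => ft r (f τ)) (ft r f') s t) : HasDerivWithinAt f f' s t := by
  rw [hasDerivWithinAt_iff_isLittleO] at h ⊢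
  simp only [← map_smul, ← map_sub] at h
  rw [← Asymptotics.isLittleO_norm_left] at h ⊢
  simpa only [LinearIsometry.norm_map] using h

theorem continuousOn_iff_ft {r : ℝ} {f : ℝ → H r} {s : Set ℝ} :
    ContinuousOn f s ↔ ContinuousOn (fun τ => ft r (f τ)) s :=
  ((ft r).isometry.comp_continuousOn_iff).symm

section Existence

variable {ρ A B : ℝ} {lam l g : ℝ → ℝ}

theorem dist_eq_val {s : ℝ} (u : H s) : H.dist u = Subtype.val (p := (· ∈ sobolevSubmodule s)) u :=
  rfl

theorem dist_incl {s r : ℝ} (hrs : r ≤ s) (u : H s) : H.dist (H.incl hrs u) = H.dist u := by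
  rw [dist_eq_val, H.incl]

theorem ft_incl (h : IsElliptic ρ A B lam) (hrs : -1 ≤ ρ / 2) (u : H (ρ / 2)) :
    ft (-1) (H.incl hrs u) = mul (fun ξ => ((jap (-1) ξ / √(lam ξ) : ℝ) : ℂ)) (amp lam u) := by
  apply Lp.ext
  have h0 := isFunction_fourier_dist (H.incl hrs u)
  rw [dist_incl] at h0
  have h1 := h0.ae_eq (isFunction_fourier_amp h u)
  filter_upwards [h1, mul_coe (h.isBddSymbol_jap_div_sqrt (s := -1) (by linarith)) (amp lam u)]
    with ξ e1 e2
  have e3 : (jap (- -1) ξ : ℂ) ≠ 0 := by exact_mod_cast (jap_pos _ _).ne'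
  apply mul_left_cancel₀ e3
  rw [e1, e2, ← mul_assoc, ← Complex.ofReal_mul, mul_div_assoc', jap_mul_jap, neg_add_cancel,
    jap_zero, one_div]

theorem apply_velocity (h2 : 2 ≤ ρ) (v : H (-1)) (χ : 𝓢(ℝ, ℂ)) :
    H.dist v χ = testCLM (dualTest (2 + ρ / 2) χ)
      (mul (fun ξ => (jap (-(1 + ρ / 2)) ξ : ℂ)) (ft (-1) v)) :=
  apply_eq_dualTest (isFunction_fourier_velocity h2 v) χ

theorem apply_rhs (h : IsElliptic ρ A B lam) (hlam : ∀ ξ, lam ξ = l (2 * Real.pi * ξ))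
    (hg : ContDiff ℝ 2 g) (g0 : g 0 = 0) {u : H (ρ / 2)} {w d : 𝓢'(ℝ, ℂ)}
    (hw : IsMultiplierImage l (dxx (H.dist u)) w) (hd : IsComposition g (H.dist u) d)
    (χ : 𝓢(ℝ, ℂ)) :
    (w + dxx d) χ = testCLM (dualTest (2 + ρ / 2) χ)
      (mul (fun ξ => ((jap (-1) ξ * wt ξ : ℝ) : ℂ)) (rate lam g u)) := by
  obtain rfl : lam = fun ξ => l (2 * Real.pi * ξ) := funext hlam
  exact apply_eq_dualTest (isFunction_fourier_rhs h hg g0 hw hd) χ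

/-- A solution `z = exp(itω) y` of the first order equation gives a solution of the Cauchy problem,
with `λ^{1/2} 𝓕 u` and `𝓕 u_t / |2πξ|` the hermitian parts of `z`. -/
theorem exists_solvesWith (h : IsElliptic ρ A B lam) (hlam : ∀ ξ, lam ξ = l (2 * Real.pi * ξ))
    (hg : ContDiff ℝ 2 g) (g0 : g 0 = 0) (hrs : -1 ≤ ρ / 2) {φ : H (ρ / 2)} {ψ : H (-1)}
    {h₀ : L2} (hJ : J h₀ = h₀) (hψ : ft (-1) ψ = mul (fun ξ => ((jap (-1) ξ * wt ξ : ℝ) : ℂ)) h₀)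
    {y : ℝ → L2} (hy0 : y 0 = amp lam φ - Complex.I • h₀)
    (hy : IsInteractionSolution (phase lam) (force lam g) (Ici 0) y) :
    ∃ (u : ℝ → H (ρ / 2)) (u' : ℝ → H (-1)), SolvesWith l g hrs φ ψ u u' := by
  set z := fun τ => group (phase lam) τ (y τ) with hz
  have hzc : ContinuousOn z (Ici 0) := continuousOn_state h fun t ht => (hy t ht).continuousWithinAt
  have hz0 : z 0 = amp lam φ - Complex.I • h₀ := by rw [hz]; simp only [group_zero, hy0]
  have b1 := h.isBddSymbol_jap_div_sqrt (s := ρ / 2) le_rfl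
  have b2 := isBddSymbol_jap_mul_wt
  have b3 := h.isBddSymbol_jap_div_sqrt (s := -1) hrs
  have b4 := isBddSymbol_jap_order h
  have J1 : ∀ t, J (mul (fun ξ => ((jap (ρ / 2) ξ / √(lam ξ) : ℝ) : ℂ)) (hermRe (z t))) = _ := fun t =>
    J_mul_real b1 (fun ξ => by rw [jap_neg_arg, h.even]) (J_hermRe (z t))
  have J2 : ∀ t, J (mul (fun ξ => ((jap (-1) ξ * wt ξ : ℝ) : ℂ)) (hermIm (z t))) = _ := fun t =>
    J_mul_real b2 (fun ξ => by rw [jap_neg_arg, wt_neg]) (J_hermIm (z t))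
  set u : ℝ → H (ρ / 2) := fun t => ofFt (ρ / 2) _ (J1 t) with hu
  set u' : ℝ → H (-1) := fun t => ofFt (-1) _ (J2 t) with hu'
  have fu : ∀ t, ft (ρ / 2) (u t) =
      mul (fun ξ => ((jap (ρ / 2) ξ / √(lam ξ) : ℝ) : ℂ)) (hermRe (z t)) := fun t => ft_ofFt _ _ _
  have fu' : ∀ t, ft (-1) (u' t) =
      mul (fun ξ => ((jap (-1) ξ * wt ξ : ℝ) : ℂ)) (hermIm (z t)) := fun t => ft_ofFt _ _ _
  have au : ∀ t, amp lam (u t) = hermRe (z t) := fun t => amp_eq_of_ft h (fu t)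
  have ou : ∀ t, oneFt (u t) = profile lam (z t) := fun t => by rw [oneFt_eq_amp h, au, profile]
  refine ⟨u, u', ⟨?_, ?_, fun t ht => hasDerivWithinAt_of_ft ?_, ?_, ?_, fun t ht => ?_⟩⟩
  · rw [continuousOn_iff_ft]
    simp only [fu]
    exact ((mul _).continuous.comp hermRe.continuous).comp_continuousOn hzc
  · rw [continuousOn_iff_ft]
    simp only [fu']
    exact ((mul _).continuous.comp (hermRe.continuous.comp continuous_smul_I)).comp_continuousOn hzc
  · simp only [ft_incl h, au, fu']
    have := hasDerivWithinAt_hermRe h hg g0 hy ht (m := fun ξ => jap (-1) ξ / √(lam ξ)) b3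
      (fun ξ => by rw [jap_neg_arg, h.even]) (by rw [jap_div_sqrt_mul_phase h]; exact b2)
    rwa [jap_div_sqrt_mul_phase h] at this
  · apply (ft (ρ / 2)).injective
    rw [fu, hz0, hermRe_sub_smul_I (J_amp h φ) hJ, ← ft_eq_amp h]
  · apply (ft (-1)).injective
    rw [fu', hz0, hermIm_sub_smul_I (J_amp h φ) hJ, hψ]
  · obtain ⟨w, hw⟩ : ∃ w, IsMultiplierImage l (dxx (H.dist (u t))) w := by
      obtain rfl : lam = fun ξ => l (2 * Real.pi * ξ) := funext hlam
      exact exists_multiplierImage h (u t)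
    have hc := isComposition_compL2 h.two_le (hg.of_le (by norm_num)) g0 (u t)
    refine ⟨w, _, hw, hc, fun χ => ?_⟩
    rw [apply_rhs h hlam hg g0 hw hc]
    have hd := (hasDerivWithinAt_hermIm h hg g0 hy ht.le (m := jap (-(1 + ρ / 2))) b4
      (jap_neg_arg _) (isBddSymbol_jap_mul_phase h)).hasDerivAt (Ici_mem_nhds ht)
    have hr : -(mul (fun ξ => ((jap (-(1 + ρ / 2)) ξ * phase lam ξ : ℝ) : ℂ)) (hermRe (z t)) +
        mul (fun ξ => (jap (-(1 + ρ / 2)) ξ : ℂ)) (nl g (profile lam (z t)))) = rate lam g (u t) := by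
      rw [rate, au, ou]
    rw [hr] at hd
    have hd2 := (testCLM (dualTest (2 + ρ / 2) χ)).hasFDerivAt.comp_hasDerivAt t
      (((mul (fun ξ => ((jap (-1) ξ * wt ξ : ℝ) : ℂ))).restrictScalars ℝ).hasFDerivAt.comp_hasDerivAt
        t hd)
    refine hd2.congr_of_eventuallyEq (Eventually.of_forall fun τ => ?_)
    change H.dist (u' τ) χ = _
    rw [apply_velocity h.two_le, fu', mul_comm_apply b4 b2]
    rfl

end Existence

/-! ### Integration in time -/

theorem hasDerivWithinAt_integral {G : ℝ → L2} (hG : ContinuousOn G (Ici 0)) {t : ℝ} (ht : 0 ≤ t) :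
    HasDerivWithinAt (fun τ => ∫ s in (0 : ℝ)..τ, G s) (G t) (Ici 0) t := by
  have hc : Continuous (fun s => G (max 0 s)) :=
    hG.comp_continuous (by fun_prop) fun s => mem_Ici.2 (le_max_left _ _)
  have h1 := (intervalIntegral.integral_hasDerivAt_right (hc.intervalIntegrable 0 t)
    hc.stronglyMeasurable.stronglyMeasurableAtFilter hc.continuousAt).hasDerivWithinAt (s := Ici 0)
  simp only [max_eq_right ht] at h1
  have e : ∀ τ ∈ Ici (0 : ℝ), ∫ s in (0 : ℝ)..τ, G s = ∫ s in (0 : ℝ)..τ, G (max 0 s) := fun τ hτ => by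
    refine intervalIntegral.integral_congr fun s hs => ?_
    rw [uIcc_of_le hτ] at hs
    simp only [max_eq_right hs.1]
  exact h1.congr e (e t ht)

theorem eq_of_hasDerivWithinAt_Ici {x y x' : ℝ → L2}
    (hx : ∀ t ∈ Ici (0 : ℝ), HasDerivWithinAt x (x' t) (Ici 0) t)
    (hy : ∀ t ∈ Ici (0 : ℝ), HasDerivWithinAt y (x' t) (Ici 0) t) (h0 : x 0 = y 0) {t : ℝ}
    (ht : 0 ≤ t) : x t = y t := by
  have hd : ∀ τ ∈ Icc 0 t, HasDerivWithinAt (fun τ => x τ - y τ) 0 (Icc 0 t) τ := fun τ hτ => by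
    have := ((hx τ hτ.1).sub (hy τ hτ.1)).mono (Icc_subset_Ici_self : Icc 0 t ⊆ Ici 0)
    rwa [sub_self] at this
  have := constant_of_derivWithin_zero (fun τ hτ => (hd τ hτ).differentiableWithinAt)
    (fun τ hτ => (hd τ (Ico_subset_Icc_self hτ)).derivWithin
      (uniqueDiffOn_Icc (hτ.1.trans_lt hτ.2) τ (Ico_subset_Icc_self hτ))) t ⟨ht, le_rfl⟩
  simpa only [h0, sub_self, sub_eq_zero] using this

/-- A weak derivative (tested against Schwartz functions) that is continuous in `L²` is a strong one, in integrated form. -/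
theorem eq_add_integral_of_weak {X G : ℝ → L2} (hX : ContinuousOn X (Ici 0))
    (hG : ContinuousOn G (Ici 0))
    (h : ∀ t, 0 < t → ∀ η : 𝓢(ℝ, ℂ), HasDerivAt (fun τ => testCLM η (X τ)) (testCLM η (G t)) t)
    {t : ℝ} (ht : 0 ≤ t) : X t = X 0 + ∫ s in (0 : ℝ)..t, G s := by
  have hsub : Icc 0 t ⊆ Ici 0 := Icc_subset_Ici_self
  have hGi : IntervalIntegrable G volume 0 t :=
    ContinuousOn.intervalIntegrable (by rw [uIcc_of_le ht]; exact hG.mono hsub)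
  apply H.lp_dist_injective
  ext η
  change testCLM η _ = testCLM η _
  have h1 := intervalIntegral.integral_eq_sub_of_hasDerivAt_of_le ht
    ((testCLM η).continuous.comp_continuousOn (hX.mono hsub)) (fun τ hτ => h τ hτ.1 η)
    (ContinuousOn.intervalIntegrable (by
      rw [uIcc_of_le ht]
      exact (testCLM η).continuous.comp_continuousOn (hG.mono hsub)))
  rw [(testCLM η).intervalIntegral_comp_comm hGi] at h1
  rw [map_add, h1]
  simp

/-! ### From the Cauchy problem to the first order equation -/

theorem mul_injective {m : ℝ → ℝ} (hm : IsBddSymbol (fun ξ => (m ξ : ℂ))) (h : ∀ ξ, m ξ ≠ 0) :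
    Function.Injective (mul (fun ξ => (m ξ : ℂ))) := by
  intro f k hfk
  apply Lp.ext
  have h2 := mul_coe hm k
  rw [← hfk] at h2
  filter_upwards [mul_coe hm f, h2] with ξ e1 e2
  exact mul_left_cancel₀ (Complex.ofReal_ne_zero.2 (h ξ)) (e1.symm.trans e2)

theorem continuous_nl {g : ℝ → ℝ} (hg : ContDiff ℝ 2 g) (g0 : g 0 = 0) : Continuous (nl g) := by
  refine continuous_iff_continuousAt.2 fun b => ?_
  obtain ⟨K, hK⟩ := nl_lipschitz hg g0 (‖b‖ + 1)
  exact hK.continuousOn.continuousAt (mem_of_superset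
    (isOpen_ball.mem_nhds (show b ∈ ball (0 : L2) (‖b‖ + 1) by simp)) ball_subset_closedBall)

section Uniqueness

variable {ρ A B : ℝ} {lam l g : ℝ → ℝ}

theorem J_rate (h : IsElliptic ρ A B lam) (hg : ContDiff ℝ 2 g) (g0 : g 0 = 0) (u : H (ρ / 2)) :
    J (rate lam g u) = rate lam g u := by
  rw [rate, map_neg, map_add,
    J_mul_real (isBddSymbol_jap_mul_phase h) (fun ξ => by rw [jap_neg_arg, h.phase_neg]) (J_amp h u),
    J_mul_real (isBddSymbol_jap_order h) (jap_neg_arg _) (J_nl hg g0 _)]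

theorem continuous_rate (hg : ContDiff ℝ 2 g) (g0 : g 0 = 0) :
    Continuous (rate (ρ := ρ) lam g) := by
  have h1 : Continuous (amp (ρ := ρ) lam) := (mul _).continuous.comp (ft (ρ / 2)).continuous
  have h2 : Continuous (oneFt (ρ := ρ)) := (mul _).continuous.comp (ft (ρ / 2)).continuous
  exact (((mul _).continuous.comp h1).add
    ((mul _).continuous.comp ((continuous_nl hg g0).comp h2))).neg

/-- The weighted `|D|⁻¹ u_t` on the Fourier side: the initial value plus the integral of `rate`. -/
def momentum (lam g : ℝ → ℝ) (h₀ : L2) (v : ℝ → H (ρ / 2)) (t : ℝ) : L2 :=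
  mul (fun ξ => (jap (-(1 + ρ / 2)) ξ : ℂ)) h₀ + ∫ s in (0 : ℝ)..t, rate lam g (v s)

theorem J_momentum (h : IsElliptic ρ A B lam) (hg : ContDiff ℝ 2 g) (g0 : g 0 = 0) {h₀ : L2}
    (hJ : J h₀ = h₀) {v : ℝ → H (ρ / 2)} (hv : ContinuousOn v (Ici 0)) {t : ℝ} (ht : 0 ≤ t) :
    J (momentum lam g h₀ v t) = momentum lam g h₀ v t := by
  have hi : IntervalIntegrable (fun s => rate lam g (v s)) volume 0 t :=
    ContinuousOn.intervalIntegrable (by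
      rw [uIcc_of_le ht]
      exact (continuous_rate hg g0).comp_continuousOn (hv.mono Icc_subset_Ici_self))
  rw [momentum, map_add, ← J.intervalIntegral_comp_comm hi,
    J_mul_real (isBddSymbol_jap_order h) (jap_neg_arg _) hJ]
  simp only [J_rate h hg g0]

/-- The equation integrated in time: `𝓕 u_t` is `2π|ξ|` times `momentum` without its weight. -/
theorem SolvesWith.velocity_eq (h : IsElliptic ρ A B lam) (hlam : ∀ ξ, lam ξ = l (2 * Real.pi * ξ))
    (hg : ContDiff ℝ 2 g) (g0 : g 0 = 0) {hrs : -1 ≤ ρ / 2} {φ : H (ρ / 2)} {ψ : H (-1)} {h₀ : L2}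
    (hψ : ft (-1) ψ = mul (fun ξ => ((jap (-1) ξ * wt ξ : ℝ) : ℂ)) h₀)
    {v : ℝ → H (ρ / 2)} {v' : ℝ → H (-1)} (hv : SolvesWith l g hrs φ ψ v v') {t : ℝ} (ht : 0 ≤ t) :
    mul (fun ξ => (jap (-(1 + ρ / 2)) ξ : ℂ)) (ft (-1) (v' t)) =
      mul (fun ξ => ((jap (-1) ξ * wt ξ : ℝ) : ℂ)) (momentum lam g h₀ v t) := by
  set W := (mul (fun ξ => ((jap (-1) ξ * wt ξ : ℝ) : ℂ))).restrictScalars ℝ with hW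
  have hR : ContinuousOn (fun s => rate lam g (v s)) (Ici 0) :=
    (continuous_rate hg g0).comp_continuousOn hv.continuousOn
  have key := eq_add_integral_of_weak
    (X := fun τ => mul (fun ξ => (jap (-(1 + ρ / 2)) ξ : ℂ)) (ft (-1) (v' τ)))
    (G := fun τ => W (rate lam g (v τ)))
    ((mul _).continuous.comp_continuousOn (continuousOn_iff_ft.1 hv.continuousOn_deriv))
    (W.continuous.comp_continuousOn hR) (fun t ht η => ?_) ht
  · rw [W.intervalIntegral_comp_comm (ContinuousOn.intervalIntegrable (by
      rw [uIcc_of_le ht]; exact hR.mono Icc_subset_Ici_self)), hv.initial_deriv, hψ,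
      mul_comm_apply (isBddSymbol_jap_order h) isBddSymbol_jap_mul_wt] at key
    rw [key, momentum, map_add]
    rfl
  · obtain ⟨χ, rfl⟩ := dualTest_surjective (2 + ρ / 2) η
    obtain ⟨w, d, hw, hd, hder⟩ := hv.equation t ht
    have := hder χ
    rw [apply_rhs h hlam hg g0 hw hd] at this
    simp only [apply_velocity h.two_le] at this
    exact this

/-- The amplitude `λ^{1/2} 𝓕 u` has the derivative `λ^{1/2} 𝓕 u_t`, which need not be square
integrable. Of the two factors `(1 + ξ²)^{-(1 + ρ/2)/2}`, one makes the symbol `ω` bounded and the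
other is the weight of `momentum`. -/
theorem SolvesWith.hasDerivWithinAt_amp (h : IsElliptic ρ A B lam)
    (hlam : ∀ ξ, lam ξ = l (2 * Real.pi * ξ))
    (hg : ContDiff ℝ 2 g) (g0 : g 0 = 0) {hrs : -1 ≤ ρ / 2} {φ : H (ρ / 2)} {ψ : H (-1)} {h₀ : L2}
    (hψ : ft (-1) ψ = mul (fun ξ => ((jap (-1) ξ * wt ξ : ℝ) : ℂ)) h₀)
    {v : ℝ → H (ρ / 2)} {v' : ℝ → H (-1)} (hv : SolvesWith l g hrs φ ψ v v') {t : ℝ}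
    (ht : t ∈ Ici (0 : ℝ)) :
    HasDerivWithinAt (fun τ => mul (fun ξ => (jap (-(1 + ρ / 2)) ξ : ℂ))
      (mul (fun ξ => (jap (-(1 + ρ / 2)) ξ : ℂ)) (amp lam (v τ))))
      (mul (fun ξ => ((jap (-(1 + ρ / 2)) ξ * phase lam ξ : ℝ) : ℂ)) (momentum lam g h₀ v t))
      (Ici 0) t := by
  have b1 := isBddSymbol_jap_order h
  have b2 := h.isBddSymbol_sqrt_mul_jap
  have b3 := h.isBddSymbol_jap_div_sqrt (s := -1) hrs
  have h1 := (ft (-1)).toContinuousLinearMap.hasFDerivAt.comp_hasDerivWithinAt t (hv.hasDeriv t ht)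
  have h2 := ((mul (fun ξ => ((√(lam ξ) * jap (-(ρ / 2)) ξ : ℝ) : ℂ)) ∘L
    mul (fun ξ => (jap (-(1 + ρ / 2)) ξ : ℂ))).restrictScalars ℝ).hasFDerivAt.comp_hasDerivWithinAt
      t h1
  have e1 : ∀ f : L2, mul (fun ξ => ((√(lam ξ) * jap (-(ρ / 2)) ξ : ℝ) : ℂ))
      (mul (fun ξ => ((jap (-1) ξ * wt ξ : ℝ) : ℂ)) f) =
      mul (fun ξ => ((jap (-(1 + ρ / 2)) ξ * phase lam ξ : ℝ) : ℂ)) f := fun f => by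
    refine mul_mul_real b2 isBddSymbol_jap_mul_wt (fun ξ => ?_) f
    rw [phase, show -(1 + ρ / 2) = -1 + -(ρ / 2) by ring, ← jap_mul_jap]
    ring
  have e2 : ∀ f : L2, mul (fun ξ => ((√(lam ξ) * jap (-(ρ / 2)) ξ : ℝ) : ℂ))
      (mul (fun ξ => ((jap (-1) ξ / √(lam ξ) : ℝ) : ℂ)) f) =
      mul (fun ξ => (jap (-(1 + ρ / 2)) ξ : ℂ)) f := fun f => by
    refine mul_mul_real b2 b3 (fun ξ => ?_) f
    have := (h.sqrt_pos ξ).ne'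
    rw [show -(1 + ρ / 2) = -1 + -(ρ / 2) by ring, ← jap_mul_jap]
    field_simp
  have e3 : ((mul (fun ξ => ((√(lam ξ) * jap (-(ρ / 2)) ξ : ℝ) : ℂ)) ∘L
      mul (fun ξ => (jap (-(1 + ρ / 2)) ξ : ℂ))).restrictScalars ℝ)
      ((ft (-1)).toContinuousLinearMap (v' t)) =
      mul (fun ξ => ((jap (-(1 + ρ / 2)) ξ * phase lam ξ : ℝ) : ℂ)) (momentum lam g h₀ v t) := by
    rw [← e1, ← hv.velocity_eq h hlam hg g0 hψ ht]
    rfl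
  rw [e3] at h2
  have e4 : ∀ τ, mul (fun ξ => (jap (-(1 + ρ / 2)) ξ : ℂ))
      (mul (fun ξ => (jap (-(1 + ρ / 2)) ξ : ℂ)) (amp lam (v τ))) =
      mul (fun ξ => ((√(lam ξ) * jap (-(ρ / 2)) ξ : ℝ) : ℂ))
        (mul (fun ξ => (jap (-(1 + ρ / 2)) ξ : ℂ)) (ft (-1) (H.incl hrs (v τ)))) := fun τ => by
    rw [ft_incl h, mul_comm_apply b2 b1, e2]
  exact h2.congr (fun τ _ => e4 τ) (e4 t)

theorem group_neg_phase (ω : ℝ → ℝ) (t : ℝ) : group (fun ξ => -ω ξ) t = group ω (-t) := by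
  rw [group, group]
  congr 1
  ext ξ
  rw [expSymbol, expSymbol, neg_mul, mul_neg]

theorem group_mul {ω m : ℝ → ℝ} (hω : Measurable ω) (hm : IsBddSymbol (fun ξ => (m ξ : ℂ))) (t : ℝ)
    (f : L2) : group ω t (mul (fun ξ => (m ξ : ℂ)) f) = mul (fun ξ => (m ξ : ℂ)) (group ω t f) :=
  mul_comm_apply (isBddSymbol_exp hω t) hm f

/-- The variation of constants formula behind a weight `κ`: if `κ β` is differentiable with the
derivative `i (κ ω β + κ² F)`, which is the weighted form of `a' = i (ω a + F)` for `β = κ a`, then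
`β(t) = κ exp(itω) y(t)` for `y(t) = a₀ + ∫₀ᵗ exp(-isω) i F(s) ds`. -/
theorem eq_duhamel {ω κ : ℝ → ℝ} (hω : Measurable ω) (hκ : IsBddSymbol (fun ξ => (κ ξ : ℂ)))
    (hκ0 : ∀ ξ, κ ξ ≠ 0) (hκω : IsBddSymbol (fun ξ => ((κ ξ * ω ξ : ℝ) : ℂ))) {β F y : ℝ → L2}
    (hβ : ∀ t ∈ Ici (0 : ℝ), HasDerivWithinAt (fun τ => mul (fun ξ => (κ ξ : ℂ)) (β τ))
      (Complex.I • (mul (fun ξ => ((κ ξ * ω ξ : ℝ) : ℂ)) (β t) +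
        mul (fun ξ => (κ ξ : ℂ)) (mul (fun ξ => (κ ξ : ℂ)) (F t)))) (Ici 0) t)
    (hy : ∀ t ∈ Ici (0 : ℝ), HasDerivWithinAt y (group ω (-t) (Complex.I • F t)) (Ici 0) t)
    (h0 : β 0 = mul (fun ξ => (κ ξ : ℂ)) (y 0)) {t : ℝ} (ht : 0 ≤ t) :
    β t = mul (fun ξ => (κ ξ : ℂ)) (group ω t (y t)) := by
  set M := mul (fun ξ => (κ ξ : ℂ)) with hM
  have hω' : Measurable (fun ξ => -ω ξ) := hω.neg
  have hb : IsBddSymbol (fun ξ => (κ ξ : ℂ) * ((-ω ξ : ℝ) : ℂ)) := by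
    obtain ⟨C, hC⟩ := hκω.2
    refine ⟨hκ.1.mul (Complex.measurable_ofReal.comp hω'), C, fun ξ => ?_⟩
    simpa using hC ξ
  have d1 : ∀ t ∈ Ici (0 : ℝ), HasDerivWithinAt
      (fun τ => M (group (fun ξ => -ω ξ) τ (M (β τ))))
      (M (M (M (group ω (-t) (Complex.I • F t))))) (Ici 0) t := fun t ht => by
    convert hasDerivWithinAt_mul_group hω' hκ hb (hβ t ht) using 1
    have hI : IsBddSymbol (fun ξ => Complex.I * ((κ ξ : ℂ) * ((-ω ξ : ℝ) : ℂ))) := by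
      obtain ⟨C, hC⟩ := hb.2
      exact ⟨hb.1.const_mul _, C, fun ξ => by simpa using hC ξ⟩
    have e : M (M (M (group ω (-t) (Complex.I • F t)))) =
        M (group ω (-t) (Complex.I • M (M (F t)))) := by
      rw [← map_smul M, ← map_smul M, group_mul hω hκ, group_mul hω hκ]
    rw [group_neg_phase, e, smul_add, map_add, map_add, ← add_assoc, right_eq_add]
    have hg := isBddSymbol_exp hω (-t)
    rw [map_smul, map_smul, group, mul_mul hg hκω, mul_mul hκ (hg.mul hκω), mul_mul hg hκ,
      mul_mul hI (hg.mul hκ)]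
    apply Lp.ext
    filter_upwards [mul_coe (hI.mul (hg.mul hκ)) (β t), mul_coe (hκ.mul (hg.mul hκω)) (β t),
      Lp.coeFn_add (mul (fun ξ => Complex.I * ((κ ξ : ℂ) * ((-ω ξ : ℝ) : ℂ)) *
        (expSymbol ω (-t) ξ * (κ ξ : ℂ))) (β t)) (Complex.I • mul (fun ξ => (κ ξ : ℂ) *
          (expSymbol ω (-t) ξ * ((κ ξ * ω ξ : ℝ) : ℂ))) (β t)),
      Lp.coeFn_smul Complex.I (mul (fun ξ => (κ ξ : ℂ) *
          (expSymbol ω (-t) ξ * ((κ ξ * ω ξ : ℝ) : ℂ))) (β t)), Lp.coeFn_zero ℂ 2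
          (volume : Measure ℝ)] with ξ e1 e2 e3 e4 e5
    rw [e3, Pi.add_apply, e1, e4, Pi.smul_apply, e2, e5, Pi.zero_apply, smul_eq_mul]
    push_cast
    ring
  have d2 : ∀ t ∈ Ici (0 : ℝ), HasDerivWithinAt (fun τ => M (M (M (y τ))))
      (M (M (M (group ω (-t) (Complex.I • F t))))) (Ici 0) t := fun t ht =>
    ((M ∘L M ∘L M).restrictScalars ℝ).hasFDerivAt.comp_hasDerivWithinAt t (hy t ht)
  have key := eq_of_hasDerivWithinAt_Ici d1 d2 (by simp only [group_zero, h0]) ht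
  -- The symbols `κ` may be cancelled, since they vanish nowhere.
  have hinj := mul_injective hκ hκ0
  have key2 := hinj key
  rw [group_neg_phase, group_mul hω hκ] at key2
  have key3 := congrArg (group ω t) (hinj key2)
  rw [group_group_neg hω, group_mul hω hκ] at key3
  exact key3

/-- A solution of the Cauchy problem is given by a solution of the first order equation. -/
theorem SolvesWith.exists_interaction (h : IsElliptic ρ A B lam)
    (hlam : ∀ ξ, lam ξ = l (2 * Real.pi * ξ))
    (hg : ContDiff ℝ 2 g) (g0 : g 0 = 0) {hrs : -1 ≤ ρ / 2} {φ : H (ρ / 2)} {ψ : H (-1)} {h₀ : L2}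
    (hJ : J h₀ = h₀) (hψ : ft (-1) ψ = mul (fun ξ => ((jap (-1) ξ * wt ξ : ℝ) : ℂ)) h₀)
    {v : ℝ → H (ρ / 2)} {v' : ℝ → H (-1)} (hv : SolvesWith l g hrs φ ψ v v') :
    ∃ y : ℝ → L2, y 0 = amp lam φ - Complex.I • h₀ ∧
      IsInteractionSolution (phase lam) (force lam g) (Ici 0) y ∧
      ∀ t, 0 ≤ t → amp lam (v t) = hermRe (group (phase lam) t (y t)) := by
  have hω := h.measurable_phase
  have b1 := isBddSymbol_jap_order h
  have b2 := isBddSymbol_jap_mul_phase h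
  -- `M (amp lam (v t)) - i Z t` is the unknown `√λ 𝓕 v - i 𝓕(|D|⁻¹ v_t)` with the weight `κ`,
  -- and `y` is the solution of the linear equation with the force coming from `v`.
  set κ := jap (-(1 + ρ / 2)) with hκ
  set M := mul (fun ξ => (κ ξ : ℂ)) with hM
  have hκ0 : ∀ ξ, κ ξ ≠ 0 := fun ξ => (jap_pos _ _).ne'
  set F : ℝ → L2 := fun t => nl g (oneFt (v t)) with hF
  have cF : ContinuousOn F (Ici 0) := by
    have h2 : Continuous (oneFt (ρ := ρ)) := (mul _).continuous.comp (ft (ρ / 2)).continuous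
    exact ((continuous_nl hg g0).comp h2).comp_continuousOn hv.continuousOn
  have cG : ContinuousOn (fun s => group (phase lam) (-s) (Complex.I • F s)) (Ici 0) := fun t ht =>
    tendsto_group hω ((continuous_neg.tendsto t).mono_left nhdsWithin_le_nhds)
      ((continuous_smul_I.tendsto _).comp (cF t ht))
  set y : ℝ → L2 := fun t => (amp lam φ - Complex.I • h₀) +
    ∫ s in (0 : ℝ)..t, group (phase lam) (-s) (Complex.I • F s) with hy
  have dy : ∀ t ∈ Ici (0 : ℝ), HasDerivWithinAt y
      (group (phase lam) (-t) (Complex.I • F t)) (Ici 0) t := fun t ht =>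
    (hasDerivWithinAt_integral cG ht).const_add _
  have y0 : y 0 = amp lam φ - Complex.I • h₀ := by simp [hy]
  set Z := momentum lam g h₀ v with hZ
  have cR : ContinuousOn (fun s => rate lam g (v s)) (Ici 0) :=
    (continuous_rate hg g0).comp_continuousOn hv.continuousOn
  have key : ∀ t, 0 ≤ t → M (amp lam (v t)) - Complex.I • Z t = M (group (phase lam) t (y t)) := by
    intro t ht
    refine eq_duhamel (β := fun t => M (amp lam (v t)) - Complex.I • Z t) hω b1 hκ0 b2
      (fun t ht => ?_) dy ?_ ht
    · have h1 := hv.hasDerivWithinAt_amp h hlam hg g0 hψ ht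
      have h2 : HasDerivWithinAt Z (rate lam g (v t)) (Ici 0) t :=
        (hasDerivWithinAt_integral cR ht).const_add _
      have h3 := (M.restrictScalars ℝ).hasFDerivAt.comp_hasDerivWithinAt t
        (h2.const_smul Complex.I)
      have e : Complex.I • (mul (fun ξ => ((κ ξ * phase lam ξ : ℝ) : ℂ))
          (M (amp lam (v t)) - Complex.I • Z t) + M (M (F t))) =
          mul (fun ξ => ((κ ξ * phase lam ξ : ℝ) : ℂ)) (Z t) - M (Complex.I • rate lam g (v t)) := by
        rw [rate, map_sub, map_smul, map_smul, map_neg, map_add, mul_comm_apply b2 b1, smul_add,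
          smul_sub, smul_smul, Complex.I_mul_I, smul_neg, smul_add]
        module
      rw [e]
      exact (h1.sub h3).congr (fun τ _ => map_sub M _ _) (map_sub M _ _)
    · simp only [hv.initial, y0, hZ, momentum, intervalIntegral.integral_same, add_zero]
      rw [map_sub, map_smul]
  have hp : ∀ t, 0 ≤ t → amp lam (v t) = hermRe (group (phase lam) t (y t)) := fun t ht => by
    apply mul_injective b1 hκ0
    rw [← hermRe_mul b1 (jap_neg_arg _)]
    change M (amp lam (v t)) = hermRe (M _)
    rw [← key t ht, hermRe_sub_smul_I (J_mul_real b1 (jap_neg_arg _) (J_amp h _))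
      (J_momentum h hg g0 hJ hv.continuousOn ht)]
  refine ⟨y, y0, fun t ht => ?_, hp⟩
  rw [force, profile, ← hp t ht, ← oneFt_eq_amp h]
  exact dy t ht

theorem SolvesWith.unique (h : IsElliptic ρ A B lam)
    (hlam : ∀ ξ, lam ξ = l (2 * Real.pi * ξ))
    (hg : ContDiff ℝ 2 g) (g0 : g 0 = 0) {hrs : -1 ≤ ρ / 2} {φ : H (ρ / 2)} {ψ : H (-1)} {h₀ : L2}
    (hJ : J h₀ = h₀) (hψ : ft (-1) ψ = mul (fun ξ => ((jap (-1) ξ * wt ξ : ℝ) : ℂ)) h₀)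
    {u v : ℝ → H (ρ / 2)} {u' v' : ℝ → H (-1)} (hu : SolvesWith l g hrs φ ψ u u')
    (hv : SolvesWith l g hrs φ ψ v v') {t : ℝ} (ht : 0 ≤ t) : v t = u t := by
  obtain ⟨y, y0, hy, hyu⟩ := hu.exists_interaction h hlam hg g0 hJ hψ
  obtain ⟨z, z0, hz, hzv⟩ := hv.exists_interaction h hlam hg g0 hJ hψ
  have e := interaction_unique h.measurable_phase (force_lipschitz h hg g0) (T := t)
    (fun τ hτ => (hz τ hτ.1).mono Icc_subset_Ici_self)
    (fun τ hτ => (hy τ hτ.1).mono Icc_subset_Ici_self) (z0.trans y0.symm) ⟨ht, le_rfl⟩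
  apply (ft (ρ / 2)).injective
  rw [ft_eq_amp h, ft_eq_amp h, hyu t ht, hzv t ht, e]

end Uniqueness

/-! ### The data of the Cauchy problem -/

/-- Passing from the angular frequency `2πξ` to `ξ` only changes the constants, as
`1 + ξ² ≤ 1 + (2πξ)² ≤ (2π)² (1 + ξ²)`. -/
theorem isElliptic_of_bounds {ρ c₁ c₂ : ℝ} {l : ℝ → ℝ} (hρ : 2 ≤ ρ) (hc₁ : 0 < c₁) (hc₂ : 0 < c₂)
    (hl_meas : Measurable l) (hl_even : ∀ ξ, l (-ξ) = l ξ)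
    (hl : ∀ ξ, c₁ ^ 2 * (1 + ξ ^ 2) ^ (ρ / 2) ≤ l ξ ∧ l ξ ≤ c₂ ^ 2 * (1 + ξ ^ 2) ^ (ρ / 2)) :
    IsElliptic ρ c₁ (c₂ * √(((2 * Real.pi) ^ 2) ^ (ρ / 2))) (fun ξ => l (2 * Real.pi * ξ)) := by
  have hpi : 1 ≤ (2 * Real.pi) ^ 2 := by nlinarith [Real.pi_gt_three]
  have hρ' : 0 ≤ ρ / 2 := by linarith
  refine ⟨hρ, hl_meas.comp (by fun_prop), fun ξ => by rw [mul_neg, hl_even], hc₁, fun ξ => ?_,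
    by positivity, fun ξ => ?_⟩
  · refine le_trans ?_ (hl (2 * Real.pi * ξ)).1
    rw [jap]
    refine mul_le_mul_of_nonneg_left (Real.rpow_le_rpow (by positivity) ?_ hρ') (by positivity)
    rw [mul_pow]
    nlinarith [sq_nonneg ξ]
  · refine (hl (2 * Real.pi * ξ)).2.trans ?_
    rw [mul_pow c₂, Real.sq_sqrt (by positivity), mul_assoc (c₂ ^ 2), jap,
      ← Real.mul_rpow (by positivity) (by positivity)]
    refine mul_le_mul_of_nonneg_left (Real.rpow_le_rpow (by positivity) ?_ hρ') (by positivity)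
    rw [mul_pow (2 * Real.pi)]
    nlinarith [sq_nonneg ξ]

theorem eq_zero_of_primitive_nonneg {g : ℝ → ℝ} (hg : Continuous g)
    (hG : ∀ y : ℝ, 0 ≤ ∫ p in (0 : ℝ)..y, g p) : g 0 = 0 := by
  refine IsLocalMin.hasDerivAt_eq_zero (Eventually.of_forall fun y => ?_) (hasDerivAt_primitive hg 0)
  simpa using hG y

/-- The Fourier transform `h₀` of `|D|⁻¹ ψ` is hermitian and square integrable. -/
theorem exists_initial_momentum {ψ : H (-1)} {h : L2}
    (hψ : IsMultiplierImage (fun ξ => |ξ|⁻¹) (H.dist ψ) (h : 𝓢'(ℝ, ℂ))) :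
    ∃ h₀ : L2, J h₀ = h₀ ∧
      ft (-1) ψ = mul (fun ξ => ((jap (-1) ξ * wt ξ : ℝ) : ℂ)) h₀ := by
  obtain ⟨F, hF, hhF⟩ := hψ
  -- At `ξ = 0` the symbol `|ξ|⁻¹` has the junk value `0`.
  have e0 : ∀ᵐ ξ : ℝ, ξ ≠ 0 := by simp [ae_iff]
  have e1 := hF.ae_eq (isFunction_fourier_dist ψ)
  have e2 := (isFunction_fourier_lp h).ae_eq hhF
  have e3 : ∀ᵐ ξ, ft (-1) ψ ξ = ((jap (-1) ξ * wt ξ : ℝ) : ℂ) * (𝓕 h : L2) ξ := by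
    filter_upwards [e0, e1, e2] with ξ h0 h1 h2
    have hw : |2 * Real.pi * ξ| ≠ 0 := abs_ne_zero.2 (mul_ne_zero Real.two_pi_pos.ne' h0)
    have e4 : jap (-1) ξ * wt ξ * |2 * Real.pi * ξ|⁻¹ * jap (- -1) ξ = 1 := by
      have : wt ξ = |2 * Real.pi * ξ| := by rw [wt, abs_mul, abs_of_pos Real.two_pi_pos]
      rw [this, mul_assoc (jap _ _), mul_inv_cancel₀ hw, mul_one, jap_mul_jap, add_neg_cancel,
        jap_zero]
    rw [h2, h1, ← mul_assoc, ← mul_assoc, ← Complex.ofReal_mul, ← Complex.ofReal_mul, e4,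
      Complex.ofReal_one, one_mul]
  refine ⟨𝓕 h, ?_, ?_⟩
  · rw [J_eq_iff]
    filter_upwards [e0, e3, ae_neg e3, J_eq_iff.1 (J_ft ψ)] with ξ h0 h1 h2 h3
    rw [h1, h2, map_mul, Complex.conj_ofReal, jap_neg_arg, wt_neg] at h3
    refine mul_left_cancel₀ (Complex.ofReal_ne_zero.2 (mul_ne_zero (jap_pos _ _).ne' ?_)) h3
    exact mul_ne_zero Real.two_pi_pos.ne' (abs_ne_zero.2 h0)
  · apply Lp.ext
    filter_upwards [e3, mul_coe isBddSymbol_jap_mul_wt (𝓕 h)] with ξ h1 h2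
    rw [h1, h2]

end NonlocalWave

end

theorem theorem4p3 (ρ : ℝ) (hρ : 2 ≤ ρ) (l : ℝ → ℝ) (c₁ c₂ : ℝ) (hc₁ : 0 < c₁) (hc₂ : 0 < c₂)
    (hl_meas : Measurable l) (hl_even : ∀ ξ, l (-ξ) = l ξ)
    (hl : ∀ ξ, c₁ ^ 2 * (1 + ξ ^ 2) ^ (ρ / 2) ≤ l ξ ∧ l ξ ≤ c₂ ^ 2 * (1 + ξ ^ 2) ^ (ρ / 2))
    (g : ℝ → ℝ) (hg : ContDiff ℝ ((⌊ρ / 2⌋₊ + 1 : ℕ) : WithTop ℕ∞) g)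
    (hG : ∀ y : ℝ, 0 ≤ ∫ p in (0 : ℝ)..y, g p)
    (φ : NonlocalWave.H (ρ / 2)) (ψ : NonlocalWave.H (-1))
    (hψ : ∃ h : Lp ℂ 2 (volume : Measure ℝ),
      NonlocalWave.IsMultiplierImage (fun ξ => |ξ|⁻¹) (NonlocalWave.H.dist ψ) (h : 𝓢'(ℝ, ℂ)))
    (hφ : ∃ v : ℝ → ℝ, NonlocalWave.IsFunction (NonlocalWave.H.dist φ) (fun x => (v x : ℂ)) ∧
      Integrable (fun x => ∫ p in (0 : ℝ)..v x, g p)) :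
    ∃ u : ℝ → NonlocalWave.H (ρ / 2),
      NonlocalWave.IsGlobalSolution l g (by linarith : (-1 : ℝ) ≤ ρ / 2) φ ψ u ∧
      ∀ v : ℝ → NonlocalWave.H (ρ / 2),
        NonlocalWave.IsGlobalSolution l g (by linarith : (-1 : ℝ) ≤ ρ / 2) φ ψ v →
          ∀ t : ℝ, 0 ≤ t → v t = u t := by
  have h := NonlocalWave.isElliptic_of_bounds hρ hc₁ hc₂ hl_meas hl_even hl
  have hg2 : ContDiff ℝ 2 g := by
    refine hg.of_le ?_
    have h1 : 1 ≤ ⌊ρ / 2⌋₊ := Nat.le_floor (by push_cast; linarith)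
    exact_mod_cast Nat.succ_le_succ h1
  have g0 := NonlocalWave.eq_zero_of_primitive_nonneg hg2.continuous hG
  obtain ⟨h₁, hψ⟩ := hψ
  obtain ⟨h₀, hJ, hψ₀⟩ := NonlocalWave.exists_initial_momentum hψ
  obtain ⟨y, y0, hy⟩ := NonlocalWave.exists_global_interaction h hg2 g0 hG
    (NonlocalWave.amp (fun ξ => l (2 * Real.pi * ξ)) φ - Complex.I • h₀)
  obtain ⟨u, u', hu⟩ := NonlocalWave.exists_solvesWith h (fun _ => rfl) hg2 g0 (by linarith)
    hJ hψ₀ y0 hy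
  refine ⟨u, ⟨u', hu⟩, fun v ⟨v', hv⟩ t ht => ?_⟩
  exact NonlocalWave.SolvesWith.unique h (fun _ => rfl) hg2 g0 hJ hψ₀ hu hv ht
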